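/- All graphs are finite and simple. A generalized Halin graph is a graph obtained from a plane tree $T$ with at least three vertices (a tree embedded in the plane, in which vertices of degree 2 are allowed) by adding a cycle that connects the leaves of $T$ in their cyclic order, i.e. by joining any two cyclically consecutive leaves by an edge (if $T$ is a path, this means that its two leaves are joined by one edge, so that the resulting graph is a cycle). Let $G$ be a graph with a fixed, arbitrary orientation. Let $A_G$ be the matrix whose rows are indexed by the edges and whose columns are indexed by the vertices and edges of $G$, such that for an edge $e$ oriented from $u$ to $v$, $A_G[e,z]=1$ if $z=v$ or $z\neq e$ is an edge incident to $v$; $A_G[e,z]=-1$ if $z=u$ or $z\ne e$ is an edge incident to $u$; and $A_G[e,z]=0$ otherwise. An $(a,b)$-matrix of $G$ is a square matrix whose columns are columns of $A_G$, in which each column indexed by a vertex occurs at most $a$ times and each column indexed by an edge occurs at most $b$ times. A square matrix is permanent-non-singular if its permanent is nonzero. The graph $G$ is $(k,k')$-choosable if, whenever each vertex is given a set of $k$ real numbers and each edge a set of $k'$ real numbers, one can choose for each vertex and edge $z$ a weight $\phi(z)$ from its set such that $\phi(u)+\sum_{e\ni u}\phi(e)\neq\phi(v)+\sum_{e\ni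 v}\phi(e)$ for every edge $uv$. Theorem. Every generalized Halin graph has a permanent-non-singular $(0,2)$-matrix (for every choice of the orientation). Consequently, every generalized Halin graph is $(1,3)$-choosable. -/

import Mathlib

namespace Halin

/-! ### Plane trees and generalized Halin graphs -/

/-- A plane tree on the vertex set `V`, given by its rotation system: a tree together with a
permutation `rot` of its darts (edges with a direction) whose cycles are exactly the sets of darts
leaving a common vertex. So `rot d` is the dart that follows `d` in the (say, clockwise) cyclic
order of the edges around the vertex `d.fst`. -/
structure PlaneTree (V : Type*) where
  /-- the underlying tree -/
  tree : SimpleGraph V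
  isTree : tree.IsTree
  /-- the next dart around the same vertex -/
  rot : Equiv.Perm tree.Dart
  rot_fst : ∀ d, (rot d).fst = d.fst
  rot_sameCycle : ∀ d d' : tree.Dart, d.fst = d'.fst → rot.SameCycle d d'

namespace PlaneTree

variable {V : Type*} (T : PlaneTree V)

/-- A leaf is a vertex with exactly one neighbour in the tree. -/
def IsLeaf (v : V) : Prop := ∃! w, T.tree.Adj v w

/-- One step of the walk around the tree (along the boundary of its only face): after traversing
`d`, leave the vertex `d.snd` through the dart that follows the reverse of `d` in the rotation. -/
def faceStep (d : T.tree.Dart) : T.tree.Dart := T.rot d.symm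

/-- `v` is the first leaf reached after the leaf `u` by the walk around the tree, i.e. `v` is the
successor of `u` in the cyclic order of the leaves of the plane tree. -/
def NextLeaf (u v : V) : Prop :=
  T.IsLeaf u ∧ T.IsLeaf v ∧ ∃ d : T.tree.Dart, d.fst = u ∧ ∃ n : ℕ, 0 < n ∧
    (T.faceStep^[n] d).fst = v ∧ ∀ k, 0 < k → k < n → ¬ T.IsLeaf (T.faceStep^[k] d).fst

/-- The graph obtained from a plane tree by joining cyclically consecutive leaves.
(If the tree is a path, its two leaves are joined by one edge.) -/
def closure : SimpleGraph V := T.tree ⊔ SimpleGraph.fromRel T.NextLeaf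

end PlaneTree

/-- A generalized Halin graph: a plane tree (vertices of degree 2 are allowed) together with
a cycle through its leaves in their cyclic order. The tree has at least three vertices. -/
def IsGeneralizedHalin {V : Type*} [Fintype V] (G : SimpleGraph V) : Prop :=
  3 ≤ Fintype.card V ∧ ∃ T : PlaneTree V, G = T.closure

/-! ### The matrix `A_G` and `(a, b)`-matrices -/

/-- An orientation of `G`: each edge gets a tail and a head. -/
structure Orientation {V : Type*} (G : SimpleGraph V) where
  tail : G.edgeSet → V
  head : G.edgeSet → V
  mk_eq : ∀ e, s(tail e, head e) = (e : Sym2 V)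

section Matrix

variable {V : Type*} [Fintype V] [DecidableEq V] {G : SimpleGraph V} [DecidableRel G.Adj]

/-- The matrix `A_G` of `G` with respect to the orientation `D`. Its rows are indexed by the edges,
its columns by the vertices (`Sum.inl`) and the edges (`Sum.inr`). -/
def incMatrix (D : Orientation G) : Matrix G.edgeSet (V ⊕ G.edgeSet) ℤ := fun e z =>
  match z with
  | .inl v => if v = D.head e then 1 else if v = D.tail e then -1 else 0
  | .inr f =>
      if f = e then 0
      else if D.head e ∈ (f : Sym2 V) then 1
      else if D.tail e ∈ (f : Sym2 V) then -1
      else 0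

/-- The square matrix `M` is of the form `A_G(η)`: each column of `M` is a column of `A_G`, and the
column `A_G(z)` is used `η z` times. In particular, the sum of `η` is the number of edges. -/
def IsColumnMatrix (D : Orientation G) (η : V ⊕ G.edgeSet → ℕ)
    (M : Matrix G.edgeSet G.edgeSet ℤ) : Prop :=
  ∃ c : G.edgeSet → V ⊕ G.edgeSet,
    (∀ z, (Finset.univ.filter fun j => c j = z).card = η z) ∧
      ∀ e j, M e j = incMatrix D e (c j)

/-- `M` is an `(a, b)`-matrix of `G` (with respect to the orientation `D`). -/
def IsABMatrix (D : Orientation G) (a b : ℕ) (M : Matrix G.edgeSet G.edgeSet ℤ) : Prop :=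
  ∃ η : V ⊕ G.edgeSet → ℕ, (∀ v, η (.inl v) ≤ a) ∧ (∀ e, η (.inr e) ≤ b) ∧ IsColumnMatrix D η M

variable (G) in
/-- `G` has a permanent-non-singular `(a, b)`-matrix, whatever orientation of `G` is fixed. -/
def HasPermanentNonsingularMatrix (a b : ℕ) : Prop :=
  ∀ D : Orientation G, ∃ M : Matrix G.edgeSet G.edgeSet ℤ, IsABMatrix D a b M ∧ M.permanent ≠ 0

/-! ### Total weightings and choosability -/

/-- The sum of the weight of `v` and the weights of the edges incident to `v`. -/
def weightSum (φ : V ⊕ G.edgeSet → ℝ) (v : V) : ℝ :=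
  (∑ e ∈ Finset.univ.filter (fun e : G.edgeSet => v ∈ (e : Sym2 V)), φ (.inr e)) + φ (.inl v)

/-- A total weighting is proper if adjacent vertices have different sums. -/
def IsProper (φ : V ⊕ G.edgeSet → ℝ) : Prop :=
  ∀ u v, G.Adj u v → weightSum φ u ≠ weightSum φ v

variable (G) in
/-- `G` is `(k, k')`-choosable: for any sets of `k` real numbers at the vertices and of `k'` real
numbers at the edges there is a proper total weighting with weights from these sets. -/
def IsChoosable (k k' : ℕ) : Prop :=
  ∀ L : V ⊕ G.edgeSet → Finset ℝ,
    (∀ v, (L (.inl v)).card = k) → (∀ e, (L (.inr e)).card = k') →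
      ∃ φ : V ⊕ G.edgeSet → ℝ, (∀ z, φ z ∈ L z) ∧ IsProper φ

end Matrix

end Halin

set_option linter.unusedSectionVars false

/-! Let `edgePoly` be the product, over the edges, of the differences of the two end sums, in the
edge weights. Up to a positive factor, a coefficient of it is the permanent of a matrix built from
edge columns (`permanent_columns`). So it suffices that over some commutative ring `edgePoly` lies
outside the ideal generated by the cubes of the variables: a monomial with exponents at most 2 then
survives, and it has a nonzero integer coefficient. The Combinatorial Nullstellensatz turns the same
monomial into choosability.

Non-membership is tested by substitution: the weights become polynomials whose cubes lie in a cube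
ideal (`Realizable.edgePoly_notMem`). In characteristic 3 every linear form qualifies, by Frobenius.
If the graph is not bipartite, the vertex sums can be arbitrary linear forms; if it is bipartite
with signs ε, they must satisfy Σ ε x = 0. A common translation does not affect differences, so this
constraint matters only when Σ ε = 0 mod 3 (`realizable_or_exists_sign`).

With free vertex sums, the forms at internal vertices are chosen so that each internal tree edge
contributes a single variable, and the leaves get their variables with alternating signs. The rim
and pendant edges become a path polynomial, whose coefficients at squared leaf variables are
explicit (`tops_X_mul_pathPoly`, `tops_X_mul_X_mul_pathPoly`). This settles an even number of
leaves, and an odd number when two consecutive leaves have different neighbours. What remains is an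
odd wheel, which is computed over ℤ by eliminating rim vertices two at a time.

In the balanced bipartite case no two leaves are consecutive around a vertex, since this would
create a triangle. Hence extremal internal vertices are legs: vertices of degree 2 between a leaf
and an internal vertex. The form at one leg is used to satisfy the balance condition. Extracting
squares (`tops_leg`) leaves a combination of independent linear forms whose coefficients depend mod
3 on the number and the positions of the leaves. Two internal vertices at maximal distance give legs
at both ends. If none of the resulting criteria applied, there would be four legs whose leaves have
pairwise incongruent positions mod 3. -/

namespace Halin

open MvPolynomial

/-! ### The cube ideal and the extraction of squared variables -/

section CubeIdeal

variable {K : Type*} {R : Type*} [CommRing R]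

/-- The ideal generated by the cubes of the variables. -/
noncomputable def cubeIdeal (K R : Type*) [CommRing R] : Ideal (MvPolynomial K R) :=
  Ideal.span ((fun m => monomial m (1 : R)) '' Set.range fun k : K => Finsupp.single k 3)

theorem mem_cubeIdeal {p : MvPolynomial K R} :
    p ∈ cubeIdeal K R ↔ ∀ m ∈ p.support, ∃ k, 3 ≤ m k := by
  rw [cubeIdeal, mem_ideal_span_monomial_image]
  simp [Finsupp.single_le_iff]

theorem X_pow_three_mem (k : K) : (X k : MvPolynomial K R) ^ 3 ∈ cubeIdeal K R := by
  classical
  rw [mem_cubeIdeal]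
  intro m hm
  rw [mem_support_iff, coeff_X_pow] at hm
  refine ⟨k, ?_⟩
  by_contra h
  refine hm (if_neg ?_)
  rintro rfl
  simp at h

theorem cubeIdeal_eq_span : cubeIdeal K R = Ideal.span (Set.range fun k => X k ^ 3) := by
  rw [cubeIdeal, ← Set.range_comp]
  congr 1
  ext p
  simp [X_pow_eq_monomial]

theorem notMem_cubeIdeal_of_coeff {p : MvPolynomial K R} (m : K →₀ ℕ) (hm : ∀ k, m k ≤ 2)
    (h : coeff m p ≠ 0) : p ∉ cubeIdeal K R := by
  rw [mem_cubeIdeal]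
  push Not
  exact ⟨m, by simpa using h, fun k => Nat.lt_succ_of_le (hm k)⟩

theorem exists_coeff_ne_zero {p : MvPolynomial K R} (h : p ∉ cubeIdeal K R) :
    ∃ m : K →₀ ℕ, (∀ k, m k ≤ 2) ∧ coeff m p ≠ 0 := by
  rw [mem_cubeIdeal] at h
  push Not at h
  obtain ⟨m, hm, hk⟩ := h
  exact ⟨m, fun k => Nat.le_of_lt_succ (hk k), by simpa using hm⟩

open Classical in
/-- Substitution of zero for the variable `k`. -/
noncomputable def zeroAt (k : K) : MvPolynomial K R →ₐ[R] MvPolynomial K R :=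
  aeval (fun j => if j = k then 0 else X j)

@[simp] theorem zeroAt_X_self (k : K) : zeroAt k (X k : MvPolynomial K R) = 0 := by simp [zeroAt]

theorem zeroAt_X_of_ne {j k : K} (h : j ≠ k) : zeroAt k (X j : MvPolynomial K R) = X j := by
  simp [zeroAt, h]

/-- The polynomial `c` does not involve the variable `k` (expressed through the two operators
which are used to extract coefficients). -/
structure Free (k : K) (c : MvPolynomial K R) : Prop where
  pderiv_eq : pderiv k c = 0
  zeroAt_eq : zeroAt k c = c

variable {k : K} {c d : MvPolynomial K R}

theorem Free.add (hc : Free k c) (hd : Free k d) : Free k (c + d) :=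
  ⟨by simp [hc.pderiv_eq, hd.pderiv_eq], by simp [hc.zeroAt_eq, hd.zeroAt_eq]⟩

theorem Free.mul (hc : Free k c) (hd : Free k d) : Free k (c * d) :=
  ⟨by simp [hc.pderiv_eq, hd.pderiv_eq], by simp [hc.zeroAt_eq, hd.zeroAt_eq]⟩

theorem Free.C (a : R) : Free k (C a : MvPolynomial K R) := ⟨by simp, by simp [zeroAt]⟩

theorem Free.zero : Free k (0 : MvPolynomial K R) := ⟨by simp, by simp⟩

theorem Free.one : Free k (1 : MvPolynomial K R) := ⟨by simp, by simp⟩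

theorem Free.natCast (n : ℕ) : Free k (n : MvPolynomial K R) := by
  simpa using Free.C (k := k) (n : R)

theorem Free.neg (hc : Free k c) : Free k (-c) :=
  ⟨by simp [hc.pderiv_eq], by simp [hc.zeroAt_eq]⟩

theorem Free.sub (hc : Free k c) (hd : Free k d) : Free k (c - d) :=
  ⟨by simp [hc.pderiv_eq, hd.pderiv_eq], by simp [hc.zeroAt_eq, hd.zeroAt_eq]⟩

theorem Free.X {j : K} (h : j ≠ k) : Free k (X j : MvPolynomial K R) :=
  ⟨pderiv_X_of_ne h, zeroAt_X_of_ne h⟩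

theorem Free.pow (hc : Free k c) (n : ℕ) : Free k (c ^ n) := by
  induction n with
  | zero => simpa using Free.one
  | succ n ih => rw [pow_succ]; exact ih.mul hc

theorem Free.sum {ι : Type*} (s : Finset ι) {f : ι → MvPolynomial K R}
    (h : ∀ i ∈ s, Free k (f i)) : Free k (∑ i ∈ s, f i) :=
  ⟨by rw [map_sum]; exact Finset.sum_eq_zero fun i hi => (h i hi).pderiv_eq,
    by rw [map_sum]; exact Finset.sum_congr rfl fun i hi => (h i hi).zeroAt_eq⟩

theorem Free.prod {ι : Type*} (s : Finset ι) {f : ι → MvPolynomial K R}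
    (h : ∀ i ∈ s, Free k (f i)) : Free k (∏ i ∈ s, f i) := by
  classical
  induction s using Finset.induction_on with
  | empty => simpa using Free.one
  | insert a s ha ih =>
    rw [Finset.prod_insert ha]
    exact (h a (by simp)).mul (ih fun i hi => h i (by simp [hi]))

/-- Twice the coefficient of the square of the variable `k`: the second derivative with respect
to `k`, at zero. -/
noncomputable def top (k : K) : MvPolynomial K R →ₗ[R] MvPolynomial K R :=
  (zeroAt k).toLinearMap ∘ₗ (pderiv k).toLinearMap ∘ₗ (pderiv k).toLinearMap

theorem top_apply (k : K) (p : MvPolynomial K R) : top k p = zeroAt k (pderiv k (pderiv k p)) :=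
  rfl

theorem top_mul (hc : Free k c) (p : MvPolynomial K R) : top k (c * p) = c * top k p := by
  simp [top_apply, hc.pderiv_eq, hc.zeroAt_eq]

theorem top_poly {c₀ c₁ c₂ c₃ c₄ : MvPolynomial K R} (h₀ : Free k c₀) (h₁ : Free k c₁)
    (h₂ : Free k c₂) (h₃ : Free k c₃) (h₄ : Free k c₄) :
    top k (c₀ + c₁ * X k + c₂ * X k ^ 2 + c₃ * X k ^ 3 + c₄ * X k ^ 4) = 2 * c₂ := by
  simp only [map_add, top_mul h₁, top_mul h₂, top_mul h₃, top_mul h₄]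
  rw [← mul_one c₀, top_mul h₀]
  have h2 : zeroAt k (2 : MvPolynomial K R) = 2 := map_ofNat _ 2
  simp [top_apply, h2]
  ring

/-- Two derivatives of a multiple of X k ^ 3 still leave a factor X k, which vanishes at zero, while
the cubes of the other variables are constants for `top k`. -/
theorem top_mem {p : MvPolynomial K R} (hp : p ∈ cubeIdeal K R) : top k p ∈ cubeIdeal K R := by
  -- `top k` is not linear over polynomials, so the induction over the span must carry an arbitrary
  -- multiplier.
  suffices h : ∀ a, top k (a * p) ∈ cubeIdeal K R by simpa using h 1
  rw [cubeIdeal_eq_span] at hp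
  induction hp using Submodule.span_induction with
  | mem x hx =>
    obtain ⟨j, rfl⟩ := hx
    intro a
    by_cases h : j = k
    · subst h; simp [top_apply]
    · rw [mul_comm, top_mul ((Free.X (R := R) h).pow 3)]
      exact Ideal.mul_mem_right _ _ (X_pow_three_mem j)
  | zero => simp
  | add x y _ _ hx hy => intro a; rw [mul_add, map_add]; exact add_mem (hx a) (hy a)
  | smul b x _ hx => intro a; rw [smul_eq_mul, ← mul_assoc]; exact hx _

end CubeIdeal

/-! ### Leaf coefficients of a path with pendant edges -/

section Path

variable {K : Type*} {R : Type*} [CommRing R] (w : ℕ → K) (P : ℕ → MvPolynomial K R)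

/-- The product of the sums along the edges of a path `w 0, …, w n` with a pendant edge at each of
its vertices. -/
noncomputable def pathPoly (n : ℕ) : MvPolynomial K R :=
  (∏ j ∈ Finset.range n, (X (w j) + X (w (j + 1)))) * ∏ j ∈ Finset.range (n + 1), (X (w j) + P j)

/-- Extraction of the squares of the variables `w n, …, w 0`. -/
noncomputable def tops : ℕ → MvPolynomial K R →ₗ[R] MvPolynomial K R
  | 0 => top (w 0)
  | n + 1 => tops n ∘ₗ top (w (n + 1))

variable {w P}

theorem tops_mem (n : ℕ) {p : MvPolynomial K R} (hp : p ∈ cubeIdeal K R) :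
    tops w n p ∈ cubeIdeal K R := by
  induction n generalizing p with
  | zero => exact top_mem hp
  | succ n ih => exact ih (top_mem hp)

theorem tops_mul (n : ℕ) {c : MvPolynomial K R} (hc : ∀ j ≤ n, Free (w j) c)
    (p : MvPolynomial K R) : tops w n (c * p) = c * tops w n p := by
  induction n generalizing p with
  | zero => exact top_mul (hc 0 le_rfl) p
  | succ n ih =>
    simp only [tops, LinearMap.comp_apply]
    rw [top_mul (hc _ le_rfl), ih fun j hj => hc j (by omega)]

theorem pathPoly_succ (n : ℕ) : pathPoly w P (n + 1) =
    pathPoly w P n * ((X (w n) + X (w (n + 1))) * (X (w (n + 1)) + P (n + 1))) := by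
  simp only [pathPoly, Finset.prod_range_succ]
  ring

variable {N : ℕ} (hw : ∀ i ≤ N, ∀ j ≤ N, w i = w j → i = j)
  (hP : ∀ i ≤ N, ∀ j ≤ N, Free (w j) (P i))

include hw in
theorem free_X_of_ne {i j : ℕ} (hi : i ≤ N) (hj : j ≤ N) (h : i ≠ j) :
    Free (w j) (X (w i) : MvPolynomial K R) :=
  Free.X fun e => h (hw i hi j hj e)

include hw hP in
theorem free_pathPoly {n j : ℕ} (hn : n < j) (hj : j ≤ N) : Free (w j) (pathPoly w P n) := by
  refine Free.mul (Free.prod _ fun i hi => ?_) (Free.prod _ fun i hi => ?_)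
  · rw [Finset.mem_range] at hi
    exact (free_X_of_ne hw (by omega) hj (by omega)).add
      (free_X_of_ne hw (by omega) hj (by omega))
  · rw [Finset.mem_range] at hi
    exact (free_X_of_ne hw (by omega) hj (by omega)).add (hP _ (by omega) _ hj)

/-- The last vertex of a path enters through a quadratic in its own variable. Multiplying by 1, X k
or X k ^ 2 picks out one of its three coefficients; this drives every induction on the path. -/
theorem top_mul_quadratic {k : K} {a b c : MvPolynomial K R} (ha : Free k a) (hb : Free k b)
    (hc : Free k c) :
    top k (c * ((a + X k) * (X k + b))) = 2 * c ∧
      top k (X k * (c * ((a + X k) * (X k + b)))) = 2 * ((a + b) * c) ∧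
      top k (X k ^ 2 * (c * ((a + X k) * (X k + b)))) = 2 * (a * b * c) := by
  have h0 := Free.zero (R := R) (k := k)
  refine ⟨?_, ?_, ?_⟩
  · rw [← top_poly (c₂ := c) ((ha.mul hb).mul hc) ((ha.add hb).mul hc) hc h0 h0]
    congr 1; ring
  · rw [← top_poly (c₂ := (a + b) * c) h0 ((ha.mul hb).mul hc) ((ha.add hb).mul hc) hc h0]
    congr 1; ring
  · rw [← top_poly (c₂ := a * b * c) h0 h0 ((ha.mul hb).mul hc) ((ha.add hb).mul hc) hc]
    congr 1; ring

theorem top_mul_linear {k : K} {b : MvPolynomial K R} (hb : Free k b) :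
    top k (X k + b) = 0 ∧ top k (X k * (X k + b)) = 2 ∧ top k (X k ^ 2 * (X k + b)) = 2 * b := by
  have h0 := Free.zero (R := R) (k := k)
  have h1 := Free.one (R := R) (k := k)
  refine ⟨?_, ?_, ?_⟩
  · rw [← mul_zero 2, ← top_poly hb h1 h0 h0 h0]
    congr 1; ring
  · rw [← mul_one 2, ← top_poly h0 hb h1 h0 h0]
    congr 1; ring
  · rw [← top_poly h0 h0 hb h1 h0]
    congr 1; ring

-- There are only 2n + 1 factors for the 2n + 2 occurrences of variables that are extracted.
include hw hP in
theorem tops_pathPoly {n : ℕ} (hn : n ≤ N) : tops w n (pathPoly w P n) = 0 := by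
  induction n with
  | zero =>
    have := (top_mul_linear (hP 0 hn 0 hn)).1
    simpa [tops, pathPoly] using this
  | succ n ih =>
    simp only [tops, LinearMap.comp_apply]
    rw [pathPoly_succ, (top_mul_quadratic (free_X_of_ne hw (by omega) hn (by omega))
      (hP _ hn _ hn) (free_pathPoly hw hP (Nat.lt_succ_self n) hn)).1, two_mul, map_add,
      ih (by omega), add_zero]

theorem tops_two_mul (n : ℕ) (p : MvPolynomial K R) : tops w n (2 * p) = 2 * tops w n p := by
  rw [two_mul, map_add, two_mul]

-- One extra factor makes the degree exact, so the pendant forms cannot contribute. The value does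
-- not depend on which vertex supplies the factor; this independence causes the cancellation for an
-- odd number of leaves.
include hw hP in
theorem tops_X_mul_pathPoly {n b : ℕ} (hn : n ≤ N) (hb : b ≤ n) :
    tops w n (X (w b) * pathPoly w P n) = 2 ^ (n + 1) := by
  induction n generalizing b with
  | zero =>
    obtain rfl : b = 0 := by omega
    have := (top_mul_linear (hP 0 hn 0 hn)).2.1
    simpa [tops, pathPoly] using this
  | succ n ih =>
    have key := top_mul_quadratic (free_X_of_ne (R := R) hw (by omega : n ≤ N) hn (by omega))
      (hP _ hn _ hn) (free_pathPoly hw hP (Nat.lt_succ_self n) hn)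
    simp only [tops, LinearMap.comp_apply]
    rw [pathPoly_succ]
    rcases Nat.lt_or_ge b (n + 1) with h | h
    · rw [top_mul (free_X_of_ne hw (by omega) hn (by omega)), key.1, mul_left_comm,
        tops_two_mul, ih (by omega) (by omega)]
      ring
    · obtain rfl : b = n + 1 := by omega
      rw [key.2.1, add_mul, tops_two_mul, map_add, tops_mul n fun j hj => hP _ hn _ (by omega),
        tops_pathPoly hw hP (by omega), ih (by omega) le_rfl]
      ring

-- With two extra factors the degree is exceeded by one, so exactly one pendant form survives, and
-- it is one hanging between the two marked vertices.
include hw hP in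
theorem tops_X_mul_X_mul_pathPoly {n b c : ℕ} (hn : n ≤ N) (hb : b ≤ c) (hc : c ≤ n) :
    tops w n (X (w b) * (X (w c) * pathPoly w P n)) =
      2 ^ (n + 1) * ∑ s ∈ Finset.Icc b c, P s := by
  induction n generalizing b c with
  | zero =>
    obtain rfl : b = 0 := by omega
    obtain rfl : c = 0 := by omega
    have := (top_mul_linear (hP 0 hn 0 hn)).2.2
    simpa [tops, pathPoly, pow_two, mul_assoc] using this
  | succ n ih =>
    have key := top_mul_quadratic (free_X_of_ne (R := R) hw (by omega : n ≤ N) hn (by omega))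
      (hP _ hn _ hn) (free_pathPoly hw hP (Nat.lt_succ_self n) hn)
    have hPn : ∀ j ≤ n, Free (w j) (P (n + 1)) := fun j hj => hP _ hn _ (by omega)
    simp only [tops, LinearMap.comp_apply]
    rw [pathPoly_succ]
    rcases Nat.lt_or_ge c (n + 1) with h | h
    · rw [top_mul (free_X_of_ne hw (by omega) hn (by omega)),
        top_mul (free_X_of_ne hw (by omega) hn (by omega)), key.1, mul_left_comm (X (w c)),
        mul_left_comm, tops_two_mul, ih (by omega) hb (by omega)]
      ring
    · obtain rfl : c = n + 1 := by omega
      rcases Nat.lt_or_ge b (n + 1) with h | h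
      · rw [top_mul (free_X_of_ne hw (by omega) hn (by omega)), key.2.1, mul_left_comm,
          tops_two_mul, add_mul, mul_add, map_add, ih (by omega) (by omega) le_rfl, mul_left_comm,
          tops_mul n hPn, tops_X_mul_pathPoly hw hP (by omega) (by omega),
          Finset.sum_Icc_succ_top (by omega)]
        ring
      · obtain rfl : b = n + 1 := by omega
        rw [← mul_assoc (X _), ← pow_two, key.2.2, tops_two_mul, mul_comm (X (w n)), mul_assoc,
          tops_mul n hPn, tops_X_mul_pathPoly hw hP (by omega) le_rfl]
        simp
        ring

end Path

end Halin

namespace Halin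

open MvPolynomial

/-! ### Permanents as coefficients of products of linear forms -/

section Permanent

variable {ι κ R : Type*} [Fintype ι] [CommRing R]

/-- The exponent of the product of the variables `g i`. -/
noncomputable def exponent (g : ι → κ) : κ →₀ ℕ := ∑ i, Finsupp.single (g i) 1

theorem exponent_apply [DecidableEq κ] (g : ι → κ) (k : κ) :
    exponent g k = (Finset.univ.filter fun i => g i = k).card := by
  rw [exponent, Finsupp.finsetSum_apply, Finset.card_filter]
  simp [Finsupp.single_apply]

theorem degree_exponent (g : ι → κ) : (exponent g).degree = Fintype.card ι := by
  simp [exponent, Finsupp.degree_single]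

theorem coeff_prod_linear [Fintype κ] [DecidableEq ι] [DecidableEq κ] (A : Matrix ι κ R) (m : κ →₀ ℕ) :
    coeff m (∏ i, ∑ j, C (A i j) * X j) =
      ∑ g : ι → κ, if exponent g = m then ∏ i, A i (g i) else 0 := by
  rw [Finset.prod_univ_sum, coeff_sum, Fintype.piFinset_univ]
  refine Finset.sum_congr rfl fun g _ => ?_
  rw [Finset.prod_mul_distrib, ← map_prod, coeff_C_mul]
  have : (∏ i, X (g i) : MvPolynomial κ R) = monomial (exponent g) 1 := by
    simp [exponent, monomial_sum_one, X]
  rw [this, coeff_monomial]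
  split_ifs <;> simp

/-- Equal exponents mean fibres of equal size, and bijections between fibres glue to a permutation.
-/
theorem exists_perm_of_exponent_eq {g h : ι → κ} (e : exponent g = exponent h) :
    ∃ τ : Equiv.Perm ι, h ∘ τ = g := by
  classical
  have key : ∀ k, Nonempty ({ a // g a = k } ≃ { b // h b = k }) := by
    intro k
    refine ⟨Fintype.equivOfCardEq ?_⟩
    have h := DFunLike.congr_fun e k
    rw [exponent_apply, exponent_apply] at h
    rw [Fintype.card_subtype, Fintype.card_subtype]
    convert h
  let f := fun k => (key k).some
  exact ⟨Equiv.ofFiberEquiv fun k => f k, funext fun a => Equiv.ofFiberEquiv_map _ a⟩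

theorem exponent_comp_perm (g : ι → κ) (σ : Equiv.Perm ι) : exponent (g ∘ σ) = exponent g :=
  Equiv.sum_comp σ fun i => Finsupp.single (g i) 1

/-- The permanent sums over permutations, the coefficient over distinct rearrangements of the column
choice. Each rearrangement arises from a coset of the stabilizer of `c`, hence the factor, which is
a positive integer. -/
theorem permanent_columns [Fintype κ] [DecidableEq ι] [DecidableEq κ] (A : Matrix ι κ R) (c : ι → κ) :
    Matrix.permanent (fun i j => A i (c j)) =
      ((Finset.univ.filter fun σ : Equiv.Perm ι => c ∘ σ = c).card : R) *
        coeff (exponent c) (∏ i, ∑ j, C (A i j) * X j) := by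
  have h1 : Matrix.permanent (fun i j => A i (c j)) =
      ∑ σ : Equiv.Perm ι, ∏ i, A i ((c ∘ σ) i) := by
    unfold Matrix.permanent
    rw [← Equiv.sum_comp (Equiv.inv _)]
    refine Finset.sum_congr rfl fun σ _ => ?_
    rw [← Equiv.prod_comp σ]
    simp
  rw [h1, coeff_prod_linear, Finset.mul_sum,
    ← Finset.sum_fiberwise_of_maps_to (t := Finset.univ) (g := fun σ : Equiv.Perm ι => c ∘ σ)
      (fun _ _ => Finset.mem_univ _)]
  refine Finset.sum_congr rfl fun g _ => ?_
  split_ifs with h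
  · obtain ⟨τ, rfl⟩ := exists_perm_of_exponent_eq h
    have : (Finset.univ.filter fun σ : Equiv.Perm ι => c ∘ σ = c ∘ τ).card =
        (Finset.univ.filter fun σ : Equiv.Perm ι => c ∘ σ = c).card := by
      refine Finset.card_equiv (Equiv.mulRight τ⁻¹) fun σ => ?_
      simp only [Finset.mem_filter_univ, Equiv.coe_mulRight, Equiv.Perm.coe_mul]
      constructor
      · intro h; rw [← Function.comp_assoc, h]; ext; simp
      · intro h
        conv_rhs => rw [← h]
        ext; simp
    rw [← this, ← nsmul_eq_mul, ← Finset.sum_const]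
    refine Finset.sum_congr rfl fun σ hσ => ?_
    rw [(Finset.mem_filter.mp hσ).2]
  · rw [mul_zero]
    refine Finset.sum_eq_zero fun σ hσ => absurd ?_ h
    rw [← (Finset.mem_filter.mp hσ).2, exponent_comp_perm]

/-- Choosing a constant in any factor lowers the degree, so constants do not affect top-degree
coefficients. This is how vertex weights fixed in advance become harmless. -/
theorem coeff_prod_linear_add_C (L : ι → MvPolynomial κ R) (hL : ∀ i, (L i).IsHomogeneous 1)
    (b : ι → R) (m : κ →₀ ℕ) (hm : m.degree = Fintype.card ι) :
    coeff m (∏ i, (L i + C (b i))) = coeff m (∏ i, L i) := by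
  classical
  rw [Fintype.prod_add, coeff_sum, Finset.sum_eq_single Finset.univ]
  · simp
  · intro t _ ht
    rw [← map_prod, mul_comm, coeff_C_mul]
    have h := IsHomogeneous.prod t L (fun _ => 1) fun i _ => hL i
    have h2 : coeff m (∏ i ∈ t, L i) = 0 := by
      by_contra hne
      have := h hne
      rw [show Finsupp.weight (1 : κ → ℕ) m = m.degree by rw [Finsupp.degree_eq_weight_one]; rfl]
        at this
      simp only [Finset.sum_const, smul_eq_mul, mul_one] at this
      rw [hm] at this
      exact ht ((Finset.card_eq_iff_eq_univ t).mp this.symm)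
    rw [h2, mul_zero]
  · simp

end Permanent

/-! ### Reduction of both conclusions to non-membership in the cube ideal -/

section Reduction

variable {V : Type*} [Fintype V] [DecidableEq V] {G : SimpleGraph V} [DecidableRel G.Adj]

/-- The product over all edges of the differences of the weighted sums of the ends, as a polynomial
in the weights of the edges. -/
noncomputable def edgePoly (R : Type*) [CommRing R] (D : Orientation G) :
    MvPolynomial G.edgeSet R :=
  ∏ e, ∑ f, C ((incMatrix D e (.inr f) : ℤ) : R) * X f

/-- A coefficient over `R` is the image of the integer coefficient, so nonvanishing over any ring,
such as ZMod 3, passes to ℤ. -/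
theorem exists_coeff_edgePoly {R : Type*} [CommRing R] {D : Orientation G}
    (h : edgePoly R D ∉ cubeIdeal G.edgeSet R) :
    ∃ c : G.edgeSet → G.edgeSet, (∀ f, exponent c f ≤ 2) ∧
      coeff (exponent c) (∏ e, ∑ f, C (incMatrix D e (.inr f)) * X f) ≠ 0 := by
  obtain ⟨m, hm, hc⟩ := exists_coeff_ne_zero h
  have hmap : edgePoly R D =
      map (Int.castRingHom R) (∏ e, ∑ f, C (incMatrix D e (.inr f)) * X f) := by
    simp [edgePoly, map_prod, map_sum]
  rw [hmap, coeff_map] at hc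
  have hc' : coeff m (∏ e, ∑ f, C (incMatrix D e (.inr f)) * X f) ≠ 0 := fun h0 => hc (by rw [h0, map_zero])
  have := coeff_prod_linear (fun e f => incMatrix D e (.inr f)) m
  rw [this] at hc'
  obtain ⟨c, -, hcm⟩ := Finset.exists_ne_zero_of_sum_ne_zero hc'
  have hcm : exponent c = m := by
    by_contra hne
    exact hcm (if_neg hne)
  subst hcm
  refine ⟨c, hm, ?_⟩
  rw [this]
  exact hc'

theorem exists_isABMatrix {D : Orientation G} {c : G.edgeSet → G.edgeSet}
    (hc : ∀ f, exponent c f ≤ 2)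
    (h : coeff (exponent c) (∏ e, ∑ f, C (incMatrix D e (.inr f)) * X f) ≠ 0) :
    ∃ M : Matrix G.edgeSet G.edgeSet ℤ, IsABMatrix D 0 2 M ∧ M.permanent ≠ 0 := by
  refine ⟨fun e j => incMatrix D e (.inr (c j)), ⟨fun z => match z with
    | .inl _ => 0
    | .inr f => exponent c f, fun _ => le_rfl, hc, fun j => .inr (c j), ?_, fun _ _ => rfl⟩, ?_⟩
  · rintro (v | f)
    · simp
    · simp [exponent_apply]
  · have := permanent_columns (fun e f => incMatrix D e (.inr f)) c
    rw [this]
    refine mul_ne_zero ?_ h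
    rw [Nat.cast_ne_zero, Finset.card_ne_zero]
    exact ⟨1, by simp⟩

theorem tail_ne_head (D : Orientation G) (e : G.edgeSet) : D.tail e ≠ D.head e := by
  have h := e.2
  rw [← D.mk_eq e, SimpleGraph.mem_edgeSet] at h
  exact h.ne

theorem mem_edge_iff (D : Orientation G) (e : G.edgeSet) (v : V) :
    v ∈ (e : Sym2 V) ↔ v = D.tail e ∨ v = D.head e := by
  rw [← D.mk_eq e, Sym2.mem_iff]

/-- The exceptional case f = e disappears: both indicators are then 1 and cancel. -/
theorem incMatrix_inr (D : Orientation G) (e f : G.edgeSet) :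
    incMatrix D e (.inr f) =
      (if D.head e ∈ (f : Sym2 V) then 1 else 0) - if D.tail e ∈ (f : Sym2 V) then 1 else 0 := by
  unfold incMatrix
  by_cases hfe : f = e
  · subst hfe
    simp [mem_edge_iff D]
  · by_cases h1 : D.head e ∈ (f : Sym2 V) <;> by_cases h2 : D.tail e ∈ (f : Sym2 V)
    · exfalso
      refine hfe (Subtype.ext ?_)
      rw [← D.mk_eq e]
      exact (Sym2.mem_and_mem_iff (tail_ne_head D e)).mp ⟨h2, h1⟩
    all_goals simp [hfe, h1, h2]

/-- The sum of the weights of the edges at `v`. -/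
def starSum {A : Type*} [CommRing A] (y : G.edgeSet → A) (v : V) : A :=
  ∑ f ∈ Finset.univ.filter (fun f : G.edgeSet => v ∈ (f : Sym2 V)), y f

/-- Substitution of elements of an algebra for the edge weights in a row of the matrix. -/
theorem sum_incMatrix_mul {A : Type*} [CommRing A] (D : Orientation G) (e : G.edgeSet)
    (y : G.edgeSet → A) :
    ∑ f, (incMatrix D e (.inr f) : A) * y f =
      starSum y (D.head e) - starSum y (D.tail e) := by
  simp only [starSum, incMatrix_inr, Finset.sum_filter, ← Finset.sum_sub_distrib]
  refine Finset.sum_congr rfl fun f _ => ?_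
  split_ifs <;> simp

/-- The single weight at each vertex shifts each factor by a constant. The chosen monomial still has
a nonzero coefficient and top degree, and its exponents are below the list size 3, so the
Combinatorial Nullstellensatz applies. -/
theorem isChoosable_of_coeff {D : Orientation G} {c : G.edgeSet → G.edgeSet}
    (hc : ∀ f, exponent c f ≤ 2)
    (h : coeff (exponent c) (∏ e, ∑ f, C (incMatrix D e (.inr f)) * X f) ≠ 0) :
    IsChoosable G 1 3 := by
  intro L hV hE
  have hx : ∀ v, ∃ x, x ∈ L (.inl v) := fun v =>
    Finset.card_pos.mp (by rw [hV v]; norm_num)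
  choose x hx using hx
  set Lin : G.edgeSet → MvPolynomial G.edgeSet ℝ := fun e =>
    ∑ f, C ((incMatrix D e (.inr f) : ℤ) : ℝ) * X f with hLin
  have hhom : ∀ e, (Lin e).IsHomogeneous 1 := fun e =>
    IsHomogeneous.sum _ _ _ fun f _ => by
      simpa only [zero_add] using (isHomogeneous_C _ _).mul (isHomogeneous_X ℝ f)
  set F : MvPolynomial G.edgeSet ℝ := ∏ e, (Lin e + C (x (D.head e) - x (D.tail e))) with hF
  have hcoeff : coeff (exponent c) F ≠ 0 := by
    rw [hF, coeff_prod_linear_add_C _ hhom _ _ (degree_exponent c)]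
    have hmap : ∏ e, Lin e =
        map (Int.castRingHom ℝ) (∏ e, ∑ f, C (incMatrix D e (.inr f)) * X f) := by
      simp [hLin, map_prod, map_sum]
    rw [hmap, coeff_map]
    simpa using h
  have hdeg : F.totalDegree = (exponent c).degree := by
    apply le_antisymm
    · rw [degree_exponent]
      refine (totalDegree_finsetProd _ _).trans ?_
      refine (Finset.sum_le_card_nsmul _ _ 1 fun e _ => ?_).trans (by simp)
      refine (totalDegree_add _ _).trans ?_
      rw [totalDegree_C]
      exact max_le (hhom e).totalDegree_le zero_le_one
    · exact le_totalDegree (by simpa using hcoeff)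
  obtain ⟨s, hs, hne⟩ := combinatorial_nullstellensatz_exists_eval_nonzero F (exponent c) hcoeff
    hdeg (fun f => L (.inr f)) fun f => by rw [hE f]; exact Nat.lt_succ_of_le (hc f)
  refine ⟨Sum.elim x s, by rintro (v | e) <;> simp [hx, hs], ?_⟩
  set φ : V ⊕ G.edgeSet → ℝ := Sum.elim x s with hφ
  have key : ∀ e, weightSum φ (D.head e) ≠ weightSum φ (D.tail e) := by
    intro e heq
    refine hne ?_
    rw [hF, map_prod]
    refine Finset.prod_eq_zero (Finset.mem_univ e) ?_
    have := sum_incMatrix_mul D e s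
    simp only [hLin, map_add, map_sum, map_mul, eval_C, eval_X]
    rw [this]
    simp only [weightSum, hφ, Sum.elim_inl, Sum.elim_inr] at heq
    simp only [starSum]
    linarith
  intro u v huv
  obtain ⟨e, he⟩ : ∃ e : G.edgeSet, (e : Sym2 V) = s(u, v) := ⟨⟨s(u, v), huv⟩, rfl⟩
  rcases Sym2.eq_iff.mp ((D.mk_eq e).trans he) with ⟨rfl, rfl⟩ | ⟨rfl, rfl⟩
  · exact (key _).symm
  · exact key _

theorem exists_orientation (G : SimpleGraph V) : Nonempty (Orientation G) := by
  refine ⟨⟨fun e => (Quot.out e.1).1, fun e => (Quot.out e.1).2, fun e => ?_⟩⟩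
  exact Quot.out_eq e.1

theorem conclusion_of_notMem
    (h : ∀ D : Orientation G, ∃ (R : Type) (_ : CommRing R), edgePoly R D ∉ cubeIdeal G.edgeSet R) :
    HasPermanentNonsingularMatrix G 0 2 ∧ IsChoosable G 1 3 := by
  constructor
  · intro D
    obtain ⟨R, _, hR⟩ := h D
    obtain ⟨c, hc, hne⟩ := exists_coeff_edgePoly hR
    exact exists_isABMatrix hc hne
  · obtain ⟨D⟩ := exists_orientation G
    obtain ⟨R, _, hR⟩ := h D
    obtain ⟨c, hc, hne⟩ := exists_coeff_edgePoly hR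
    exact isChoosable_of_coeff hc hne

end Reduction

end Halin

namespace Halin

open MvPolynomial

/-! ### Substituting polynomials for edge weights -/

section Realize

variable {V : Type*} [Fintype V] [DecidableEq V] {G : SimpleGraph V} [DecidableRel G.Adj]
variable {K R : Type*} [CommRing R]

variable (G) in
/-- Up to a common translation, `x` is the family of vertex sums of edge weights whose cubes lie in
the ideal generated by the cubes of the variables. -/
def Realizable (x : V → MvPolynomial K R) : Prop :=
  ∃ (y : G.edgeSet → MvPolynomial K R) (c : MvPolynomial K R),
    (∀ f, y f ^ 3 ∈ cubeIdeal K R) ∧ ∀ v, x v + c = starSum y v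

/-- The substitution carries cubes into the cube ideal, and the common translation cancels in
differences. The index type may list an edge twice or contain superfluous pairs: extra factors only
make non-membership harder. -/
theorem Realizable.edgePoly_notMem {x : V → MvPolynomial K R} (hx : Realizable G x)
    (D : Orientation G) {J : Type*} [Fintype J] (a b : J → V)
    (hab : ∀ u v, G.Adj u v → ∃ j, (a j = u ∧ b j = v) ∨ (a j = v ∧ b j = u))
    (h : ∏ j, (x (a j) - x (b j)) ∉ cubeIdeal K R) : edgePoly R D ∉ cubeIdeal G.edgeSet R := by
  classical
  obtain ⟨y, c, hy, hxy⟩ := hx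
  intro hmem
  have h1 : aeval y (edgePoly R D) ∈ cubeIdeal K R := by
    have : cubeIdeal G.edgeSet R ≤ (cubeIdeal K R).comap (aeval y).toRingHom := by
      rw [cubeIdeal_eq_span, Ideal.span_le]
      rintro _ ⟨f, rfl⟩
      simpa using hy f
    exact this hmem
  have h2 : aeval y (edgePoly R D) = ∏ e, (x (D.head e) - x (D.tail e)) := by
    rw [edgePoly, map_prod]
    refine Finset.prod_congr rfl fun e _ => ?_
    rw [map_sum]
    have := sum_incMatrix_mul D e y
    rw [← hxy, ← hxy] at this
    simp only [map_mul, aeval_X, map_intCast]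
    rw [this]
    ring
  have hJ : ∀ e : G.edgeSet, ∃ j, (a j = D.tail e ∧ b j = D.head e) ∨
      (a j = D.head e ∧ b j = D.tail e) := fun e => hab _ _ (by
    have h := e.2
    rwa [← D.mk_eq e, SimpleGraph.mem_edgeSet] at h)
  choose j hj using hJ
  have hinj : Function.Injective j := by
    intro e e' hee
    refine Subtype.ext ?_
    rw [← D.mk_eq e, ← D.mk_eq e']
    have h1 := hj e
    have h2 := hj e'
    rw [hee] at h1
    rcases h1 with ⟨h1, h1'⟩ | ⟨h1, h1'⟩ <;> rcases h2 with ⟨h2, h2'⟩ | ⟨h2, h2'⟩ <;>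
      rw [← h1, ← h1', ← h2, ← h2'] <;> simp [Sym2.eq_swap]
  refine h ?_
  have hdvd : aeval y (edgePoly R D) ∣ ∏ j, (x (a j) - x (b j)) := by
    rw [h2, ← Finset.prod_mul_prod_compl (Finset.univ.image j),
      Finset.prod_image fun _ _ _ _ h => hinj h]
    refine Dvd.dvd.mul_right (Finset.prod_dvd_prod_of_dvd _ _ fun e _ => ?_) _
    rcases hj e with ⟨h1, h1'⟩ | ⟨h1, h1'⟩ <;> rw [h1, h1']
    rw [← neg_sub, neg_dvd]
  exact (cubeIdeal K R).mem_of_dvd hdvd h1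

end Realize

/-! ### Which families are vertex sums of edge weights -/

section Solve

variable {V : Type*} [Fintype V] [DecidableEq V] {G : SimpleGraph V} [DecidableRel G.Adj]
variable {A : Type*} [CommRing A]

/-- `x` is the family of vertex sums of edge weights in the ideal `I`. -/
def Solvable (G : SimpleGraph V) [DecidableRel G.Adj] (I : Ideal A) (x : V → A) : Prop :=
  ∃ y : G.edgeSet → A, (∀ f, y f ∈ I) ∧ ∀ v, starSum y v = x v

variable {I : Ideal A}

theorem Solvable.zero : Solvable G I 0 := ⟨0, by simp, by simp [starSum]⟩

theorem Solvable.add {x x' : V → A} (h : Solvable G I x) (h' : Solvable G I x') :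
    Solvable G I (x + x') := by
  obtain ⟨y, hy, hx⟩ := h
  obtain ⟨y', hy', hx'⟩ := h'
  refine ⟨y + y', fun f => I.add_mem (hy f) (hy' f), fun v => ?_⟩
  simp only [Pi.add_apply, ← hx v, ← hx' v, starSum, Finset.sum_add_distrib]

theorem Solvable.smul {x : V → A} (h : Solvable G I x) (a : A) : Solvable G I (a • x) := by
  obtain ⟨y, hy, hx⟩ := h
  refine ⟨a • y, fun f => I.mul_mem_left a (hy f), fun v => ?_⟩
  simp only [Pi.smul_apply, ← hx v, starSum, smul_eq_mul, Finset.mul_sum]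

theorem Solvable.sub {x x' : V → A} (h : Solvable G I x) (h' : Solvable G I x') :
    Solvable G I (x - x') := by
  simpa [sub_eq_add_neg] using h.add (h'.smul (-1))

theorem Solvable.sum {ι : Type*} (s : Finset ι) {x : ι → V → A}
    (h : ∀ i ∈ s, Solvable G I (x i)) : Solvable G I (∑ i ∈ s, x i) := by
  classical
  induction s using Finset.induction_on with
  | empty => simpa using Solvable.zero
  | insert a s ha ih =>
    rw [Finset.sum_insert ha]
    exact (h a (by simp)).add (ih fun i hi => h i (by simp [hi]))

theorem Solvable.of_adj {u v : V} (h : G.Adj u v) {m : A} (hm : m ∈ I) :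
    Solvable G I (Pi.single u m + Pi.single v m) := by
  refine ⟨Pi.single ⟨s(u, v), h⟩ m, fun f => ?_, fun w => ?_⟩
  · by_cases hf : f = ⟨s(u, v), h⟩
    · subst hf; simpa using hm
    · simp [hf]
  · rw [starSum, Finset.sum_filter, Finset.sum_eq_single ⟨s(u, v), h⟩
      (fun f _ hf => by simp [hf]) (by simp)]
    simp only [Sym2.mem_iff, Pi.add_apply, Pi.single_apply]
    have := h.ne
    by_cases h1 : w = u <;> by_cases h2 : w = v <;> simp_all

/-- Putting m, -m, m, ... on the successive edges cancels at every inner vertex of the walk. -/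
theorem Solvable.of_walk {u v : V} (p : G.Walk u v) {m : A} (hm : m ∈ I) :
    Solvable G I (Pi.single u m - (-1 : A) ^ p.length • Pi.single v m) := by
  induction p with
  | nil => simpa using Solvable.zero
  | cons h p ih =>
    have := (Solvable.of_adj h hm).sub ih
    convert this using 1
    rw [SimpleGraph.Walk.length_cons, pow_succ]
    ext w
    simp only [Pi.sub_apply, Pi.smul_apply, Pi.add_apply, smul_eq_mul]
    ring

/-- Walks move all prescribed values to a base vertex r, up to sign. An odd closed walk at r allows
any value there; without one, parity of walk length gives a bipartition, and the total moved to r is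
the signed sum. -/
theorem solvable_or_exists_sign (hG : G.Connected) (I : Ideal A) (h3 : (3 : A) = 0) :
    (∀ x : V → A, (∀ v, x v ∈ I) → Solvable G I x) ∨
    ∃ ε : V → ℤ, (∀ v, ε v = 1 ∨ ε v = -1) ∧ (∀ u v, G.Adj u v → ε v = -ε u) ∧
      ∀ x : V → A, (∀ v, x v ∈ I) → ∑ v, (ε v : A) * x v = 0 → Solvable G I x := by
  obtain ⟨r⟩ := hG.nonempty
  have hsum : ∀ x : V → A, x = ∑ v, Pi.single v (x v) := fun x =>
    (Finset.univ_sum_single x).symm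
  by_cases hodd : ∃ p : G.Walk r r, Odd p.length
  · left
    obtain ⟨p, hp⟩ := hodd
    have hr : ∀ m ∈ I, Solvable G I (Pi.single r m) := by
      intro m hm
      -- The odd closed walk produces 2m at r; doubling gives 4m = m.
      have := (Solvable.of_walk p hm).smul 2
      convert this using 1
      ext w
      simp only [Pi.smul_apply, Pi.sub_apply, smul_eq_mul, hp.neg_one_pow]
      linear_combination -Pi.single (M := fun _ => A) r m w * h3
    intro x hx
    rw [hsum x]
    refine Solvable.sum _ fun v _ => ?_
    obtain ⟨q⟩ := hG.preconnected v r
    have := (Solvable.of_walk q (hx v)).add ((hr _ (hx v)).smul ((-1) ^ q.length))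
    simpa using this
  · right
    have heven : ∀ p : G.Walk r r, Even p.length := fun p => by
      by_contra h
      exact hodd ⟨p, Nat.not_even_iff_odd.mp h⟩
    choose q hq using fun v => hG.exists_walk_length_eq_dist v r
    refine ⟨fun v => (-1) ^ (q v).length, fun v => neg_one_pow_eq_or _ _, ?_, ?_⟩
    · intro u v huv
      have := heven ((q u).reverse.append (SimpleGraph.Walk.cons huv (q v)))
      rw [SimpleGraph.Walk.length_append, SimpleGraph.Walk.length_reverse,
        SimpleGraph.Walk.length_cons] at this
      rcases Nat.even_or_odd (q u).length with h1 | h1 <;>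
      rcases Nat.even_or_odd (q v).length with h2 | h2
      · exfalso; rw [Nat.even_iff] at *; omega
      · simp [h1.neg_one_pow, h2.neg_one_pow]
      · simp [h1.neg_one_pow, h2.neg_one_pow]
      · exfalso; rw [Nat.odd_iff] at *; rw [Nat.even_iff] at this; omega
    · intro x hx h0
      have : Solvable G I (∑ v, (Pi.single v (x v) -
          (-1 : A) ^ (q v).length • Pi.single r (x v))) :=
        Solvable.sum _ fun v _ => Solvable.of_walk (q v) (hx v)
      rw [Finset.sum_sub_distrib, ← hsum] at this
      convert this using 1
      rw [eq_comm, sub_eq_self]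
      ext w
      rw [Finset.sum_apply]
      by_cases hw : w = r
      · subst hw
        simpa using h0
      · simp [hw]

end Solve

/-! ### Realizability in characteristic 3 -/

section CharThree

variable {V : Type*} [Fintype V] [DecidableEq V] {G : SimpleGraph V} [DecidableRel G.Adj]
variable {K : Type*}

/-- Frobenius is a ring homomorphism in characteristic 3 and sends each variable into the cube
ideal. -/
theorem pow_three_mem_cubeIdeal {p : MvPolynomial K (ZMod 3)} (hp : p ∈ idealOfVars K (ZMod 3)) :
    p ^ 3 ∈ cubeIdeal K (ZMod 3) := by
  have : idealOfVars K (ZMod 3) ≤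
      (cubeIdeal K (ZMod 3)).comap (frobenius (MvPolynomial K (ZMod 3)) 3) := by
    rw [idealOfVars, Ideal.span_le]
    rintro _ ⟨k, rfl⟩
    exact X_pow_three_mem k
  exact this hp

theorem Solvable.realizable {x : V → MvPolynomial K (ZMod 3)} {c : MvPolynomial K (ZMod 3)}
    (h : Solvable G (idealOfVars K (ZMod 3)) fun v => x v + c) : Realizable G x := by
  obtain ⟨y, hy, hx⟩ := h
  exact ⟨y, c, fun f => pow_three_mem_cubeIdeal (hy f), fun v => (hx v).symm⟩

/-- Either all families of linear forms are realizable, or the graph has a balanced bipartition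
(modulo `3`) and the families which are balanced are realizable. -/
theorem realizable_or_exists_sign (hG : G.Connected) (K : Type*) :
    (∀ x : V → MvPolynomial K (ZMod 3), (∀ v, x v ∈ idealOfVars K (ZMod 3)) → Realizable G x) ∨
    ∃ ε : V → ℤ, (∀ v, ε v = 1 ∨ ε v = -1) ∧ (∀ u v, G.Adj u v → ε v = -ε u) ∧
      ((∑ v, ε v : ℤ) : ZMod 3) = 0 ∧
      ∀ x : V → MvPolynomial K (ZMod 3), (∀ v, x v ∈ idealOfVars K (ZMod 3)) →
        ∑ v, (ε v : MvPolynomial K (ZMod 3)) * x v = 0 → Realizable G x := by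
  have h3 : (3 : MvPolynomial K (ZMod 3)) = 0 := by
    have := CharP.cast_eq_zero (MvPolynomial K (ZMod 3)) 3
    exact_mod_cast this
  rcases solvable_or_exists_sign hG (idealOfVars K (ZMod 3)) h3 with h | ⟨ε, h1, h2, h⟩
  · left
    intro x hx
    refine Solvable.realizable (c := 0) ?_
    simpa using h x hx
  by_cases hδ : ((∑ v, ε v : ℤ) : ZMod 3) = 0
  · right
    refine ⟨ε, h1, h2, hδ, fun x hx h0 => Solvable.realizable (c := 0) ?_⟩
    simpa using h x hx h0
  · left
    intro x hx
    set δ : ZMod 3 := ((∑ v, ε v : ℤ) : ZMod 3) with hδdef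
    have hδ2 : δ * δ = 1 := by revert hδ; generalize δ = d; revert d; decide
    set S : MvPolynomial K (ZMod 3) := ∑ v, (ε v : MvPolynomial K (ZMod 3)) * x v with hS
    have hSmem : S ∈ idealOfVars K (ZMod 3) :=
      Ideal.sum_mem _ fun v _ => Ideal.mul_mem_left _ _ (hx v)
    -- Translation by c changes the signed sum by δc. Since δ² = 1, this c cancels S.
    refine Solvable.realizable (c := -(C δ * S)) (h _ (fun v => ?_) ?_)
    · exact Ideal.add_mem _ (hx v) (neg_mem (Ideal.mul_mem_left _ _ hSmem))
    · simp only [mul_add, Finset.sum_add_distrib]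
      rw [← hS, ← Finset.sum_mul]
      have hC : (∑ v, (ε v : MvPolynomial K (ZMod 3))) = C δ := by
        rw [hδdef, map_intCast, Int.cast_sum]
      rw [hC, mul_neg, ← mul_assoc, ← map_mul, hδ2]
      simp

end CharThree

end Halin

namespace Halin

/-! ### The face walk of a plane tree and the cyclic order of its leaves -/

namespace PlaneTree

variable {V : Type*} (T : PlaneTree V)

/-- The step of the walk around the tree, as a permutation of the darts. -/
def facePerm : Equiv.Perm T.tree.Dart :=
  (SimpleGraph.Dart.symm_involutive (G := T.tree)).toPerm.trans T.rot

theorem facePerm_apply (d : T.tree.Dart) : T.facePerm d = T.faceStep d := rfl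

theorem faceStep_fst (d : T.tree.Dart) : (T.faceStep d).fst = d.snd := T.rot_fst _

theorem faceStep_symm (d : T.tree.Dart) : T.faceStep d.symm = T.rot d := by
  simp [faceStep]

section Orbit

variable [Finite V]

/-- Every edge of a tree is a bridge. Around a closed orbit the indicator of one side of `e` has
total variation zero, because the end of a dart is the start of the next. If the reverse of `e` were
missing, `e` alone would cross the cut. -/
theorem sameCycle_symm_of_sameCycle {d₀ e : T.tree.Dart} (he : T.facePerm.SameCycle d₀ e) :
    T.facePerm.SameCycle d₀ e.symm := by
  classical
  have := Fintype.ofFinite V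
  by_contra hn
  set f : V → ℤ := fun w =>
    if (T.tree.deleteEdges {s(e.fst, e.snd)}).Reachable e.fst w then 1 else 0 with hf
  have hbridge : ¬ (T.tree.deleteEdges {s(e.fst, e.snd)}).Reachable e.fst e.snd :=
    SimpleGraph.isBridge_iff.mp
      (SimpleGraph.isAcyclic_iff_forall_adj_isBridge.mp T.isTree.isAcyclic e.adj)
  set O : Finset T.tree.Dart := Finset.univ.filter fun d => T.facePerm.SameCycle d₀ d with hO
  have hsum : ∑ d ∈ O, (f d.snd - f d.fst) = 0 := by
    rw [Finset.sum_sub_distrib, sub_eq_zero]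
    refine Finset.sum_equiv T.facePerm (fun d => ?_) fun d _ => ?_
    · simp [hO, Equiv.Perm.sameCycle_apply_right]
    · rw [facePerm_apply, faceStep_fst]
  rw [Finset.sum_eq_single e] at hsum
  · simp [hf, hbridge] at hsum
  · intro d hd hde
    have hds : d ≠ e.symm := by
      rintro rfl
      exact hn (by simpa [hO] using hd)
    have hadj : (T.tree.deleteEdges {s(e.fst, e.snd)}).Adj d.fst d.snd := by
      rw [SimpleGraph.deleteEdges_adj]
      refine ⟨d.adj, fun h => ?_⟩
      rw [Set.mem_singleton_iff] at h
      rcases (SimpleGraph.dart_edge_eq_iff d e).mp h with h | h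
      · exact hde h
      · exact hds h
    have : (T.tree.deleteEdges {s(e.fst, e.snd)}).Reachable e.fst d.fst ↔
        (T.tree.deleteEdges {s(e.fst, e.snd)}).Reachable e.fst d.snd :=
      ⟨fun h => h.trans hadj.reachable, fun h => h.trans hadj.symm.reachable⟩
    simp [hf, this]
  · intro h
    exact absurd (by simpa [hO] using he) h

/-- An orbit closed under reversal is closed under rotation, since a rotation is a face step after a
reversal. Connectedness then spreads it over all darts. -/
theorem sameCycle_facePerm (d d' : T.tree.Dart) : T.facePerm.SameCycle d d' := by
  have hrot : ∀ e, T.facePerm.SameCycle d e → T.facePerm.SameCycle d (T.rot e) := by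
    intro e he
    rw [← faceStep_symm, ← facePerm_apply, Equiv.Perm.sameCycle_apply_right]
    exact T.sameCycle_symm_of_sameCycle he
  have hfst : ∀ e e', T.facePerm.SameCycle d e → e.fst = e'.fst → T.facePerm.SameCycle d e' := by
    intro e e' he h
    have : Finite T.tree.Dart :=
      Finite.of_injective _ SimpleGraph.Dart.toProd_injective
    obtain ⟨n, rfl⟩ := (T.rot_sameCycle e e' h).exists_nat_pow_eq
    clear h
    induction n with
    | zero => simpa
    | succ n ih =>
      rw [pow_succ', Equiv.Perm.mul_apply]
      exact hrot _ ih
  have hwalk : ∀ {u w : V} (p : T.tree.Walk u w), (∀ e, e.fst = u → T.facePerm.SameCycle d e) →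
      ∀ e, e.fst = w → T.facePerm.SameCycle d e := by
    intro u w p
    induction p with
    | nil => exact id
    | cons h p ih =>
      intro hu
      refine ih fun e he => ?_
      exact hfst _ _ (T.sameCycle_symm_of_sameCycle (hu ⟨(_, _), h⟩ rfl)) he.symm
  obtain ⟨p⟩ := T.isTree.connected.preconnected d.fst d'.fst
  exact hwalk p (fun e he => hfst d e (Equiv.Perm.SameCycle.refl _ _) he.symm) d' rfl

end Orbit

theorem IsLeaf.dart_eq {d d' : T.tree.Dart} (h : T.IsLeaf d.fst) (hd : d.fst = d'.fst) : d = d' := by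
  obtain ⟨w, -, hw⟩ := h
  refine SimpleGraph.Dart.ext _ _ (Prod.ext hd ?_)
  exact (hw _ d.adj).trans (hw _ (hd ▸ d'.adj)).symm

/-- `g` lists the leaves in their cyclic order, with period `l`. -/
structure LeafOrder (l : ℕ) (g : ℕ → V) : Prop where
  two_le : 2 ≤ l
  isLeaf : ∀ i, T.IsLeaf (g i)
  surj : ∀ v, T.IsLeaf v → ∃ i, g i = v
  eq_iff : ∀ i j, g i = g j ↔ i ≡ j [MOD l]
  next : ∀ i, T.NextLeaf (g i) (g (i + 1))
  exists_of_next : ∀ u v, T.NextLeaf u v → ∃ i, g i = u ∧ g (i + 1) = v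

variable {T} in
theorem LeafOrder.shift {l : ℕ} {g : ℕ → V} (h : T.LeafOrder l g) (k : ℕ) :
    T.LeafOrder l fun i => g (i + k) := by
  have hl := h.two_le
  -- Adding (l - 1) * k plays the role of subtracting k modulo l in natural number indices.
  have key : ∀ i, (i + (l - 1) * k) + k ≡ i [MOD l] := by
    intro i
    have : i + (l - 1) * k + k = i + l * k := by
      obtain ⟨m, rfl⟩ : ∃ m, l = m + 1 := ⟨l - 1, by omega⟩
      simp; ring
    rw [this]
    simp [Nat.ModEq]
  refine ⟨hl, fun i => h.isLeaf _, fun v hv => ?_, fun i j => ?_, fun i => ?_, fun u v huv => ?_⟩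
  · obtain ⟨i, rfl⟩ := h.surj v hv
    exact ⟨i + (l - 1) * k, (h.eq_iff _ _).mpr (key i)⟩
  · rw [h.eq_iff]
    exact ⟨fun h => Nat.ModEq.add_right_cancel' k h, fun h => h.add_right k⟩
  · have := h.next (i + k)
    rwa [show i + k + 1 = i + 1 + k by ring] at this
  · obtain ⟨i, rfl, rfl⟩ := h.exists_of_next u v huv
    refine ⟨i + (l - 1) * k, (h.eq_iff _ _).mpr (key i), (h.eq_iff _ _).mpr ?_⟩
    rw [show i + (l - 1) * k + 1 + k = (i + (l - 1) * k) + k + 1 by ring]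
    exact (key i).add_right 1

theorem isLeaf_iff_degree [Fintype V] [DecidableRel T.tree.Adj] (v : V) :
    T.IsLeaf v ↔ T.tree.degree v = 1 := by
  rw [IsLeaf, ← SimpleGraph.degree_eq_one_iff_existsUnique_adj]

theorem exists_two_leaves [Fintype V] (hV : 2 ≤ Fintype.card V) :
    ∃ u v, u ≠ v ∧ T.IsLeaf u ∧ T.IsLeaf v := by
  classical
  have : Nontrivial V := Fintype.one_lt_card_iff_nontrivial.mp hV
  obtain ⟨u, v, huv, hu, hv⟩ := T.isTree.exists_ne_and_degree_eq_one
  exact ⟨u, v, huv, (T.isLeaf_iff_degree u).mpr hu, (T.isLeaf_iff_degree v).mpr hv⟩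

/-- The face walk has period M, the number of darts, and a leaf starts exactly one dart, so it is
met once per period. The list is the sequence of times at leaves, enumerated by `Nat.nth`; its
period l is their number in one round. -/
theorem exists_leafOrder [Fintype V] (hV : 2 ≤ Fintype.card V) : ∃ l g, T.LeafOrder l g := by
  classical
  obtain ⟨u, v, huv, hu, hv⟩ := T.exists_two_leaves hV
  obtain ⟨u', huu', -⟩ := id hu
  set d₀ : T.tree.Dart := ⟨(u, u'), huu'⟩ with hd₀
  set M := (Finset.univ : Finset T.tree.Dart).card with hM
  have hcyc : T.facePerm.IsCycleOn ((Finset.univ : Finset T.tree.Dart) : Set T.tree.Dart) :=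
    ⟨by simp, fun d _ d' _ => T.sameCycle_facePerm d d'⟩
  set a : ℕ → T.tree.Dart := fun k => (T.facePerm ^ k) d₀ with ha
  have haeq : ∀ m n, a m = a n ↔ m ≡ n [MOD M] := fun m n =>
    hcyc.pow_apply_eq_pow_apply (Finset.mem_univ _)
  have hiter : ∀ k n, T.faceStep^[n] (a k) = a (k + n) := by
    intro k n
    simp only [ha]
    rw [add_comm, pow_add, Equiv.Perm.mul_apply, ← Equiv.Perm.iterate_eq_pow]
    rfl
  have hasurj : ∀ d, ∃ k, a k = d := fun d =>
    ((T.sameCycle_facePerm d₀ d).exists_nat_pow_eq)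
  set p : ℕ → Prop := fun k => T.IsLeaf (a k).fst with hp
  have hp0 : p 0 := hu
  have hper : ∀ k, a (M + k) = a k := fun k => (haeq _ _).mpr (by simp [Nat.ModEq])
  have hM0 : 0 < M := Finset.card_pos.mpr ⟨d₀, Finset.mem_univ _⟩
  have hinf : (Set.ofPred p).Infinite := by
    rw [Set.infinite_iff_exists_gt]
    intro n
    have : a (M * (n + 1)) = a 0 := (haeq _ _).mpr (by simp [Nat.ModEq])
    refine ⟨M * (n + 1), ?_, by nlinarith⟩
    change T.IsLeaf (a (M * (n + 1))).fst
    rw [this]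
    exact hp0
  set l := Nat.count p M with hl
  have hl0 : 0 < l := by
    have := Nat.count_monotone p (show 1 ≤ M from hM0)
    rw [Nat.count_succ, Nat.count_zero, if_pos hp0] at this
    omega
  have hnth : ∀ i, p (Nat.nth p i) := fun i => Nat.nth_mem_of_infinite hinf i
  have hmono := Nat.nth_strictMono hinf
  have hcount : ∀ k, Nat.count p (M + k) = l + Nat.count p k := by
    intro k
    rw [Nat.count_add]
    congr 1
    simp only [hp, hper]
  have hnadd : ∀ i, Nat.nth p (l + i) = M + Nat.nth p i := by
    intro i
    have h1 : p (M + Nat.nth p i) := by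
      have := hnth i
      simp only [hp, hper] at this ⊢
      exact this
    rw [← Nat.nth_count h1, hcount, Nat.count_nth_of_infinite hinf]
  have hnmul : ∀ q i, Nat.nth p (l * q + i) = M * q + Nat.nth p i := by
    intro q i
    induction q with
    | zero => simp
    | succ q ih => rw [mul_add, mul_one, add_right_comm, add_comm, hnadd, ih]; ring
  have hlt : ∀ i < l, Nat.nth p i < M := fun i hi => Nat.nth_lt_of_lt_count hi
  have hfst : ∀ m n, p m → (a m).fst = (a n).fst → a m = a n := fun m n hm h =>
    IsLeaf.dart_eq T hm h
  have heq : ∀ i j, (a (Nat.nth p i)).fst = (a (Nat.nth p j)).fst ↔ i ≡ j [MOD l] := by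
    intro i j
    have : (a (Nat.nth p i)).fst = (a (Nat.nth p j)).fst ↔ a (Nat.nth p i) = a (Nat.nth p j) :=
      ⟨hfst _ _ (hnth i), fun h => by rw [h]⟩
    rw [this, haeq]
    have hi := hnmul (i / l) (i % l)
    have hj := hnmul (j / l) (j % l)
    rw [Nat.div_add_mod] at hi hj
    have hi' : Nat.nth p i % M = Nat.nth p (i % l) := by
      rw [hi, Nat.mul_add_mod, Nat.mod_eq_of_lt (hlt _ (Nat.mod_lt _ hl0))]
    have hj' : Nat.nth p j % M = Nat.nth p (j % l) := by
      rw [hj, Nat.mul_add_mod, Nat.mod_eq_of_lt (hlt _ (Nat.mod_lt _ hl0))]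
    rw [Nat.ModEq, hi', hj', hmono.injective.eq_iff, Nat.ModEq]
  have hsurj : ∀ w, T.IsLeaf w → ∃ i, (a (Nat.nth p i)).fst = w := by
    intro w hw
    obtain ⟨w', hww', -⟩ := id hw
    obtain ⟨k, hk⟩ := hasurj ⟨(w, w'), hww'⟩
    refine ⟨Nat.count p k, ?_⟩
    rw [Nat.nth_count (by simpa only [hp, hk] using hw), hk]
  refine ⟨l, fun i => (a (Nat.nth p i)).fst, ?_, hnth, hsurj, heq, ?_, ?_⟩
  · by_contra hlt2
    obtain ⟨i, hi⟩ := hsurj u hu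
    obtain ⟨j, hj⟩ := hsurj v hv
    refine huv ?_
    rw [← hi, ← hj, heq]
    have : l = 1 := by omega
    rw [this]
    exact Nat.modEq_one
  · intro i
    refine ⟨hnth i, hnth (i + 1), a (Nat.nth p i), rfl, Nat.nth p (i + 1) - Nat.nth p i, ?_, ?_, ?_⟩
    · exact Nat.sub_pos_of_lt (hmono (Nat.lt_succ_self i))
    · rw [hiter, Nat.add_sub_cancel' (hmono (Nat.lt_succ_self i)).le]
    · intro k hk hk' hleaf
      rw [hiter] at hleaf
      have := Nat.le_nth_of_lt_nth_succ (p := p) (by omega : Nat.nth p i + k < Nat.nth p (i + 1)) hleaf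
      omega
  · rintro u₁ v₁ ⟨hu₁, hv₁, d, rfl, n, hn, rfl, hno⟩
    obtain ⟨k, rfl⟩ := hasurj d
    simp only [hiter] at hv₁ hno ⊢
    have h1 := Nat.nth_count (p := p) hu₁
    have h2 := Nat.nth_count (p := p) hv₁
    refine ⟨Nat.count p k, by rw [h1], ?_⟩
    suffices Nat.count p (k + n) = Nat.count p k + 1 by rw [← this, h2]
    have h3 : Nat.count p k < Nat.count p (k + n) := by
      rw [← hmono.lt_iff_lt, h1, h2]; omega
    by_contra hne
    have h4 : Nat.nth p (Nat.count p k + 1) < k + n := by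
      rw [← h2]; exact hmono (by omega)
    have h5 : k < Nat.nth p (Nat.count p k + 1) := by
      conv_lhs => rw [← h1]
      exact hmono (Nat.lt_succ_self _)
    refine hno (Nat.nth p (Nat.count p k + 1) - k) (by omega) (by omega) ?_
    rw [Nat.add_sub_cancel' h5.le]
    exact hnth _

theorem closure_adj {u v : V} :
    T.closure.Adj u v ↔ T.tree.Adj u v ∨ u ≠ v ∧ (T.NextLeaf u v ∨ T.NextLeaf v u) := by
  simp [closure]

theorem closure_connected : T.closure.Connected :=
  T.isTree.connected.mono le_sup_left

end PlaneTree

theorem exists_parent {V : Type*} {G : SimpleGraph V} (hG : G.IsTree) (r : V) :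
    ∃ par : V → V, (∀ u, u ≠ r → G.Adj u (par u) ∧ G.dist r u = G.dist r (par u) + 1) ∧
      ∀ u v, G.Adj u v → (u ≠ r ∧ v = par u) ∨ (v ≠ r ∧ u = par v) := by
  classical
  have key : ∀ u v w, G.Adj v u → G.Adj w u → G.dist r u = G.dist r v + 1 →
      G.dist r u = G.dist r w + 1 → v = w := by
    intro u v w hv hw hdv hdw
    obtain ⟨p, hp⟩ := hG.connected.exists_walk_length_eq_dist r v
    obtain ⟨q, hq⟩ := hG.connected.exists_walk_length_eq_dist r w
    have h1 : (p.concat hv).IsPath := SimpleGraph.Walk.isPath_of_length_eq_dist _ (by simp [hp, hdv])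
    have h2 : (q.concat hw).IsPath := SimpleGraph.Walk.isPath_of_length_eq_dist _ (by simp [hq, hdw])
    have := (hG.existsUnique_path r u).unique h1 h2
    have := congrArg SimpleGraph.Walk.penultimate this
    simpa using this
  have hex : ∀ u, u ≠ r → ∃ w, G.Adj u w ∧ G.dist r u = G.dist r w + 1 := by
    intro u hu
    obtain ⟨p, hp⟩ := hG.connected.exists_walk_length_eq_dist u r
    cases p with
    | nil => exact absurd rfl hu
    | @cons _ w _ h p =>
      refine ⟨w, h, ?_⟩
      have h1 := SimpleGraph.dist_le p
      rw [SimpleGraph.dist_comm] at h1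
      rw [SimpleGraph.Walk.length_cons, SimpleGraph.dist_comm] at hp
      rcases hG.dist_eq_dist_add_one_of_adj r h with h | h <;> omega
  choose! par hpar using hex
  refine ⟨par, hpar, fun u v huv => ?_⟩
  rcases hG.dist_eq_dist_add_one_of_adj r huv with h | h
  · have hu : u ≠ r := by rintro rfl; simp at h
    exact Or.inl ⟨hu, key u v _ huv.symm (hpar u hu).1.symm h (hpar u hu).2⟩
  · have hv : v ≠ r := by rintro rfl; simp at h
    exact Or.inr ⟨hv, key v u _ huv (hpar v hv).1.symm h (hpar v hv).2⟩

end Halin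

/-! ### Rooted plane trees and triangular families of linear forms -/

namespace Halin

open MvPolynomial

variable {V : Type*} [Fintype V] [DecidableEq V]

/-- A plane tree with an internal root, its parent function and its cyclic order of leaves. -/
structure Rooted (T : PlaneTree V) (r : V) (par : V → V) (l : ℕ) (g : ℕ → V) : Prop where
  root : ¬ T.IsLeaf r
  par_spec : ∀ u, u ≠ r → T.tree.Adj u (par u) ∧ T.tree.dist r u = T.tree.dist r (par u) + 1
  eq_par : ∀ u v, T.tree.Adj u v → (u ≠ r ∧ v = par u) ∨ (v ≠ r ∧ u = par v)
  order : T.LeafOrder l g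

open Classical in
/-- The internal vertices. -/
noncomputable def PlaneTree.internal (T : PlaneTree V) : Finset V :=
  Finset.univ.filter fun u => ¬ T.IsLeaf u

theorem PlaneTree.mem_internal {T : PlaneTree V} {u : V} : u ∈ T.internal ↔ ¬ T.IsLeaf u := by
  simp [PlaneTree.internal]

/-- If all degrees were 1, the edge count would give n = 2(n - 1), hence n = 2. -/
theorem PlaneTree.exists_internal (T : PlaneTree V) (hV : 3 ≤ Fintype.card V) :
    ∃ r, ¬ T.IsLeaf r := by
  classical
  by_contra h
  push Not at h
  have h1 := T.isTree.card_edgeFinset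
  have h2 := T.tree.sum_degrees_eq_twice_card_edges
  rw [Finset.sum_congr rfl fun v _ => (T.isLeaf_iff_degree v).mp (h v)] at h2
  simp at h2
  omega

theorem PlaneTree.exists_rooted (T : PlaneTree V) {r : V} (hr : ¬ T.IsLeaf r)
    {l : ℕ} {g : ℕ → V} (h : T.LeafOrder l g) : ∃ par, Rooted T r par l g := by
  obtain ⟨par, h1, h2⟩ := exists_parent T.isTree r
  exact ⟨par, hr, h1, h2, h⟩

namespace Rooted

variable {T : PlaneTree V} {r : V} {par : V → V} {l : ℕ} {g : ℕ → V} (h : Rooted T r par l g)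

include h

theorem par_internal {u : V} (hu : u ≠ r) : ¬ T.IsLeaf (par u) := by
  intro hl
  have hne : par u ≠ r := fun e => h.root (e ▸ hl)
  obtain ⟨h1, h2⟩ := h.par_spec u hu
  obtain ⟨h3, h4⟩ := h.par_spec _ hne
  obtain ⟨w, -, hw⟩ := hl
  rw [hw _ h3, ← hw _ h1.symm] at h4
  omega

theorem leaf_ne_root (i : ℕ) : g i ≠ r := fun e => h.root (e ▸ h.order.isLeaf i)

theorem adj_leaf_iff {u v : V} (hu : T.IsLeaf u) : T.tree.Adj u v ↔ v = par u := by
  have hne : u ≠ r := fun e => h.root (e ▸ hu)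
  have h1 := (h.par_spec u hne).1
  obtain ⟨w, -, hw⟩ := hu
  constructor
  · intro hv
    rw [hw _ hv, hw _ h1]
  · rintro rfl
    exact h1

theorem shift (k : ℕ) : Rooted T r par l fun i => g (i + k) :=
  ⟨h.root, h.par_spec, h.eq_par, h.order.shift k⟩

theorem leaf_eq_mod (i : ℕ) : g i = g (i % l) := by
  rw [h.order.eq_iff]
  exact (Nat.mod_modEq i l).symm

theorem pos : 0 < l := by have := h.order.two_le; omega

theorem leaf_inj {i j : ℕ} (hi : i < l) (hj : j < l) (e : g i = g j) : i = j := by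
  rw [h.order.eq_iff] at e
  exact Nat.ModEq.eq_of_lt_of_lt e hi hj

theorem exists_index {v : V} (hv : T.IsLeaf v) : ∃ i < l, g i = v := by
  obtain ⟨i, rfl⟩ := h.order.surj v hv
  exact ⟨i % l, Nat.mod_lt _ h.pos, (h.leaf_eq_mod i).symm⟩

theorem next_adj (i : ℕ) : T.closure.Adj (g i) (g (i + 1)) := by
  rw [PlaneTree.closure_adj]
  refine Or.inr ⟨fun e => ?_, Or.inl (h.order.next i)⟩
  rw [h.order.eq_iff] at e
  have h1 : 0 ≡ 1 [MOD l] := Nat.ModEq.add_left_cancel' i e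
  exact zero_ne_one (h1.eq_of_lt_of_lt (by have := h.order.two_le; omega) h.order.two_le)

/-- The product over all tree edges and the first `m` rim edges, which have to include all the rim
edges. -/
noncomputable def edgeProd {A : Type*} [CommRing A] (_ : Rooted T r par l g) (x : V → A) (m : ℕ) : A :=
  (∏ u ∈ T.internal.erase r, (x u - x (par u))) *
    ((∏ i ∈ Finset.range l, (x (g i) - x (par (g i)))) *
      ∏ i ∈ Finset.range m, (x (g i) - x (g (i + 1))))

/-- Taking m = l covers every rim edge, twice when l = 2; then m = 1 lists the only rim edge once,
which is why the hypotheses on m have this form. -/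
theorem edgePoly_notMem [DecidableRel T.closure.Adj] {K R : Type*} [CommRing R]
    {x : V → MvPolynomial K R} (hx : Realizable T.closure x) (D : Orientation T.closure) {m : ℕ}
    (hm : l ≤ m + 1) (hm' : l ≤ m ∨ l = 2) (hmem : h.edgeProd x m ∉ cubeIdeal K R) :
    edgePoly R D ∉ cubeIdeal T.closure.edgeSet R := by
  have hl := h.order.two_le
  refine hx.edgePoly_notMem D (J := T.internal.erase r ⊕ Fin l ⊕ Fin m)
    (Sum.elim (fun u => u.1) (Sum.elim (fun i => g i) fun i => g i))
    (Sum.elim (fun u => par u.1) (Sum.elim (fun i => par (g i)) fun i => g (i + 1))) ?_ ?_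
  · have hpar : ∀ u, u ≠ r → ∃ j : T.internal.erase r ⊕ Fin l ⊕ Fin m,
        Sum.elim (fun u => u.1) (Sum.elim (fun i : Fin l => g i) fun i : Fin m => g i) j = u ∧
        Sum.elim (fun u => par u.1)
          (Sum.elim (fun i : Fin l => par (g i)) fun i : Fin m => g (i + 1)) j = par u := by
      intro u hu
      by_cases hleaf : T.IsLeaf u
      · obtain ⟨i, hi, rfl⟩ := h.exists_index hleaf
        exact ⟨.inr (.inl ⟨i, hi⟩), rfl, rfl⟩
      · exact ⟨.inl ⟨u, Finset.mem_erase.mpr ⟨hu, PlaneTree.mem_internal.mpr hleaf⟩⟩, rfl, rfl⟩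
    have hnext : ∀ u v, T.NextLeaf u v → ∃ j : T.internal.erase r ⊕ Fin l ⊕ Fin m,
        (Sum.elim (fun u => u.1) (Sum.elim (fun i : Fin l => g i) fun i : Fin m => g i) j = u ∧
        Sum.elim (fun u => par u.1)
          (Sum.elim (fun i : Fin l => par (g i)) fun i : Fin m => g (i + 1)) j = v) ∨
        (Sum.elim (fun u => u.1) (Sum.elim (fun i : Fin l => g i) fun i : Fin m => g i) j = v ∧
        Sum.elim (fun u => par u.1)
          (Sum.elim (fun i : Fin l => par (g i)) fun i : Fin m => g (i + 1)) j = u) := by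
      intro u v huv
      obtain ⟨i, rfl, rfl⟩ := h.order.exists_of_next u v huv
      have hmod : g (i + 1) = g (i % l + 1) :=
        (h.order.eq_iff _ _).mpr ((Nat.mod_modEq i l).symm.add_right 1)
      have hlt := Nat.mod_lt i h.pos
      rw [hmod, h.leaf_eq_mod i]
      generalize i % l = i at hlt
      by_cases hi : i < m
      · exact ⟨.inr (.inr ⟨i, hi⟩), Or.inl ⟨rfl, rfl⟩⟩
      · have hl2 : l = 2 := by omega
        subst hl2
        obtain rfl : i = 1 := by omega
        obtain rfl : m = 1 := by omega
        refine ⟨.inr (.inr 0), Or.inr ⟨?_, rfl⟩⟩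
        exact (h.order.eq_iff 0 (1 + 1)).mpr (by simp [Nat.ModEq])
    intro u v huv
    rw [PlaneTree.closure_adj] at huv
    rcases huv with huv | ⟨-, huv | huv⟩
    · rcases h.eq_par u v huv with ⟨hu, rfl⟩ | ⟨hv, rfl⟩
      · obtain ⟨j, hj⟩ := hpar u hu
        exact ⟨j, Or.inl hj⟩
      · obtain ⟨j, hj⟩ := hpar v hv
        exact ⟨j, Or.inr hj⟩
    · exact hnext u v huv
    · obtain ⟨j, hj⟩ := hnext v u huv
      exact ⟨j, hj.symm⟩
  · convert hmem using 2
    rw [Fintype.prod_sum_type, Fintype.prod_sum_type, edgeProd]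
    simp only [Sum.elim_inl, Sum.elim_inr]
    congr 1
    · exact Finset.prod_coe_sort (T.internal.erase r) fun u => x u - x (par u)
    · congr 1
      · exact Fin.prod_univ_eq_prod_range (fun i => x (g i) - x (par (g i))) l
      · exact Fin.prod_univ_eq_prod_range (fun i => x (g i) - x (g (i + 1))) m

variable {R : Type*} [CommRing R]

/-- The internal forms: `form u = X u + t * form (par u)`, starting with the variable at the root. -/
noncomputable def form (_ : Rooted T r par l g) (t : R) (u : V) : MvPolynomial V R :=
  ∑ k ∈ Finset.range (T.tree.dist r u + 1), C (t ^ k) * X (par^[k] u)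

theorem form_eq (t : R) {u : V} (hu : u ≠ r) : h.form t u = X u + C t * h.form t (par u) := by
  rw [form, form, (h.par_spec u hu).2, Finset.sum_range_succ', add_comm, Finset.mul_sum]
  simp [pow_succ', mul_assoc]

theorem dist_iterate (u : V) (k : ℕ) (hk : k ≤ T.tree.dist r u) :
    T.tree.dist r (par^[k] u) + k = T.tree.dist r u := by
  induction k with
  | zero => rfl
  | succ k ih =>
    have := ih (by omega)
    have hne : par^[k] u ≠ r := by
      intro e
      rw [e, SimpleGraph.dist_self] at this
      omega
    rw [Function.iterate_succ_apply', ← this, (h.par_spec _ hne).2]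
    ring

theorem iterate_internal {u : V} (hu : ¬ T.IsLeaf u) (k : ℕ) (hk : k ≤ T.tree.dist r u) :
    ¬ T.IsLeaf (par^[k] u) := by
  cases k with
  | zero => exact hu
  | succ k =>
    rw [Function.iterate_succ_apply']
    refine h.par_internal fun e => ?_
    have := h.dist_iterate u k (by omega)
    rw [e, SimpleGraph.dist_self] at this
    omega

theorem free_form (t : R) {u v : V} (hu : ¬ T.IsLeaf u) (hv : T.IsLeaf v) :
    Free v (h.form t u) := by
  refine Free.sum _ fun k hk => (Free.C _).mul (Free.X fun e => ?_)
  rw [Finset.mem_range] at hk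
  exact h.iterate_internal hu k (by omega) (e ▸ hv)

theorem form_mem (t : R) (u : V) : h.form t u ∈ idealOfVars V R :=
  Ideal.sum_mem _ fun _ _ => Ideal.mul_mem_left _ _ (Ideal.subset_span ⟨_, rfl⟩)

/-- A form involves, besides its own vertex, only strictly shallower ancestors. The forms are
therefore triangular with respect to depth. -/
theorem coeff_form (t : R) {u v : V} (hd : T.tree.dist r v ≤ T.tree.dist r u) :
    coeff (Finsupp.single u 1) (h.form t v) = if v = u then 1 else 0 := by
  rw [form, coeff_sum, Finset.sum_eq_single 0]
  · simp [coeff_X, Finsupp.single_left_inj]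
  · intro k hk hk0
    rw [Finset.mem_range] at hk
    rw [coeff_C_mul, coeff_X, if_neg, mul_zero]
    rw [Finsupp.single_left_inj one_ne_zero]
    intro e
    have := h.dist_iterate v k (by omega)
    rw [e] at this
    omega
  · simp

omit h in
theorem prod_X_eq (s : Finset V) : (∏ u ∈ s, X u : MvPolynomial V R) =
    monomial (∑ u ∈ s, Finsupp.single u 1) 1 := by
  simp [monomial_sum_one, X]

omit h in
theorem sum_single_apply_le (s : Finset V) (v : V) :
    (∑ u ∈ s, Finsupp.single u 1 : V →₀ ℕ) v ≤ 1 := by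
  rw [Finsupp.finsetSum_apply]
  simp only [Finsupp.single_apply, Finset.sum_ite_eq']
  split_ifs <;> omega

omit h in
theorem C_mul_prod_X_notMem (s : Finset V) {c : R} (hc : c ≠ 0) :
    C c * ∏ u ∈ s, X u ∉ cubeIdeal V R := by
  refine notMem_cubeIdeal_of_coeff (∑ u ∈ s, Finsupp.single u 1) (fun v => ?_) ?_
  · exact (sum_single_apply_le s v).trans (by omega)
  · rw [prod_X_eq, coeff_C_mul, coeff_monomial, if_pos rfl, mul_one]
    exact hc

/-- At a deepest vertex u with a nonzero coefficient, X u occurs in no other contributing form. Its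
product with the squarefree monomial has exponents at most 2. -/
theorem sum_form_mul_prod_X_notMem (t : R) (s : Finset V) {c : V → R} (hc : ∃ u ∈ T.internal, c u ≠ 0) :
    (∑ u ∈ T.internal, C (c u) * h.form t u) * ∏ u ∈ s, X u ∉ cubeIdeal V R := by
  classical
  obtain ⟨u, hu, hmax⟩ := Finset.exists_max_image (T.internal.filter fun u => c u ≠ 0)
    (T.tree.dist r) (by obtain ⟨u, hu, h0⟩ := hc; exact ⟨u, Finset.mem_filter.mpr ⟨hu, h0⟩⟩)
  rw [Finset.mem_filter] at hu
  refine notMem_cubeIdeal_of_coeff (Finsupp.single u 1 + ∑ u ∈ s, Finsupp.single u 1)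
    (fun v => ?_) ?_
  · have := sum_single_apply_le s v
    rw [Finsupp.add_apply, Finsupp.single_apply]
    split_ifs <;> omega
  · rw [prod_X_eq, coeff_mul_monomial, mul_one, coeff_sum, Finset.sum_eq_single u]
    · rw [coeff_C_mul, h.coeff_form t le_rfl, if_pos rfl, mul_one]
      exact hu.2
    · intro v hv hvu
      by_cases h0 : c v = 0
      · simp [h0]
      · rw [coeff_C_mul, h.coeff_form t (hmax v (Finset.mem_filter.mpr ⟨hv, h0⟩)), if_neg hvu,
          mul_zero]
    · exact fun h' => absurd hu.1 h'

end Rooted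

/-- Extraction of squares preserves the cube ideal and commutes with factors free of the extracted
variables, so non-membership may be checked afterwards. -/
theorem notMem_of_tops {K R : Type*} [CommRing R] {w : ℕ → K} {n : ℕ} {p B : MvPolynomial K R}
    (hB : ∀ j ≤ n, Free (w j) B) (h : tops w n p * B ∉ cubeIdeal K R) :
    p * B ∉ cubeIdeal K R := by
  intro hmem
  refine h ?_
  rw [mul_comm, ← tops_mul n hB, mul_comm]
  exact tops_mem n hmem

end Halin

/-! ### Unrestricted vertex sums: the alternating family -/

namespace Halin

open MvPolynomial

variable {V : Type*} [Fintype V] [DecidableEq V]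

namespace Rooted

variable {T : PlaneTree V} {r : V} {par : V → V} {l : ℕ} {g : ℕ → V} (h : Rooted T r par l g)

include h

theorem exists_values {A : Type*} (a : ℕ → A) (b : V → A) :
    ∃ x : V → A, (∀ i < l, x (g i) = a i) ∧ ∀ u, ¬ T.IsLeaf u → x u = b u := by
  classical
  choose! idx hidx using fun v (hv : T.IsLeaf v) => h.exists_index hv
  refine ⟨fun v => if T.IsLeaf v then a (idx v) else b v, fun i hi => ?_, fun u hu => if_neg hu⟩
  have := hidx _ (h.order.isLeaf i)
  simp only [if_pos (h.order.isLeaf i)]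
  rw [h.leaf_inj this.1 hi this.2]

/-- The alternating family: internal vertices get their forms, leaves get their variables with
alternating signs. -/
theorem exists_alternating (R : Type*) [CommRing R] : ∃ x : V → MvPolynomial V R,
    (∀ i < l, x (g i) = (-1) ^ i * X (g i)) ∧ (∀ u, ¬ T.IsLeaf u → x u = h.form 1 u) ∧
      ∀ v, x v ∈ idealOfVars V R := by
  obtain ⟨x, h1, h2⟩ := h.exists_values (A := MvPolynomial V R)
    (fun i => (-1) ^ i * X (g i)) (h.form 1)
  refine ⟨x, h1, h2, fun v => ?_⟩
  by_cases hv : T.IsLeaf v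
  · obtain ⟨i, hi, rfl⟩ := h.exists_index hv
    rw [h1 i hi]
    exact Ideal.mul_mem_left _ _ (Ideal.subset_span ⟨_, rfl⟩)
  · rw [h2 v hv]
    exact h.form_mem 1 v

variable {R : Type*} [CommRing R]

theorem prod_internal {x : V → MvPolynomial V R} (hx : ∀ u, ¬ T.IsLeaf u → x u = h.form 1 u) :
    ∏ u ∈ T.internal.erase r, (x u - x (par u)) = ∏ u ∈ T.internal.erase r, X u := by
  refine Finset.prod_congr rfl fun u hu => ?_
  rw [Finset.mem_erase, PlaneTree.mem_internal] at hu
  rw [hx u hu.2, hx _ (h.par_internal hu.1), h.form_eq 1 hu.1]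
  simp

/-- Alternating signs turn all rim differences but the closing one into sums, up to sign. The
closing factor keeps a sign depending on the parity of n. -/
theorem edgeProd_alternating {x : V → MvPolynomial V R} {n : ℕ} (hn : l = n + 1)
    (hx : ∀ i < l, x (g i) = (-1) ^ i * X (g i)) (hx' : ∀ u, ¬ T.IsLeaf u → x u = h.form 1 u) :
    ∃ s : ℕ, h.edgeProd x l = (-1) ^ s * (((-1) ^ n * X (g n) - X (g 0)) *
      pathPoly g (fun i => -(-1) ^ i * h.form 1 (par (g i))) n) * ∏ u ∈ T.internal.erase r, X u := by
  have hl0 : x (g (n + 1)) = X (g 0) := by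
    rw [(h.order.eq_iff (n + 1) 0).mpr (by rw [← hn]; simp [Nat.ModEq]), hx 0 h.pos]
    simp
  have hpend : ∀ i ∈ Finset.range l, x (g i) - x (par (g i)) =
      (-1) ^ i * (X (g i) + -(-1) ^ i * h.form 1 (par (g i))) := by
    intro i hi
    rw [Finset.mem_range] at hi
    rw [hx i hi, hx' _ (h.par_internal (h.leaf_ne_root i)), mul_add, neg_mul, mul_neg, ← mul_assoc,
      ← mul_pow]
    simp
    ring
  have hrim : ∀ i ∈ Finset.range n, x (g i) - x (g (i + 1)) =
      (-1) ^ i * (X (g i) + X (g (i + 1))) := by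
    intro i hi
    rw [Finset.mem_range] at hi
    rw [hx i (by omega), hx (i + 1) (by omega)]
    ring
  have hrims : ∏ i ∈ Finset.range l, (x (g i) - x (g (i + 1))) =
      (-1) ^ (∑ i ∈ Finset.range n, i) * (∏ i ∈ Finset.range n, (X (g i) + X (g (i + 1)))) *
        ((-1) ^ n * X (g n) - X (g 0)) := by
    rw [hn, Finset.prod_range_succ _ n, Finset.prod_congr rfl hrim, Finset.prod_mul_distrib,
      Finset.prod_pow_eq_pow_sum, hl0, hx n (by omega)]
  refine ⟨∑ i ∈ Finset.range l, i + ∑ i ∈ Finset.range n, i, ?_⟩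
  rw [edgeProd, h.prod_internal hx', Finset.prod_congr rfl hpend, hrims,
    Finset.prod_mul_distrib, Finset.prod_pow_eq_pow_sum, pathPoly, pow_add]
  subst hn
  ring

theorem hw {n : ℕ} (hn : l = n + 1) : ∀ i ≤ n, ∀ j ≤ n, g i = g j → i = j :=
  fun _ hi _ hj e => h.leaf_inj (by omega) (by omega) e

theorem free_pendant (n : ℕ) (s : ℕ → MvPolynomial V R) (hs : ∀ i v, Free v (s i)) (t : R) :
    ∀ i ≤ n, ∀ j ≤ n, Free (g j) (s i * h.form t (par (g i))) :=
  fun i _ j _ => (hs i _).mul (h.free_form t (h.par_internal (h.leaf_ne_root i)) (h.order.isLeaf j))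

theorem free_prod (n : ℕ) (s : Finset V) (hs : ∀ u ∈ s, ¬ T.IsLeaf u) :
    ∀ j ≤ n, Free (g j) (∏ u ∈ s, X u : MvPolynomial V R) :=
  fun j _ => Free.prod _ fun u hu => Free.X fun e => hs u hu (e ▸ h.order.isLeaf j)

omit h in
theorem neg_pow_mul_notMem {I : Ideal (MvPolynomial V R)} {p : MvPolynomial V R} (s : ℕ)
    (hp : p ∉ I) : (-1) ^ s * p ∉ I := by
  intro hmem
  have := I.mul_mem_left ((-1) ^ s) hmem
  rw [← mul_assoc, ← mul_pow] at this
  simp at this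
  exact hp this

omit h in
theorem free_neg_pow (i : ℕ) (v : V) : Free v (-(-1) ^ i : MvPolynomial V R) :=
  (Free.one.neg.pow i).neg

omit h in
theorem two_ne_zero_three : (2 : ZMod 3) ≠ 0 := by decide

/-- For odd n the closing factor is -(X (g n) + X (g 0)). Its two terms contribute equally, giving a
power of 2 up to sign, which is nonzero mod 3. -/
theorem exists_notMem_even (hl : Even l) : ∃ x : V → MvPolynomial V (ZMod 3),
    (∀ v, x v ∈ idealOfVars V (ZMod 3)) ∧ h.edgeProd x l ∉ cubeIdeal V (ZMod 3) := by
  obtain ⟨x, hx, hx', hmem⟩ := h.exists_alternating (ZMod 3)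
  refine ⟨x, hmem, ?_⟩
  obtain ⟨n, hn⟩ : ∃ n, l = n + 1 := ⟨l - 1, by have := h.pos; omega⟩
  obtain ⟨s, hs⟩ := h.edgeProd_alternating hn hx hx'
  have hodd : Odd n := by
    rw [hn, Nat.even_add_one, Nat.not_even_iff_odd] at hl
    exact hl
  rw [hs, mul_assoc]
  refine neg_pow_mul_notMem _ (notMem_of_tops (w := g) (n := n)
    (h.free_prod n _ fun u hu => PlaneTree.mem_internal.mp (Finset.mem_of_mem_erase hu)) ?_)
  have hP := h.free_pendant n (R := ZMod 3) (fun i => -(-1) ^ i) (fun i v => free_neg_pow i v) 1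
  have h1 := tops_X_mul_pathPoly (h.hw hn) hP le_rfl (le_refl n)
  have h0 := tops_X_mul_pathPoly (h.hw hn) hP le_rfl (Nat.zero_le n)
  rw [hodd.neg_one_pow, neg_one_mul, sub_mul, neg_mul, map_sub, map_neg, h1, h0]
  have : (-2 ^ (n + 1) - 2 ^ (n + 1) : MvPolynomial V (ZMod 3)) = C (-2 ^ (n + 2)) := by
    simp only [map_neg, map_pow, map_ofNat]; ring
  rw [this]
  exact C_mul_prod_X_notMem _ (neg_ne_zero.mpr (pow_ne_zero _ two_ne_zero_three))

/-- For even n the two terms of the closing factor cancel. One more linear factor is therefore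
spent, and the result is a multiple of the difference of the forms at the two parents. -/
theorem exists_notMem_odd (hl : Odd l) {n : ℕ} (hn : l = n + 1) (hpar : par (g n) ≠ par (g 0)) :
    ∃ x : V → MvPolynomial V (ZMod 3),
      (∀ v, x v ∈ idealOfVars V (ZMod 3)) ∧ h.edgeProd x l ∉ cubeIdeal V (ZMod 3) := by
  obtain ⟨x, hx, hx', hmem⟩ := h.exists_alternating (ZMod 3)
  refine ⟨x, hmem, ?_⟩
  obtain ⟨s, hs⟩ := h.edgeProd_alternating hn hx hx'
  have heven : Even n := by
    rw [hn, Nat.odd_add_one, Nat.not_odd_iff_even] at hl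
    exact hl
  rw [hs, mul_assoc]
  refine neg_pow_mul_notMem _ fun hI => ?_
  -- This multiplier makes a difference of squares with the closing factor, so no mixed term X (g 0)
  -- X (g n) appears.
  have hI := Ideal.mul_mem_left _ (X (g n) + X (g 0)) hI
  rw [← mul_assoc] at hI
  revert hI
  refine notMem_of_tops (w := g) (n := n)
    (h.free_prod n _ fun u hu => PlaneTree.mem_internal.mp (Finset.mem_of_mem_erase hu)) ?_
  have hP := h.free_pendant n (R := ZMod 3) (fun i => -(-1) ^ i) (fun i v => free_neg_pow i v) 1
  have h1 := tops_X_mul_X_mul_pathPoly (h.hw hn) hP le_rfl (le_refl n) le_rfl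
  have h0 := tops_X_mul_X_mul_pathPoly (h.hw hn) hP le_rfl (le_refl 0) (Nat.zero_le n)
  set H : MvPolynomial V (ZMod 3) := pathPoly g (fun i => -(-1) ^ i * h.form 1 (par (g i))) n
    with hH
  have hexp : (X (g n) + X (g 0)) * (((-1) ^ n * X (g n) - X (g 0)) * H) =
      X (g n) * (X (g n) * H) - X (g 0) * (X (g 0) * H) := by
    rw [heven.neg_one_pow]; ring
  rw [hexp, map_sub, h1, h0]
  have hC : ((2 : MvPolynomial V (ZMod 3)) ^ (n + 1) * ∑ i ∈ Finset.Icc n n, -(-1) ^ i * h.form 1 (par (g i)) -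
      2 ^ (n + 1) * ∑ i ∈ Finset.Icc 0 0, -(-1) ^ i * h.form 1 (par (g i))) =
      ∑ u ∈ T.internal, C (2 ^ (n + 1) * ((if u = par (g 0) then 1 else 0) -
        if u = par (g n) then 1 else 0) : ZMod 3) * h.form 1 u := by
    have m0 := PlaneTree.mem_internal.mpr (h.par_internal (h.leaf_ne_root 0))
    have mn := PlaneTree.mem_internal.mpr (h.par_internal (h.leaf_ne_root n))
    simp only [Finset.Icc_self, Finset.sum_singleton, heven.neg_one_pow, pow_zero, map_mul, map_sub,
      sub_mul, mul_sub, Finset.sum_sub_distrib, map_pow, mul_assoc, ← Finset.mul_sum, apply_ite C,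
      map_zero, map_one, ite_mul, zero_mul, Finset.sum_ite_eq', m0, mn, if_true, map_ofNat]
    ring
  rw [hC]
  refine h.sum_form_mul_prod_X_notMem 1 _ ⟨par (g 0),
    PlaneTree.mem_internal.mpr (h.par_internal (h.leaf_ne_root 0)), ?_⟩
  rw [if_pos rfl, if_neg hpar.symm, sub_zero, mul_one]
  exact pow_ne_zero _ two_ne_zero_three

end Rooted

end Halin

/-! ### Odd wheels over the integers -/

namespace Halin

open MvPolynomial

section WheelPoly

variable {K R : Type*} [CommRing R]

theorem top_X_pow_three_mul (k : K) (p : MvPolynomial K R) : top k (X k ^ 3 * p) = 0 := by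
  simp [top_apply]

theorem top_poly_add {k : K} {c₀ c₁ c₂ : MvPolynomial K R} (h₀ : Free k c₀) (h₁ : Free k c₁)
    (h₂ : Free k c₂) (q : MvPolynomial K R) :
    top k (c₀ + c₁ * X k + c₂ * X k ^ 2 + X k ^ 3 * q) = 2 * c₂ := by
  have h0 := Free.zero (R := R) (k := k)
  rw [map_add, top_X_pow_three_mul, add_zero, ← top_poly h₀ h₁ h₂ h0 h0]
  congr 1
  ring

/-- Elimination of two consecutive vertices of the rim of a wheel. -/
theorem top_top_pair {b z : K} (hbz : b ≠ z) {A B h c : MvPolynomial K R}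
    (hA : Free b A ∧ Free z A) (hB : Free b B ∧ Free z B) (hh : Free b h ∧ Free z h)
    (hc : Free b c ∧ Free z c) :
    top z (top b (c * ((A - (X b + X z)) * ((X b + X z) - (X z - X b)) * ((X b + X z) - h) *
      ((X z - X b) - h)) * ((X z - X b) - B))) = -8 * (c * (A - B)) := by
  have h0 {k : K} := Free.zero (R := R) (k := k)
  have hz : Free b (X z : MvPolynomial K R) := Free.X hbz.symm
  have h2 : Free b (2 : MvPolynomial K R) := by simpa using Free.natCast (R := R) (k := b) 2
  have h2' : Free z (2 : MvPolynomial K R) := by simpa using Free.natCast (R := R) (k := z) 2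
  have h4' : Free z (4 : MvPolynomial K R) := by simpa using Free.natCast (R := R) (k := z) 4
  have e1 : c * ((A - (X b + X z)) * ((X b + X z) - (X z - X b)) * ((X b + X z) - h) *
      ((X z - X b) - h)) * ((X z - X b) - B) =
      0 + (2 * (c * (X z - h) ^ 2 * ((A - X z) * (X z - B)))) * X b +
        (-(2 * (c * (X z - h) ^ 2 * (A - B)))) * X b ^ 2 +
        X b ^ 3 * (2 * c * (((X z - h) ^ 2 - X b ^ 2) - ((A - X z) * (X z - B) - X b * (A - B)))) := by
    ring
  rw [e1, top_poly_add h0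
    (h2.mul ((hc.1.mul ((hz.sub hh.1).pow 2)).mul ((hA.1.sub hz).mul (hz.sub hB.1))))
    (h2.mul ((hc.1.mul ((hz.sub hh.1).pow 2)).mul (hA.1.sub hB.1))).neg]
  have e2 : 2 * -(2 * (c * (X z - h) ^ 2 * (A - B))) =
      -(4 * (c * (A - B) * h ^ 2)) + (2 * (4 * (c * (A - B) * h))) * X z +
        (-(4 * (c * (A - B)))) * X z ^ 2 + X z ^ 3 * 0 := by ring
  have hcAB := hc.2.mul (hA.2.sub hB.2)
  rw [e2, top_poly_add (h4'.mul (hcAB.mul (hh.2.pow 2))).neg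
    (h2'.mul (h4'.mul (hcAB.mul hh.2))) (h4'.mul hcAB).neg]
  ring

/-- The sums at the vertices of the rim of an odd wheel. -/
noncomputable def rimVal : ℕ → MvPolynomial ℕ ℤ
  | 0 => X 0 + X 2
  | 1 => X 2
  | 2 => X 1
  | n + 3 => if Even n then X (n + 3) + X (n + 4) else X (n + 3) - X (n + 2)

theorem rimVal_odd (i : ℕ) : rimVal (2 * i + 3) = X (2 * i + 3) + X (2 * i + 4) := by
  simp [rimVal]

theorem rimVal_even (i : ℕ) : rimVal (2 * i + 4) = X (2 * i + 4) - X (2 * i + 3) := by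
  have : ¬ Even (2 * i + 1) := by simp [parity_simps]
  rw [show 2 * i + 4 = (2 * i + 1) + 3 by ring, rimVal, if_neg this]

/-- The product of the differences along the edges of an odd wheel. -/
noncomputable def wheelPoly (k : ℕ) : MvPolynomial ℕ ℤ :=
  ((rimVal 0 - (X 0 + X 1)) * (rimVal 1 - (X 0 + X 1)) * (rimVal 2 - (X 0 + X 1)) *
    (rimVal 0 - rimVal 1) * (rimVal 1 - rimVal 2) *
    ∏ i ∈ Finset.range k, ((rimVal (2 * i + 2) - rimVal (2 * i + 3)) *
      (rimVal (2 * i + 3) - rimVal (2 * i + 4)) * (rimVal (2 * i + 3) - (X 0 + X 1)) *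
      (rimVal (2 * i + 4) - (X 0 + X 1)))) * (rimVal (2 * k + 2) - rimVal 0)

theorem free_rimVal {n k : ℕ} (h : n < k) (hk : Odd k ∨ Even k ∧ n + 1 < k) (h3 : 3 ≤ k) :
    Free k (rimVal n) := by
  rcases n with _ | _ | _ | n
  · exact (Free.X (by omega)).add (Free.X (by omega))
  · exact Free.X (by omega)
  · exact Free.X (by omega)
  · rw [rimVal]
    split_ifs with he
    · refine (Free.X (by omega)).add (Free.X ?_)
      rcases hk with hk | hk
      · rintro rfl
        rw [Nat.even_iff] at he
        rw [Nat.odd_iff] at hk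
        omega
      · omega
    · exact (Free.X (by omega)).sub (Free.X (by omega))

/-- Two new rim vertices have values X z ± X b. Extracting both squares removes them, closes the rim
again and multiplies by -8, down to the wheel with three spokes. The constant there is 48, divisible
by 3, so this evaluation needs ℤ rather than ZMod 3. -/
theorem C_mul_wheelPoly_notMem (k : ℕ) : ∀ c : ℤ, c ≠ 0 → C c * wheelPoly k ∉ cubeIdeal ℕ ℤ := by
  induction k with
  | zero =>
    intro c hc hmem
    have h0 {k : ℕ} := Free.zero (R := ℤ) (k := k)
    have h2 {k : ℕ} : Free k (2 : MvPolynomial ℕ ℤ) := by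
      simpa using Free.natCast (R := ℤ) (k := k) 2
    have hX {j k : ℕ} (h : j ≠ k) : Free k (X j : MvPolynomial ℕ ℤ) := Free.X h
    have e0 : wheelPoly 0 = 0 + 0 * X 0 + (X 2 - X 1) ^ 4 * X 0 ^ 2 +
        X 0 ^ 3 * (-X 0 * (X 2 - X 1) ^ 2) := by
      simp only [wheelPoly, rimVal, Finset.range_zero, Finset.prod_empty, zero_add]
      ring
    have t0 : top 0 (C c * wheelPoly 0) = C c * (2 * (X 2 - X 1) ^ 4) := by
      rw [top_mul (Free.C _), e0, top_poly_add h0 h0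
        (((hX (by norm_num)).sub (hX (by norm_num))).pow 4)]
    have t1 : top 1 (C c * (2 * (X 2 - X 1) ^ 4)) = C c * (2 * (2 * (6 * X 2 ^ 2))) := by
      have e1 : (X 2 - X 1 : MvPolynomial ℕ ℤ) ^ 4 = X 2 ^ 4 + (-(2 * (2 * X 2 ^ 3))) * X 1 +
        ((2 * 2 + 2) * X 2 ^ 2) * X 1 ^ 2 + X 1 ^ 3 * (X 1 - 4 * X 2) := by ring
      rw [top_mul (Free.C _), top_mul h2, e1, top_poly_add ((hX (by norm_num)).pow 4)
        (h2.mul (h2.mul ((hX (by norm_num)).pow 3))).neg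
        (((h2.mul h2).add h2).mul ((hX (by norm_num)).pow 2))]
      ring
    have t2 : top 2 (C c * (2 * (2 * (6 * X 2 ^ 2)))) = C (c * 48) := by
      have e2 : (2 * (2 * (6 * X 2 ^ 2)) : MvPolynomial ℕ ℤ) =
        0 + 0 * X 2 + C 24 * X 2 ^ 2 + X 2 ^ 3 * 0 := by
        rw [show (C 24 : MvPolynomial ℕ ℤ) = 24 from map_ofNat _ _]; ring
      rw [top_mul (Free.C _), e2, top_poly_add h0 h0 (Free.C _), map_mul,
        show (C 24 : MvPolynomial ℕ ℤ) = 24 from map_ofNat _ _,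
        show (C 48 : MvPolynomial ℕ ℤ) = 48 from map_ofNat _ _]
      ring
    have := top_mem (k := 2) (top_mem (k := 1) (top_mem (k := 0) hmem))
    rw [t0, t1, t2] at this
    exact notMem_cubeIdeal_of_coeff 0 (by simp)
      (by rw [coeff_zero_C]; exact mul_ne_zero hc (by norm_num)) this
  | succ k ih =>
    intro c hc hmem
    refine ih (c * -8) (by simpa using hc) ?_
    have hmem := top_mem (k := 2 * k + 4) (top_mem (k := 2 * k + 3) hmem)
    have hf : ∀ n ≤ 2 * k + 2, Free (2 * k + 3) (rimVal n) ∧ Free (2 * k + 4) (rimVal n) :=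
      fun n hn => ⟨free_rimVal (by omega) (Or.inl ⟨k + 1, by ring⟩) (by omega),
        free_rimVal (by omega) (Or.inr ⟨⟨k + 2, by ring⟩, by omega⟩) (by omega)⟩
    have hh : Free (2 * k + 3) (X 0 + X 1 : MvPolynomial ℕ ℤ) ∧
        Free (2 * k + 4) (X 0 + X 1 : MvPolynomial ℕ ℤ) :=
      ⟨(Free.X (by omega)).add (Free.X (by omega)), (Free.X (by omega)).add (Free.X (by omega))⟩
    set c' := (rimVal 0 - (X 0 + X 1)) * (rimVal 1 - (X 0 + X 1)) * (rimVal 2 - (X 0 + X 1)) *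
      (rimVal 0 - rimVal 1) * (rimVal 1 - rimVal 2) *
      ∏ i ∈ Finset.range k, ((rimVal (2 * i + 2) - rimVal (2 * i + 3)) *
      (rimVal (2 * i + 3) - rimVal (2 * i + 4)) * (rimVal (2 * i + 3) - (X 0 + X 1)) *
      (rimVal (2 * i + 4) - (X 0 + X 1))) with hc'
    have hcf : ∀ v, (∀ n ≤ 2 * k + 2, Free v (rimVal n)) → Free v (X 0 + X 1 : MvPolynomial ℕ ℤ) →
        Free v c' := by
      intro v hv hX
      have h0 := hv 0 (by omega)
      have h1 := hv 1 (by omega)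
      have h2 := hv 2 (by omega)
      refine (((((h0.sub hX).mul (h1.sub hX)).mul (h2.sub hX)).mul (h0.sub h1)).mul
        (h1.sub h2)).mul (Free.prod _ fun i hi => ?_)
      rw [Finset.mem_range] at hi
      have h2 := hv (2 * i + 2) (by omega)
      have h3 := hv (2 * i + 3) (by omega)
      have h4 := hv (2 * i + 4) (by omega)
      exact (((h2.sub h3).mul (h3.sub h4)).mul (h3.sub hX)).mul (h4.sub hX)
    have key := top_top_pair (by omega : 2 * k + 3 ≠ 2 * k + 4) (hf (2 * k + 2) le_rfl)
      (hf 0 (by omega)) hh ⟨hcf _ (fun n hn => (hf n hn).1) hh.1, hcf _ (fun n hn => (hf n hn).2) hh.2⟩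
    have e : wheelPoly (k + 1) = c' * ((rimVal (2 * k + 2) - (X (2 * k + 3) + X (2 * k + 4))) *
        ((X (2 * k + 3) + X (2 * k + 4)) - (X (2 * k + 4) - X (2 * k + 3))) *
        ((X (2 * k + 3) + X (2 * k + 4)) - (X 0 + X 1)) *
        ((X (2 * k + 4) - X (2 * k + 3)) - (X 0 + X 1))) *
        ((X (2 * k + 4) - X (2 * k + 3)) - rimVal 0) := by
      rw [← rimVal_odd, ← rimVal_even, wheelPoly, Finset.prod_range_succ, hc',
        show 2 * (k + 1) + 2 = 2 * k + 4 by ring]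
      ring
    rw [top_mul (Free.C _), top_mul (Free.C _), e, key, ← mul_assoc,
      show (-8 : MvPolynomial ℕ ℤ) = C (-8) by simp, ← map_mul] at hmem
    exact hmem

theorem prod_range_two_mul_add_three {A : Type*} [CommRing A] (f : ℕ → A) (k : ℕ) :
    ∏ i ∈ Finset.range (2 * k + 3), f i =
      f 0 * f 1 * f 2 * ∏ i ∈ Finset.range k, (f (2 * i + 3) * f (2 * i + 4)) := by
  induction k with
  | zero => simp [Finset.prod_range_succ]
  | succ k ih =>
    rw [show 2 * (k + 1) + 3 = 2 * k + 3 + 1 + 1 by ring, Finset.prod_range_succ,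
      Finset.prod_range_succ, ih, Finset.prod_range_succ]
    ring

theorem wheelPoly_eq (k : ℕ) : wheelPoly k =
    (∏ i ∈ Finset.range (2 * k + 3), (rimVal i - (X 0 + X 1))) *
      ((∏ i ∈ Finset.range (2 * k + 2), (rimVal i - rimVal (i + 1))) *
        (rimVal (2 * k + 2) - rimVal 0)) := by
  have h : ∏ i ∈ Finset.range (2 * k + 2), (rimVal i - rimVal (i + 1)) =
      (rimVal 0 - rimVal 1) * (rimVal 1 - rimVal 2) * ∏ i ∈ Finset.range k,
        ((rimVal (2 * i + 2) - rimVal (2 * i + 3)) *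
          (rimVal (2 * i + 3) - rimVal (2 * i + 4))) := by
    induction k with
    | zero => simp [Finset.prod_range_succ]
    | succ k ih =>
      rw [show 2 * (k + 1) + 2 = 2 * k + 2 + 1 + 1 by ring, Finset.prod_range_succ,
        Finset.prod_range_succ, ih, Finset.prod_range_succ]
      ring
  rw [h, prod_range_two_mul_add_three, wheelPoly]
  simp only [Finset.prod_mul_distrib]
  ring

end WheelPoly

namespace Rooted

variable {V : Type*} [Fintype V] [DecidableEq V]
variable {T : PlaneTree V} {r : V} {par : V → V} {l : ℕ} {g : ℕ → V} (h : Rooted T r par l g)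

include h

/-- If all leaves have the same neighbour, the tree is a star. -/
theorem internal_eq_of_star (hpar : ∀ i, par (g i) = r) : T.internal = {r} := by
  classical
  ext u
  rw [PlaneTree.mem_internal, Finset.mem_singleton]
  refine ⟨fun hu => ?_, fun hu => hu ▸ h.root⟩
  by_contra hur
  obtain ⟨v, hv, hmax⟩ := Finset.exists_max_image (T.internal.erase r) (T.tree.dist r)
    ⟨u, Finset.mem_erase.mpr ⟨hur, PlaneTree.mem_internal.mpr hu⟩⟩
  rw [Finset.mem_erase, PlaneTree.mem_internal] at hv
  obtain ⟨hvr, hvl⟩ := hv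
  have h1 := (h.par_spec v hvr).1
  obtain ⟨w, hw, hne⟩ : ∃ w, T.tree.Adj v w ∧ w ≠ par v := by
    by_contra hcon
    push Not at hcon
    exact hvl ⟨par v, h1, hcon⟩
  rcases h.eq_par v w hw with ⟨-, hw'⟩ | ⟨hwr, hw'⟩
  · exact hne hw'
  · by_cases hwl : T.IsLeaf w
    · obtain ⟨i, -, rfl⟩ := h.exists_index hwl
      exact hvr (hw'.trans (hpar i))
    · have := hmax w (Finset.mem_erase.mpr ⟨hwr, PlaneTree.mem_internal.mpr hwl⟩)
      rw [(h.par_spec w hwr).2, ← hw'] at this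
      omega

/-- Outside characteristic 3 general linear forms are unavailable, so weights with admissible cubes
are placed directly: `S` on the spokes and `Q` on the rim. -/
theorem realizable_of_star [DecidableRel T.closure.Adj] (hpar : ∀ i, par (g i) = r) (hl : 3 ≤ l)
    {K R : Type*} [CommRing R] (S Q : ℕ → MvPolynomial K R)
    (hS : ∀ i, S i ^ 3 ∈ cubeIdeal K R) (hQ : ∀ i, Q i ^ 3 ∈ cubeIdeal K R) :
    ∃ x : V → MvPolynomial K R, Realizable T.closure x ∧ x r = ∑ i ∈ Finset.range l, S i ∧
      x (g 0) = S 0 + (Q 0 + Q (l - 1)) ∧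
      ∀ i, i + 1 < l → x (g (i + 1)) = S (i + 1) + (Q (i + 1) + Q i) := by
  have hspoke : ∀ i, T.closure.Adj (g i) r := fun i => by
    rw [PlaneTree.closure_adj]
    exact Or.inl (hpar i ▸ (h.par_spec _ (h.leaf_ne_root i)).1)
  let es : ℕ → T.closure.edgeSet := fun i => ⟨s(g i, r), hspoke i⟩
  let er : ℕ → T.closure.edgeSet := fun i => ⟨s(g i, g (i + 1)), h.next_adj i⟩
  have hes : ∀ i < l, ∀ j < l, es i = es j → i = j := by
    intro i hi j hj e
    have e := Sym2.eq_iff.mp (congrArg Subtype.val e)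
    rcases e with e | e
    · exact h.leaf_inj hi hj e.1
    · exact absurd e.1 (h.leaf_ne_root i)
  have her : ∀ i < l, ∀ j < l, er i = er j → i = j := by
    intro i hi j hj e
    have e := Sym2.eq_iff.mp (congrArg Subtype.val e)
    rcases e with e | ⟨e1, e2⟩
    · exact h.leaf_inj hi hj e.1
    · rw [h.order.eq_iff] at e1 e2
      -- Two rim edges that agree with their ends swapped would force l ∣ 2, excluded by 3 ≤ l.
      have h3 : j + 2 ≡ j + 0 [MOD l] := (e1.add_right 1).symm.trans e2
      have := (Nat.ModEq.add_left_cancel' j h3).eq_of_lt_of_lt (by omega) (by omega)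
      omega
  have hsr : ∀ i j, es i ≠ er j := by
    intro i j e
    have e := Sym2.eq_iff.mp (congrArg Subtype.val e)
    rcases e with e | e
    · exact h.leaf_ne_root _ e.2.symm
    · exact h.leaf_ne_root _ e.2.symm
  let y : T.closure.edgeSet → MvPolynomial K R := fun e =>
    (∑ i ∈ Finset.range l, if e = es i then S i else 0) +
      ∑ i ∈ Finset.range l, if e = er i then Q i else 0
  have hstar : ∀ v, starSum y v = (∑ i ∈ Finset.range l, if v ∈ (es i : Sym2 V) then S i else 0) +
      ∑ i ∈ Finset.range l, if v ∈ (er i : Sym2 V) then Q i else 0 := by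
    intro v
    have key : ∀ (E : ℕ → T.closure.edgeSet) (c : ℕ → MvPolynomial K R),
        ∑ f ∈ Finset.univ.filter (fun f : T.closure.edgeSet => v ∈ (f : Sym2 V)),
          ∑ i ∈ Finset.range l, (if f = E i then c i else 0) =
        ∑ i ∈ Finset.range l, if v ∈ (E i : Sym2 V) then c i else 0 := by
      intro E c
      rw [Finset.sum_comm]
      refine Finset.sum_congr rfl fun i _ => ?_
      rw [Finset.sum_ite_eq']
      simp
    rw [starSum, Finset.sum_add_distrib, key, key]
  refine ⟨starSum y, ⟨y, 0, fun e => ?_, fun v => add_zero _⟩, ?_, ?_, ?_⟩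
  · by_cases h1 : ∃ i < l, e = es i
    · obtain ⟨i, hi, rfl⟩ := h1
      have : y (es i) = S i := by
        simp only [y, hsr, if_false, Finset.sum_const_zero, add_zero]
        rw [Finset.sum_eq_single i, if_pos rfl]
        · intro j hj hne
          exact if_neg fun e => hne (hes _ hi _ (Finset.mem_range.mp hj) e).symm
        · intro hn; exact absurd (Finset.mem_range.mpr hi) hn
      rw [this]
      exact hS i
    · push Not at h1
      have h1' : ∑ i ∈ Finset.range l, (if e = es i then S i else 0) = 0 :=
        Finset.sum_eq_zero fun i hi => if_neg (h1 i (Finset.mem_range.mp hi))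
      by_cases h2 : ∃ i < l, e = er i
      · obtain ⟨i, hi, rfl⟩ := h2
        have : y (er i) = Q i := by
          simp only [y, h1', zero_add]
          rw [Finset.sum_eq_single i, if_pos rfl]
          · intro j hj hne
            exact if_neg fun e => hne (her _ hi _ (Finset.mem_range.mp hj) e).symm
          · intro hn; exact absurd (Finset.mem_range.mpr hi) hn
        rw [this]
        exact hQ i
      · push Not at h2
        have h2' : ∑ i ∈ Finset.range l, (if e = er i then Q i else 0) = 0 :=
          Finset.sum_eq_zero fun i hi => if_neg (h2 i (Finset.mem_range.mp hi))
        simp [y, h1', h2']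
  · rw [hstar]
    simp [es, er, fun i => (h.leaf_ne_root i).symm]
  · rw [hstar]
    congr 1
    · rw [Finset.sum_eq_single 0]
      · simp [es]
      · intro j hj hj0
        refine if_neg fun hmem => ?_
        rcases Sym2.mem_iff.mp hmem with e | e
        · exact hj0 (h.leaf_inj h.pos (Finset.mem_range.mp hj) e).symm
        · exact h.leaf_ne_root _ e
      · simp; omega
    · rw [← Finset.sum_subset (s₁ := {0, l - 1}), Finset.sum_pair (by omega)]
      · have e : g (l - 1 + 1) = g 0 := (h.order.eq_iff _ _).mpr (by
          rw [Nat.sub_add_cancel h.pos]; simp [Nat.ModEq])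
        simp [er, e]
      · intro j hj
        simp at hj ⊢
        omega
      · intro j hj hj'
        rw [Finset.mem_range] at hj
        simp only [Finset.mem_insert, Finset.mem_singleton, not_or] at hj'
        refine if_neg fun hmem => ?_
        rcases Sym2.mem_iff.mp hmem with e | e
        · exact hj'.1 (h.leaf_inj h.pos hj e).symm
        · have := h.leaf_inj h.pos (by omega) e
          omega
  · intro i hi
    rw [hstar]
    congr 1
    · rw [Finset.sum_eq_single (i + 1)]
      · simp [es]
      · intro j hj hj0
        refine if_neg fun hmem => ?_
        rcases Sym2.mem_iff.mp hmem with e | e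
        · exact hj0 (h.leaf_inj hi (Finset.mem_range.mp hj) e).symm
        · exact h.leaf_ne_root _ e
      · simp; omega
    · rw [← Finset.sum_subset (s₁ := {i + 1, i}), Finset.sum_pair (by omega)]
      · simp [er]
      · intro j hj
        simp at hj ⊢
        omega
      · intro j hj hj'
        rw [Finset.mem_range] at hj
        simp only [Finset.mem_insert, Finset.mem_singleton, not_or] at hj'
        refine if_neg fun hmem => ?_
        rcases Sym2.mem_iff.mp hmem with e | e
        · exact hj'.1 (h.leaf_inj hi hj e).symm
        · by_cases hj1 : j + 1 < l
          · have := h.leaf_inj hi hj1 e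
            omega
          · have e0 : g (j + 1) = g 0 := (h.order.eq_iff _ _).mpr (by
              rw [show j + 1 = l by omega]; simp [Nat.ModEq])
            have := h.leaf_inj hi h.pos (e.trans e0)
            omega

theorem exists_notMem_star [DecidableRel T.closure.Adj] (hpar : ∀ i, par (g i) = r) (hl : 3 ≤ l)
    (hodd : Odd l) : ∃ x : V → MvPolynomial ℕ ℤ, Realizable T.closure x ∧
      h.edgeProd x l ∉ cubeIdeal ℕ ℤ := by
  obtain ⟨k, hk⟩ : ∃ k, l = 2 * k + 3 := by
    obtain ⟨m, hm⟩ := hodd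
    exact ⟨m - 1, by omega⟩
  -- Every weight is zero or a variable up to sign. From index 3 on, the spokes come in pairs of
  -- opposite weights, so the centre keeps the sum X 0 + X 1; the rim edge inside a pair adds a
  -- common variable to its two ends.
  let S : ℕ → MvPolynomial ℕ ℤ := fun i => match i with
    | 0 => X 0
    | 1 => 0
    | 2 => X 1
    | n + 3 => if Even n then X (n + 3) else -X (n + 2)
  let Q : ℕ → MvPolynomial ℕ ℤ := fun i => match i with
    | 0 => X 2
    | 1 => 0
    | 2 => 0
    | n + 3 => if Even n then X (n + 4) else 0
  have hzero : (0 : MvPolynomial ℕ ℤ) ^ 3 ∈ cubeIdeal ℕ ℤ := by simp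
  have hS : ∀ i, S i ^ 3 ∈ cubeIdeal ℕ ℤ := by
    intro i
    rcases i with _ | _ | _ | n
    · exact X_pow_three_mem _
    · exact hzero
    · exact X_pow_three_mem _
    · simp only [S]
      split_ifs
      · exact X_pow_three_mem _
      · rw [Odd.neg_pow (by decide)]
        exact neg_mem (X_pow_three_mem _)
  have hQ : ∀ i, Q i ^ 3 ∈ cubeIdeal ℕ ℤ := by
    intro i
    rcases i with _ | _ | _ | n
    · exact X_pow_three_mem _
    · exact hzero
    · exact hzero
    · simp only [Q]
      split_ifs
      · exact X_pow_three_mem _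
      · exact hzero
  obtain ⟨x, hx, hr, h0, hi⟩ := h.realizable_of_star hpar hl S Q hS hQ
  have hsum : ∑ i ∈ Finset.range l, S i = X 0 + X 1 := by
    rw [hk]
    clear hk h0 hr hi
    induction k with
    | zero => simp [Finset.sum_range_succ, S]
    | succ k ih =>
      rw [show 2 * (k + 1) + 3 = 2 * k + 3 + 1 + 1 by ring, Finset.sum_range_succ,
        Finset.sum_range_succ, ih]
      have : ¬ Even (2 * k + 1) := by simp [parity_simps]
      simp [S, this]
  have hval : ∀ i < l, x (g i) = rimVal i := by
    intro i hil
    rcases i with _ | _ | _ | n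
    · have : Q (l - 1) = 0 := by
        rw [hk, show 2 * k + 3 - 1 = 2 * k + 2 by omega]
        rcases k with _ | k
        · rfl
        · have : ¬ Even (2 * k + 1) := by simp [parity_simps]
          rw [show 2 * (k + 1) + 2 = (2 * k + 1) + 3 by ring]
          simp only [Q, if_neg this]
      rw [h0, this]
      simp [S, Q, rimVal]
    · rw [hi 0 hil]
      simp [S, Q, rimVal]
    · rw [hi 1 hil]
      simp [S, Q, rimVal]
    · rw [hi (n + 2) hil]
      rcases n with _ | n
      · simp [S, Q, rimVal]
      · by_cases hn : Even n
        · have : ¬ Even (n + 1) := by simpa [parity_simps] using hn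
          simp only [S, Q, rimVal, if_pos hn, if_neg this]
          ring
        · have : Even (n + 1) := by simpa [parity_simps] using hn
          simp only [S, Q, rimVal, if_neg hn, if_pos this]
          ring
  refine ⟨x, hx, ?_⟩
  have hprod : h.edgeProd x l = wheelPoly k := by
    have e0 : x (g (2 * k + 2 + 1)) = rimVal 0 := by
      rw [(h.order.eq_iff (2 * k + 2 + 1) 0).mpr (by
        rw [show 2 * k + 2 + 1 = l by omega]; simp [Nat.ModEq]), hval 0 h.pos]
    have e1 : ∏ i ∈ Finset.range l, (x (g i) - x (par (g i))) =
        ∏ i ∈ Finset.range (2 * k + 3), (rimVal i - (X 0 + X 1)) := by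
      rw [← hk]
      refine Finset.prod_congr rfl fun i hi => ?_
      rw [hval i (Finset.mem_range.mp hi), hpar, hr, hsum]
    have e2 : ∏ i ∈ Finset.range l, (x (g i) - x (g (i + 1))) =
        (∏ i ∈ Finset.range (2 * k + 2), (rimVal i - rimVal (i + 1))) *
          (rimVal (2 * k + 2) - rimVal 0) := by
      rw [hk, Finset.prod_range_succ _ (2 * k + 2), e0, hval (2 * k + 2) (by omega)]
      congr 1
      refine Finset.prod_congr rfl fun i hi => ?_
      rw [Finset.mem_range] at hi
      rw [hval i (by omega), hval (i + 1) (by omega)]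
    rw [edgeProd, e1, e2, wheelPoly_eq, h.internal_eq_of_star hpar]
    simp
  rw [hprod]
  simpa using C_mul_wheelPoly_notMem k 1 one_ne_zero

end Rooted

end Halin

/-! ### Quadratic multipliers of the path polynomial -/

namespace Halin

open MvPolynomial

section Quadratic

variable {K R : Type*} [CommRing R] {w : ℕ → K} {P : ℕ → MvPolynomial K R} {n : ℕ}
  (hw : ∀ i ≤ n, ∀ j ≤ n, w i = w j → i = j) (hP : ∀ i ≤ n, ∀ j ≤ n, Free (w j) (P i))

include hw hP

theorem tops_linear (β : ℕ → R) :
    tops w n ((∑ c ∈ Finset.range (n + 1), C (β c) * X (w c)) * pathPoly w P n) =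
      2 ^ (n + 1) * C (∑ c ∈ Finset.range (n + 1), β c) := by
  rw [Finset.sum_mul, map_sum, map_sum, Finset.mul_sum]
  refine Finset.sum_congr rfl fun c hc => ?_
  rw [Finset.mem_range] at hc
  rw [mul_assoc, tops_mul n fun _ _ => Free.C _, tops_X_mul_pathPoly hw hP le_rfl (by omega)]
  ring

/-- The indicator of s lying between b and c is written as 1 minus two products, each a function of
b times a function of c. Hence sums over b and c factor, without ordering them. -/
theorem tops_X_mul_X_mul_pathPoly_symm {b c : ℕ} (hb : b ≤ n) (hc : c ≤ n) :
    tops w n (X (w b) * (X (w c) * pathPoly w P n)) = 2 ^ (n + 1) *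
      ∑ s ∈ Finset.range (n + 1), C (1 - (if b < s then 1 else 0) * (if c < s then 1 else 0) -
        (if s < b then 1 else 0) * (if s < c then 1 else 0)) * P s := by
  wlog hbc : b ≤ c generalizing b c
  · rw [mul_left_comm, this hc hb (by omega)]
    congr 1
    refine Finset.sum_congr rfl fun s _ => ?_
    congr 2
    ring
  rw [tops_X_mul_X_mul_pathPoly hw hP le_rfl hbc hc]
  congr 1
  have : Finset.Icc b c = (Finset.range (n + 1)).filter fun s => b ≤ s ∧ s ≤ c := by
    ext s
    simp only [Finset.mem_Icc, Finset.mem_filter, Finset.mem_range]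
    omega
  rw [this, Finset.sum_filter]
  refine Finset.sum_congr rfl fun s _ => ?_
  by_cases h1 : b ≤ s
  · by_cases h2 : s ≤ c
    · simp [h1, h2, not_lt.mpr h1, not_lt.mpr h2]
    · have h3 : c < s := by omega
      have h4 : b < s := by omega
      have h5 : ¬ s < b := by omega
      simp [h2, h3, h4, h5]
  · have h3 : s < b := by omega
    have h4 : s < c := by omega
    have h5 : ¬ b < s := by omega
    simp [h1, h3, h4, h5]

theorem tops_quadratic (α β : ℕ → R) :
    tops w n ((∑ b ∈ Finset.range (n + 1), C (α b) * X (w b)) *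
      ((∑ c ∈ Finset.range (n + 1), C (β c) * X (w c)) * pathPoly w P n)) =
    2 ^ (n + 1) * ∑ s ∈ Finset.range (n + 1),
      C ((∑ b ∈ Finset.range (n + 1), α b) * (∑ c ∈ Finset.range (n + 1), β c) -
        (∑ b ∈ Finset.range (n + 1), α b * if b < s then 1 else 0) *
          (∑ c ∈ Finset.range (n + 1), β c * if c < s then 1 else 0) -
        (∑ b ∈ Finset.range (n + 1), α b * if s < b then 1 else 0) *
          (∑ c ∈ Finset.range (n + 1), β c * if s < c then 1 else 0)) * P s := by
  have h1 : (∑ b ∈ Finset.range (n + 1), C (α b) * X (w b)) *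
      ((∑ c ∈ Finset.range (n + 1), C (β c) * X (w c)) * pathPoly w P n) =
      ∑ b ∈ Finset.range (n + 1), ∑ c ∈ Finset.range (n + 1),
        C (α b * β c) * (X (w b) * (X (w c) * pathPoly w P n)) := by
    rw [← mul_assoc, Finset.sum_mul_sum, Finset.sum_mul]
    refine Finset.sum_congr rfl fun b _ => ?_
    rw [Finset.sum_mul]
    refine Finset.sum_congr rfl fun c _ => ?_
    rw [map_mul]
    ring
  rw [h1, map_sum]
  have h2 : ∀ b ∈ Finset.range (n + 1), tops w n (∑ c ∈ Finset.range (n + 1),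
        C (α b * β c) * (X (w b) * (X (w c) * pathPoly w P n))) =
      ∑ c ∈ Finset.range (n + 1), ∑ s ∈ Finset.range (n + 1), 2 ^ (n + 1) * (C ((α b * β c) *
        (1 - (if b < s then 1 else 0) * (if c < s then 1 else 0) -
        (if s < b then 1 else 0) * (if s < c then 1 else 0))) * P s) := by
    intro b hb
    rw [map_sum]
    refine Finset.sum_congr rfl fun c hc => ?_
    rw [Finset.mem_range] at hb hc
    rw [tops_mul n fun _ _ => Free.C _, tops_X_mul_X_mul_pathPoly_symm hw hP (by omega) (by omega),
      mul_left_comm, Finset.mul_sum, Finset.mul_sum]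
    refine Finset.sum_congr rfl fun s _ => ?_
    rw [map_mul _ (α b * β c)]
    ring
  rw [Finset.sum_congr rfl h2, Finset.sum_congr rfl fun b _ => Finset.sum_comm, Finset.sum_comm,
    Finset.mul_sum]
  refine Finset.sum_congr rfl fun s _ => ?_
  simp only [← Finset.mul_sum, ← Finset.sum_mul, ← map_sum]
  congr 3
  rw [Finset.sum_mul_sum, Finset.sum_mul_sum, Finset.sum_mul_sum, ← Finset.sum_sub_distrib,
    ← Finset.sum_sub_distrib]
  refine Finset.sum_congr rfl fun b _ => ?_
  rw [← Finset.sum_sub_distrib, ← Finset.sum_sub_distrib]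
  refine Finset.sum_congr rfl fun c _ => ?_
  ring

omit hw hP in
theorem sum_ite_lt {s : ℕ} (hs : s ≤ n) :
    ∑ b ∈ Finset.range (n + 1), (if b < s then 1 else 0 : R) = s := by
  rw [← Finset.sum_filter]
  have : (Finset.range (n + 1)).filter (fun b => b < s) = Finset.range s := by
    ext b
    simp only [Finset.mem_filter, Finset.mem_range]
    omega
  simp [this]

omit hw hP in
theorem sum_ite_gt {s : ℕ} (hs : s ≤ n) :
    ∑ b ∈ Finset.range (n + 1), (if s < b then 1 else 0 : R) = n - s := by
  rw [← Finset.sum_filter]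
  have : (Finset.range (n + 1)).filter (fun b => s < b) = Finset.Ico (s + 1) (n + 1) := by
    ext b
    simp only [Finset.mem_filter, Finset.mem_range, Finset.mem_Ico]
    omega
  rw [this, Finset.sum_const, Nat.card_Ico, nsmul_eq_mul, mul_one,
    show n + 1 - (s + 1) = n - s by omega, Nat.cast_sub hs]

/-- The quadratic form which arises from a leg of length two. -/
theorem tops_leg {I J : MvPolynomial K R} (hI : ∀ j ≤ n, Free (w j) I)
    (hJ : ∀ j ≤ n, Free (w j) J) :
    tops w n (((∑ b ∈ Finset.range (n + 1), X (w b)) + I) *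
      (((∑ b ∈ Finset.range (n + 1), X (w b)) + J + X (w 0) + X (w n)) * pathPoly w P n)) =
    2 ^ (n + 1) * (∑ s ∈ Finset.range (n + 1),
      C ((n + 1) * (n + 3) - s * (s + 1) - (n - s) * (n - s + 1) : R) * P s +
        C ((n : R) + 1) * J + C ((n : R) + 3) * I) := by
  -- The two end vertices of the path get weight one more, from the extra terms X (w 0) and X (w n);
  -- for n = 0 both fall on the same vertex.
  let β : ℕ → R := fun c => 1 + (if c = 0 then 1 else 0) + if c = n then 1 else 0
  have hΛ : ∑ b ∈ Finset.range (n + 1), (X (w b) : MvPolynomial K R) =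
      ∑ b ∈ Finset.range (n + 1), C ((fun _ => 1 : ℕ → R) b) * X (w b) := by simp
  have hq : (∑ b ∈ Finset.range (n + 1), X (w b)) + X (w 0) + X (w n) =
      ∑ b ∈ Finset.range (n + 1), C (β b) * X (w b) := by
    simp only [β, map_add, add_mul, Finset.sum_add_distrib, apply_ite C, map_one, map_zero,
      ite_mul, one_mul, zero_mul, Finset.sum_ite_eq', Finset.mem_range]
    simp
  have hβ : ∑ c ∈ Finset.range (n + 1), β c = n + 3 := by
    simp only [β, Finset.sum_add_distrib, Finset.sum_ite_eq', Finset.mem_range]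
    simp
    ring
  have hexp : ((∑ b ∈ Finset.range (n + 1), X (w b)) + I) *
      (((∑ b ∈ Finset.range (n + 1), X (w b)) + J + X (w 0) + X (w n)) * pathPoly w P n) =
      (∑ b ∈ Finset.range (n + 1), C ((fun _ => 1 : ℕ → R) b) * X (w b)) *
        ((∑ b ∈ Finset.range (n + 1), C (β b) * X (w b)) * pathPoly w P n) +
      J * ((∑ b ∈ Finset.range (n + 1), C ((fun _ => 1 : ℕ → R) b) * X (w b)) * pathPoly w P n) +
      I * ((∑ b ∈ Finset.range (n + 1), C (β b) * X (w b)) * pathPoly w P n) +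
      I * (J * pathPoly w P n) := by
    rw [← hΛ, ← hq]
    ring
  rw [hexp, map_add, map_add, map_add, tops_quadratic hw hP, tops_mul n hJ, tops_linear hw hP,
    tops_mul n hI, tops_linear hw hP, tops_mul n hI, tops_mul n hJ, tops_pathPoly hw hP le_rfl, hβ]
  have hcoef : ∀ s ∈ Finset.range (n + 1),
      C ((∑ b ∈ Finset.range (n + 1), (fun _ => 1 : ℕ → R) b) * ((n : R) + 3) -
        (∑ b ∈ Finset.range (n + 1), (fun _ => 1 : ℕ → R) b * if b < s then 1 else 0) *
          (∑ c ∈ Finset.range (n + 1), β c * if c < s then 1 else 0) -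
        (∑ b ∈ Finset.range (n + 1), (fun _ => 1 : ℕ → R) b * if s < b then 1 else 0) *
          (∑ c ∈ Finset.range (n + 1), β c * if s < c then 1 else 0)) * P s =
      C ((n + 1) * (n + 3) - s * (s + 1) - (n - s) * (n - s + 1) : R) * P s := by
    intro s hs
    have hsn : s ≤ n := Nat.le_of_lt_succ (Finset.mem_range.mp hs)
    have h0 : ∑ b ∈ Finset.range (n + 1), (fun _ => 1 : ℕ → R) b = n + 1 := by simp
    have h1 : ∑ c ∈ Finset.range (n + 1), β c * (if c < s then 1 else 0) =
        s + if 0 < s then 1 else 0 := by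
      simp only [β, add_mul, Finset.sum_add_distrib, one_mul, sum_ite_lt hsn, ite_mul, zero_mul,
        Finset.sum_ite_eq', Finset.mem_range]
      have : ¬ n < s := by omega
      simp [this]
    have h2 : ∑ c ∈ Finset.range (n + 1), β c * (if s < c then 1 else 0) =
        (n - s) + if s < n then 1 else 0 := by
      simp only [β, add_mul, Finset.sum_add_distrib, one_mul, sum_ite_gt hsn, ite_mul, zero_mul,
        Finset.sum_ite_eq', Finset.mem_range]
      simp
    congr 2
    rw [h0, h1, h2]
    simp only [one_mul, sum_ite_lt hsn, sum_ite_gt hsn]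
    -- The missing unit at s = 0 is irrelevant, because the other partial sum vanishes there; the
    -- same happens at s = n below.
    have e1 : (s : R) * (s + if 0 < s then 1 else 0) = s * (s + 1) := by
      rcases Nat.eq_zero_or_pos s with rfl | h
      · simp
      · simp [h]
    have e2 : ((n : R) - s) * ((n - s) + if s < n then 1 else 0) = (n - s) * (n - s + 1) := by
      rcases Nat.lt_or_ge s n with h | h
      · simp [h]
      · obtain rfl : s = n := by omega
        simp
    rw [e1, e2]
  rw [Finset.sum_congr rfl hcoef]
  simp
  ring

end Quadratic

end Halin

/-! ### The balanced family at a leg -/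

namespace Halin

open MvPolynomial

variable {V : Type*} [Fintype V] [DecidableEq V]

theorem Free.ofNat {K R : Type*} [CommRing R] {k : K} (n : ℕ) [n.AtLeastTwo] :
    Free k (OfNat.ofNat n : MvPolynomial K R) := by
  rw [← Nat.cast_ofNat]
  exact Free.natCast _

namespace Rooted

variable {T : PlaneTree V} {r : V} {par : V → V} {l : ℕ} {g : ℕ → V} (h : Rooted T r par l g)

include h

theorem par_adj {u : V} (hu : u ≠ r) : T.closure.Adj u (par u) := by
  rw [PlaneTree.closure_adj]
  exact Or.inl (h.par_spec u hu).1

/-- Twisting by an alternating sign turns differences along edges into sums. -/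
theorem edgeProd_twist {A : Type*} [CommRing A] {ε : V → ℤ} (hε : ∀ v, ε v = 1 ∨ ε v = -1)
    (halt : ∀ u v, T.closure.Adj u v → ε v = -ε u) (ξ : V → A) (m : ℕ) :
    ∃ U : A, U * U = 1 ∧ h.edgeProd (fun u => (ε u : A) * ξ u) m =
      U * ((∏ u ∈ T.internal.erase r, (ξ u + ξ (par u))) *
        ((∏ i ∈ Finset.range l, (ξ (g i) + ξ (par (g i)))) *
          ∏ i ∈ Finset.range m, (ξ (g i) + ξ (g (i + 1))))) := by
  have hsq : ∀ v, (ε v : A) * (ε v : A) = 1 := fun v => by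
    rcases hε v with e | e <;> simp [e]
  have hadj : ∀ u v, T.closure.Adj u v → (ε u : A) * ξ u - (ε v : A) * ξ v = ε u * (ξ u + ξ v) := by
    intro u v huv
    rw [halt u v huv]
    push_cast
    ring
  refine ⟨(∏ u ∈ T.internal.erase r, (ε u : A)) * ((∏ i ∈ Finset.range l, (ε (g i) : A)) *
    ∏ i ∈ Finset.range m, (ε (g i) : A)), ?_, ?_⟩
  · have hcomm : ∀ a b c : A, a * (b * c) * (a * (b * c)) = a * a * (b * b * (c * c)) := by
      intros; ring
    rw [hcomm, ← Finset.prod_mul_distrib, ← Finset.prod_mul_distrib, ← Finset.prod_mul_distrib]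
    simp [hsq]
  · rw [edgeProd, Finset.prod_congr rfl fun u hu => hadj u (par u) (h.par_adj
      (Finset.mem_erase.mp hu).1), Finset.prod_congr rfl fun i _ => hadj (g i) (par (g i))
      (h.par_adj (h.leaf_ne_root i)), Finset.prod_congr rfl fun i _ => hadj (g i) (g (i + 1))
      (h.next_adj i), Finset.prod_mul_distrib, Finset.prod_mul_distrib, Finset.prod_mul_distrib]
    ring

theorem sum_eq_internal_add_leaves {A : Type*} [AddCommMonoid A] (f : V → A) :
    ∑ u, f u = ∑ u ∈ T.internal, f u + ∑ i ∈ Finset.range l, f (g i) := by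
  classical
  have hint : T.internal = Finset.univ.filter fun u => ¬ T.IsLeaf u := by
    ext u
    simp [PlaneTree.mem_internal]
  rw [hint, ← Finset.sum_filter_add_sum_filter_not (M := A) Finset.univ (fun u => ¬ T.IsLeaf u) f]
  congr 1
  · have : Finset.univ.filter (fun u => ¬¬ T.IsLeaf u) = (Finset.range l).image g := by
      ext u
      simp only [not_not, Finset.mem_filter, Finset.mem_univ, true_and, Finset.mem_image,
        Finset.mem_range]
      exact ⟨fun hu => h.exists_index hu, by rintro ⟨i, -, rfl⟩; exact h.order.isLeaf i⟩
    rw [this, Finset.sum_image]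
    intro i hi j hj e
    exact h.leaf_inj (by simpa using hi) (by simpa using hj) e

variable {R : Type*} [CommRing R]

/-- The balanced family for a leg `g 0, v` of length two at the root. -/
theorem exists_balanced {v : V} (hv : ¬ T.IsLeaf v) (R : Type*) [CommRing R] :
    ∃ ξ : V → MvPolynomial V R, (∀ i < l, ξ (g i) = X (g i)) ∧
      (∀ u, ¬ T.IsLeaf u → u ≠ v → ξ u = h.form (-1) u) ∧ ∑ u, ξ u = 0 ∧
      (∀ u, ξ u ∈ idealOfVars V R) ∧
      ξ v = -(∑ i ∈ Finset.range l, X (g i) + ∑ u ∈ T.internal.erase v, h.form (-1) u) := by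
  classical
  obtain ⟨ξ₀, h1, h2⟩ := h.exists_values (A := MvPolynomial V R) (fun i => X (g i))
    (fun u => if u = v then -(∑ i ∈ Finset.range l, X (g i) +
      ∑ u ∈ T.internal.erase v, h.form (-1) u) else h.form (-1) u)
  have hv' := h2 v hv
  rw [if_pos rfl] at hv'
  have h3 : ∀ u, ¬ T.IsLeaf u → u ≠ v → ξ₀ u = h.form (-1) u := fun u hu huv => by
    rw [h2 u hu, if_neg huv]
  refine ⟨ξ₀, h1, h3, ?_, fun u => ?_, hv'⟩
  · rw [h.sum_eq_internal_add_leaves, ← Finset.add_sum_erase _ _ (PlaneTree.mem_internal.mpr hv),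
      hv', Finset.sum_congr rfl fun u hu => h3 u (PlaneTree.mem_internal.mp
      (Finset.mem_of_mem_erase hu)) (Finset.ne_of_mem_erase hu),
      Finset.sum_congr rfl fun i hi => h1 i (Finset.mem_range.mp hi)]
    ring
  · by_cases hu : T.IsLeaf u
    · obtain ⟨i, hi, rfl⟩ := h.exists_index hu
      rw [h1 i hi]
      exact Ideal.subset_span ⟨_, rfl⟩
    · by_cases huv : u = v
      · subst huv
        rw [hv']
        exact neg_mem (add_mem (sum_mem fun _ _ => Ideal.subset_span ⟨_, rfl⟩)
          (sum_mem fun _ _ => h.form_mem _ _))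
      · rw [h3 u hu huv]
        exact h.form_mem _ _

omit h in
theorem unit_mul_notMem {I : Ideal (MvPolynomial V R)} {U p : MvPolynomial V R} (hU : U * U = 1)
    (hp : p ∉ I) : U * p ∉ I := by
  intro hmem
  have := I.mul_mem_left U hmem
  rw [← mul_assoc, hU, one_mul] at this
  exact hp this

variable {v : V} (hv : ¬ T.IsLeaf v) (hvr : v ≠ r) (hpv : par v = r) (hg0 : par (g 0) = v)
  (hchild : ∀ u, u ≠ r → par u = v → u = g 0)

include hv hvr hpv hg0 hchild

theorem prod_internal_leg {ξ : V → MvPolynomial V R}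
    (h2 : ∀ u, ¬ T.IsLeaf u → u ≠ v → ξ u = h.form (-1) u) :
    ∏ u ∈ T.internal.erase r, (ξ u + ξ (par u)) =
      (ξ v + h.form (-1) r) * ∏ u ∈ (T.internal.erase r).erase v, X u := by
  rw [← Finset.mul_prod_erase _ _ (Finset.mem_erase.mpr ⟨hvr, PlaneTree.mem_internal.mpr hv⟩), hpv,
    h2 r h.root hvr.symm]
  congr 1
  refine Finset.prod_congr rfl fun u hu => ?_
  rw [Finset.mem_erase, Finset.mem_erase, PlaneTree.mem_internal] at hu
  obtain ⟨huv, hur, hul⟩ := hu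
  have hpu : par u ≠ v := fun e => hul (hchild u hur e ▸ h.order.isLeaf 0)
  rw [h2 u hul huv, h2 _ (h.par_internal hur) hpu, h.form_eq _ hur]
  simp

theorem prod_pendant_leg {n : ℕ} (hn : l = n + 2) {ξ : V → MvPolynomial V R}
    (h1 : ∀ i < l, ξ (g i) = X (g i)) (h2 : ∀ u, ¬ T.IsLeaf u → u ≠ v → ξ u = h.form (-1) u) :
    ∏ i ∈ Finset.range l, (ξ (g i) + ξ (par (g i))) = (X (g 0) + ξ v) *
      ∏ j ∈ Finset.range (n + 1), (X (g (j + 1)) + h.form (-1) (par (g (j + 1)))) := by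
  subst hn
  rw [Finset.prod_range_succ', mul_comm, hg0, h1 0 h.pos]
  congr 1
  refine Finset.prod_congr rfl fun j hj => ?_
  rw [Finset.mem_range] at hj
  rw [h1 (j + 1) (by omega), h2 _ (h.par_internal (h.leaf_ne_root _))]
  intro e
  have := h.leaf_inj (by omega) h.pos (hchild _ (h.leaf_ne_root _) e)
  omega

omit hv hvr hpv hg0 hchild in
theorem hw_leg {n : ℕ} (hn : l = n + 2) :
    ∀ i ≤ n, ∀ j ≤ n, (fun i => g (i + 1)) i = (fun i => g (i + 1)) j → i = j := by
  intro i hi j hj e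
  have := h.leaf_inj (by omega) (by omega) e
  omega

omit hv hvr hpv hg0 hchild in
theorem notMem_of_top_leg {n : ℕ} {Q : MvPolynomial V R} (s : Finset V)
    (hs : ∀ u ∈ s, ¬ T.IsLeaf u)
    (hQ : tops (fun i => g (i + 1)) n (top (g 0) Q) * ∏ u ∈ s, X u ∉ cubeIdeal V R) :
    Q * ∏ u ∈ s, X u ∉ cubeIdeal V R := by
  have hf : ∀ i, Free (g i) (∏ u ∈ s, X u : MvPolynomial V R) := fun i =>
    Free.prod _ fun u hu => Free.X fun e => hs u hu (e ▸ h.order.isLeaf i)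
  refine notMem_of_tops (w := g) (n := 0) (fun j _ => hf j) ?_
  exact notMem_of_tops (w := fun i => g (i + 1)) (n := n) (fun j _ => hf (j + 1)) hQ

/-- With two leaves the rim is one edge, so the product lacks the closing factor of the general
case. The coefficient of X (g 0) ^ 2 is (X (g 1) + I)(X (g 1) + P), which is monic in X (g 1). -/
theorem exists_notMem_leg_two (hl : l = 2) {ε : V → ℤ} (hε : ∀ v, ε v = 1 ∨ ε v = -1)
    (halt : ∀ u v, T.closure.Adj u v → ε v = -ε u) : ∃ x : V → MvPolynomial V (ZMod 3),
      (∀ v, x v ∈ idealOfVars V (ZMod 3)) ∧ ∑ v, (ε v : MvPolynomial V (ZMod 3)) * x v = 0 ∧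
      h.edgeProd x 1 ∉ cubeIdeal V (ZMod 3) := by
  subst hl
  obtain ⟨ξ, h1, h2, h3, h4, h5⟩ := h.exists_balanced hv (ZMod 3)
  refine ⟨fun u => ε u * ξ u, fun u => Ideal.mul_mem_left _ _ (h4 u), ?_, ?_⟩
  · rw [← h3]
    refine Finset.sum_congr rfl fun u _ => ?_
    rcases hε u with e | e <;> simp [e]
  obtain ⟨U, hU, hprod⟩ := h.edgeProd_twist hε halt ξ 1
  rw [hprod]
  refine unit_mul_notMem hU ?_
  rw [h.prod_internal_leg hv hvr hpv hg0 hchild h2,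
    h.prod_pendant_leg hv hvr hpv hg0 hchild (n := 0) rfl h1 h2, h5]
  simp only [Finset.prod_range_succ, Finset.prod_range_zero, Finset.sum_range_succ,
    Finset.sum_range_zero, zero_add, one_mul, h1 0 h.pos, h1 1 (by omega)]
  set I := ∑ u ∈ T.internal.erase v, h.form (-1 : ZMod 3) u with hI
  set S := h.form (-1 : ZMod 3) r with hS
  set P := h.form (-1 : ZMod 3) (par (g 1)) with hP
  have fI : ∀ i, Free (g i) I := fun i => Free.sum _ fun u hu =>
    h.free_form _ (PlaneTree.mem_internal.mp (Finset.mem_of_mem_erase hu)) (h.order.isLeaf i)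
  have fS : ∀ i, Free (g i) S := fun i => h.free_form _ h.root (h.order.isLeaf i)
  have fP : ∀ i, Free (g i) P := fun i => h.free_form _ (h.par_internal (h.leaf_ne_root 1))
    (h.order.isLeaf i)
  have f01 : Free (g 0) (X (g 1) : MvPolynomial V (ZMod 3)) := Free.X fun e => by
    have := h.leaf_inj (by omega) h.pos e
    omega
  have e1 : (-(X (g 0) + X (g 1) + I) + S) * (∏ u ∈ (T.internal.erase r).erase v, X u) *
      ((X (g 0) + -(X (g 0) + X (g 1) + I)) * (X (g 1) + P) * (X (g 0) + X (g 1))) =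
      (((X (g 1) + I - S) * X (g 1) * ((X (g 1) + I) * (X (g 1) + P)) +
        ((X (g 1) + I - S + X (g 1)) * ((X (g 1) + I) * (X (g 1) + P))) * X (g 0) +
        ((X (g 1) + I) * (X (g 1) + P)) * X (g 0) ^ 2 + X (g 0) ^ 3 * 0)) *
        ∏ u ∈ (T.internal.erase r).erase v, X u := by ring
  rw [e1]
  refine h.notMem_of_top_leg (n := 0) _ (fun u hu =>
    PlaneTree.mem_internal.mp (Finset.mem_of_mem_erase (Finset.mem_of_mem_erase hu))) ?_
  have fc := (f01.add (fI 0)).mul (f01.add (fP 0))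
  have fd := (f01.add (fI 0)).sub (fS 0)
  rw [top_poly_add ((fd.mul f01).mul fc) ((fd.add f01).mul fc) fc]
  have e2 : 2 * ((X (g 1) + I) * (X (g 1) + P)) = 2 * (I * P) + (2 * (I + P)) * X (g 1) +
      2 * X (g 1) ^ 2 + X (g 1) ^ 3 * 0 := by ring
  have f2 : Free (g 1) (2 : MvPolynomial V (ZMod 3)) := Free.ofNat 2
  rw [tops, e2, top_poly_add (f2.mul ((fI 1).mul (fP 1))) (f2.mul ((fI 1).add (fP 1))) f2]
  have : (2 * 2 : MvPolynomial V (ZMod 3)) = C (2 * 2) := by rw [map_mul, map_ofNat]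
  rw [this]
  exact C_mul_prod_X_notMem _ (by decide)

-- In X (g 0) the product is cubic: the balancing form cancels X (g 0) from the pendant factor of
-- the leg but keeps it in the factor to the root. The coefficient of the square is the one in
-- `tops_leg`, and `hc` says that the remaining combination of forms has a nonzero coefficient.
open Classical in
theorem exists_notMem_leg {n : ℕ} (hn : l = n + 2) {ε : V → ℤ} (hε : ∀ v, ε v = 1 ∨ ε v = -1)
    (halt : ∀ u v, T.closure.Adj u v → ε v = -ε u)
    (hc : ∃ u ∈ T.internal, (if u = v then 0 else ((n : ZMod 3) + 3 + (n + 1))) -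
      (if u = r then ((n : ZMod 3) + 1) else 0) +
      ∑ s ∈ Finset.range (n + 1), (if u = par (g (s + 1)) then
        ((n + 1) * (n + 3) - s * (s + 1) - (n - s) * (n - s + 1) : ZMod 3) else 0) ≠ 0) :
    ∃ x : V → MvPolynomial V (ZMod 3),
      (∀ v, x v ∈ idealOfVars V (ZMod 3)) ∧ ∑ v, (ε v : MvPolynomial V (ZMod 3)) * x v = 0 ∧
      h.edgeProd x l ∉ cubeIdeal V (ZMod 3) := by
  obtain ⟨ξ, h1, h2, h3, h4, h5⟩ := h.exists_balanced hv (ZMod 3)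
  refine ⟨fun u => ε u * ξ u, fun u => Ideal.mul_mem_left _ _ (h4 u), ?_, ?_⟩
  · rw [← h3]
    refine Finset.sum_congr rfl fun u _ => ?_
    rcases hε u with e | e <;> simp [e]
  obtain ⟨U, hU, hprod⟩ := h.edgeProd_twist hε halt ξ l
  rw [hprod]
  refine unit_mul_notMem hU ?_
  have hrim : ∏ i ∈ Finset.range l, (ξ (g i) + ξ (g (i + 1))) =
      (X (g 0) + X (g 1)) * (X (g (n + 1)) + X (g 0)) *
        ∏ j ∈ Finset.range n, (X (g (j + 1)) + X (g (j + 1 + 1))) := by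
    have : ∏ i ∈ Finset.range (n + 1 + 1), (ξ (g i) + ξ (g (i + 1))) =
      (X (g 0) + X (g 1)) * (X (g (n + 1)) + X (g 0)) *
        ∏ j ∈ Finset.range n, (X (g (j + 1)) + X (g (j + 1 + 1))) := by
      have e0 : g (n + 1 + 1) = g 0 := (h.order.eq_iff _ _).mpr (by
        rw [show n + 1 + 1 = l by omega]; simp [Nat.ModEq])
      have hmid : ∏ j ∈ Finset.range n, (ξ (g (j + 1)) + ξ (g (j + 1 + 1))) =
          ∏ j ∈ Finset.range n, (X (g (j + 1)) + X (g (j + 1 + 1))) := by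
        refine Finset.prod_congr rfl fun j hj => ?_
        rw [Finset.mem_range] at hj
        rw [h1 (j + 1) (by omega), h1 (j + 1 + 1) (by omega)]
      rw [Finset.prod_range_succ, Finset.prod_range_succ', e0, h1 0 h.pos, h1 (n + 1) (by omega),
        h1 (0 + 1) (by omega), hmid]
      ring
    rw [← this, hn]
  have hsum : ∑ i ∈ Finset.range l, (X (g i) : MvPolynomial V (ZMod 3)) =
      ∑ j ∈ Finset.range (n + 1), X (g (j + 1)) + X (g 0) := by
    rw [hn, Finset.sum_range_succ']
  rw [h.prod_internal_leg hv hvr hpv hg0 hchild h2,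
    h.prod_pendant_leg hv hvr hpv hg0 hchild hn h1 h2, h5, hrim, hsum]
  set I := ∑ u ∈ T.internal.erase v, h.form (-1 : ZMod 3) u with hI
  set S := h.form (-1 : ZMod 3) r with hS
  set Λ := ∑ j ∈ Finset.range (n + 1), (X (g (j + 1)) : MvPolynomial V (ZMod 3)) with hΛ
  set H := pathPoly (fun j => g (j + 1)) (fun j => h.form (-1 : ZMod 3) (par (g (j + 1)))) n with hH
  have fI : ∀ i, Free (g i) I := fun i => Free.sum _ fun u hu =>
    h.free_form _ (PlaneTree.mem_internal.mp (Finset.mem_of_mem_erase hu)) (h.order.isLeaf i)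
  have fS : ∀ i, Free (g i) S := fun i => h.free_form _ h.root (h.order.isLeaf i)
  have fP : ∀ j i, Free (g i) (h.form (-1 : ZMod 3) (par (g j))) := fun j i =>
    h.free_form _ (h.par_internal (h.leaf_ne_root _)) (h.order.isLeaf i)
  have f0 : ∀ j, j + 1 < l → Free (g 0) (X (g (j + 1)) : MvPolynomial V (ZMod 3)) :=
    fun j hj => Free.X fun e => by
      have := h.leaf_inj hj h.pos e
      omega
  have fΛ : Free (g 0) Λ := Free.sum _ fun j hj => f0 j (by
    rw [Finset.mem_range] at hj; omega)
  have fH : Free (g 0) H := (Free.prod _ fun j hj => by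
    rw [Finset.mem_range] at hj
    exact (f0 j (by omega)).add (f0 (j + 1) (by omega))).mul (Free.prod _ fun j hj => by
    rw [Finset.mem_range] at hj
    exact (f0 j (by omega)).add (fP _ _))
  have e1 : (-(Λ + X (g 0) + I) + S) * (∏ u ∈ (T.internal.erase r).erase v, X u) *
      ((X (g 0) + -(Λ + X (g 0) + I)) *
        (∏ j ∈ Finset.range (n + 1), (X (g (j + 1)) + h.form (-1 : ZMod 3) (par (g (j + 1))))) *
        ((X (g 0) + X (g 1)) * (X (g (n + 1)) + X (g 0)) *
          ∏ j ∈ Finset.range n, (X (g (j + 1)) + X (g (j + 1 + 1))))) =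
      (((Λ + (I - S)) * X (g (0 + 1)) * X (g (n + 1)) * ((Λ + I) * H) +
        ((X (g (0 + 1)) * X (g (n + 1)) + (Λ + (I - S)) * (X (g (0 + 1)) + X (g (n + 1)))) *
          ((Λ + I) * H)) * X (g 0) +
        ((Λ + I) * ((Λ + (I - S) + X (g (0 + 1)) + X (g (n + 1))) * H)) * X (g 0) ^ 2 +
          X (g 0) ^ 3 * ((Λ + I) * H))) * ∏ u ∈ (T.internal.erase r).erase v, X u := by
    rw [hH, pathPoly]
    ring
  rw [e1]
  refine h.notMem_of_top_leg (n := n) _ (fun u hu =>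
    PlaneTree.mem_internal.mp (Finset.mem_of_mem_erase (Finset.mem_of_mem_erase hu))) ?_
  have f1 := f0 0 (by omega)
  have fn := f0 n (by omega)
  have fc := (fΛ.add (fI 0)).mul fH
  have fd := fΛ.add ((fI 0).sub (fS 0))
  rw [top_poly_add (((fd.mul f1).mul fn).mul fc) (((f1.mul fn).add (fd.mul (f1.add fn))).mul fc)
    ((fΛ.add (fI 0)).mul (((fd.add f1).add fn).mul fH)), tops_two_mul]
  have key := tops_leg (h.hw_leg hn)
    (P := fun j => h.form (-1 : ZMod 3) (par (g (j + 1)))) (fun i _ j _ => fP _ _)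
    (I := I) (J := I - S) (fun j _ => fI _) (fun j _ => (fI _).sub (fS _))
  rw [key]
  -- Regrouping by internal vertices: I contributes everywhere except at v, S only at the root, and
  -- each pendant form at the parent of its leaf.
  have hform : ∑ s ∈ Finset.range (n + 1),
      C ((n + 1) * (n + 3) - s * (s + 1) - (n - s) * (n - s + 1) : ZMod 3) *
        h.form (-1 : ZMod 3) (par (g (s + 1))) +
        C ((n : ZMod 3) + 1) * (I - S) + C ((n : ZMod 3) + 3) * I =
      ∑ u ∈ T.internal, C ((if u = v then 0 else ((n : ZMod 3) + 3 + (n + 1))) -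
      (if u = r then ((n : ZMod 3) + 1) else 0) +
      ∑ s ∈ Finset.range (n + 1), (if u = par (g (s + 1)) then
        ((n + 1) * (n + 3) - s * (s + 1) - (n - s) * (n - s + 1) : ZMod 3) else 0)) *
        h.form (-1 : ZMod 3) u := by
    have hsplit : ∀ (a b : ZMod 3) (f : ℕ → ZMod 3) (F : MvPolynomial V (ZMod 3)),
        C (a - b + ∑ s ∈ Finset.range (n + 1), f s) * F =
          C a * F - C b * F + ∑ s ∈ Finset.range (n + 1), C (f s) * F := by
      intro a b f F
      rw [map_add, map_sub, map_sum, add_mul, sub_mul, Finset.sum_mul]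
    rw [Finset.sum_congr rfl fun u _ => hsplit _ _ _ _, Finset.sum_add_distrib,
      Finset.sum_sub_distrib, Finset.sum_comm (s := T.internal)]
    have hA : ∑ u ∈ T.internal, C (if u = v then 0 else ((n : ZMod 3) + 3 + (n + 1))) *
        h.form (-1 : ZMod 3) u = C ((n : ZMod 3) + 3 + (n + 1)) * I := by
      rw [← Finset.add_sum_erase _ _ (PlaneTree.mem_internal.mpr hv), if_pos rfl, map_zero, zero_mul,
        zero_add, hI, Finset.mul_sum]
      exact Finset.sum_congr rfl fun u hu => by rw [if_neg (Finset.ne_of_mem_erase hu)]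
    have hB : ∑ u ∈ T.internal, C (if u = r then ((n : ZMod 3) + 1) else 0) *
        h.form (-1 : ZMod 3) u = C ((n : ZMod 3) + 1) * S := by
      rw [Finset.sum_eq_single r (fun u _ hu => by rw [if_neg hu, map_zero, zero_mul])
        (fun hr => absurd (PlaneTree.mem_internal.mpr h.root) hr), if_pos rfl]
    have hD : ∀ s ∈ Finset.range (n + 1), ∑ u ∈ T.internal, C (if u = par (g (s + 1)) then
        ((n + 1) * (n + 3) - s * (s + 1) - (n - s) * (n - s + 1) : ZMod 3) else 0) *
        h.form (-1 : ZMod 3) u =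
        C ((n + 1) * (n + 3) - s * (s + 1) - (n - s) * (n - s + 1) : ZMod 3) *
        h.form (-1 : ZMod 3) (par (g (s + 1))) := by
      intro s _
      rw [Finset.sum_eq_single (par (g (s + 1)))
        (fun u _ hu => by rw [if_neg hu, map_zero, zero_mul])
        (fun hr => absurd (PlaneTree.mem_internal.mpr (h.par_internal (h.leaf_ne_root _))) hr),
        if_pos rfl]
    rw [hA, hB, Finset.sum_congr rfl hD, map_add C ((n : ZMod 3) + 3)]
    ring
  rw [hform]
  have hpow : (2 * 2 ^ (n + 1) : MvPolynomial V (ZMod 3)) = C (2 * 2 ^ (n + 1)) := by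
    simp only [map_mul, map_pow, map_ofNat]
  rw [← mul_assoc, hpow, Finset.mul_sum, Finset.sum_congr rfl fun u _ => by
    rw [← mul_assoc, ← map_mul]]
  obtain ⟨u, hu, hne⟩ := hc
  exact h.sum_form_mul_prod_X_notMem (-1) _ ⟨u, hu, mul_ne_zero (mul_ne_zero (by decide)
    (pow_ne_zero _ (by decide))) hne⟩

end Rooted

end Halin

/-! ### Criteria for legs in terms of leaf positions mod 3 -/

namespace Halin

open MvPolynomial

variable {V : Type*} [Fintype V] [DecidableEq V]

namespace PlaneTree

/-- The vertex `e` has exactly two neighbours, the leaf `w` and the internal vertex `q`. -/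
structure IsLeg (T : PlaneTree V) (e w q : V) : Prop where
  leaf : T.IsLeaf w
  internal : ¬ T.IsLeaf q
  adj_iff : ∀ u, T.tree.Adj e u ↔ u = w ∨ u = q

variable {T : PlaneTree V} {e w q : V}

theorem IsLeg.ne (h : T.IsLeg e w q) : w ≠ q := fun h' => h.internal (h' ▸ h.leaf)

theorem IsLeg.adj_leaf (h : T.IsLeg e w q) : T.tree.Adj e w := (h.adj_iff w).mpr (Or.inl rfl)

theorem IsLeg.adj_internal (h : T.IsLeg e w q) : T.tree.Adj e q := (h.adj_iff q).mpr (Or.inr rfl)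

theorem IsLeg.not_isLeaf (h : T.IsLeg e w q) : ¬ T.IsLeaf e := fun h' =>
  h.ne (h'.unique h.adj_leaf h.adj_internal)

theorem IsLeg.exists_rooted (h : T.IsLeg e w q) {l : ℕ} {g : ℕ → V} (ho : T.LeafOrder l g) {a : ℕ}
    (ha : g a = w) : ∃ par, Rooted T q par l (fun i => g (i + a)) ∧ e ≠ q ∧ par e = q ∧
      par (g (0 + a)) = e ∧ ∀ u, u ≠ q → par u = e → u = g (0 + a) := by
  obtain ⟨par, hr⟩ := T.exists_rooted h.internal (ho.shift a)
  have heq := h.adj_internal.ne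
  rw [zero_add, ha]
  refine ⟨par, hr, heq, ?_, ((hr.adj_leaf_iff h.leaf).mp h.adj_leaf.symm).symm, fun u hu hpu => ?_⟩
  · rcases hr.eq_par _ _ h.adj_internal with h1 | h1
    · exact h1.2.symm
    · exact absurd rfl h1.1
  · have := (hr.par_spec u hu).1
    rw [hpu] at this
    exact ((h.adj_iff u).mp this.symm).resolve_right hu

variable [DecidableRel T.closure.Adj] {l : ℕ} {g : ℕ → V} {ε : V → ℤ}

theorem IsLeg.edgePoly_notMem_two (h : T.IsLeg e w q) (ho : T.LeafOrder l g) (hl : l = 2)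
    (hε : ∀ v, ε v = 1 ∨ ε v = -1) (halt : ∀ u v, T.closure.Adj u v → ε v = -ε u)
    (hreal : ∀ x : V → MvPolynomial V (ZMod 3), (∀ v, x v ∈ idealOfVars V (ZMod 3)) →
        ∑ v, (ε v : MvPolynomial V (ZMod 3)) * x v = 0 → Realizable T.closure x)
    (D : Orientation T.closure) :
    edgePoly (ZMod 3) D ∉ cubeIdeal T.closure.edgeSet (ZMod 3) := by
  obtain ⟨a, ha⟩ := ho.surj w h.leaf
  obtain ⟨par, hr, h1, h2, h3, h4⟩ := h.exists_rooted ho ha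
  obtain ⟨x, hx, h0, hmem⟩ := hr.exists_notMem_leg_two h.not_isLeaf h1 h2 h3 h4 hl hε halt
  exact hr.edgePoly_notMem (hreal x hx h0) D (by omega) (Or.inr hl) hmem

/-- An internal vertex off the leg edge with exactly one leaf receives one pendant coefficient. Its
total is nonzero mod 3 if 3 ∤ l, or if its leaf and the leaf of the leg have congruent positions. -/
theorem IsLeg.edgePoly_notMem_of_vertex (h : T.IsLeg e w q) (ho : T.LeafOrder l g)
    (hε : ∀ v, ε v = 1 ∨ ε v = -1) (halt : ∀ u v, T.closure.Adj u v → ε v = -ε u)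
    (hreal : ∀ x : V → MvPolynomial V (ZMod 3), (∀ v, x v ∈ idealOfVars V (ZMod 3)) →
        ∑ v, (ε v : MvPolynomial V (ZMod 3)) * x v = 0 → Realizable T.closure x)
    {a b : ℕ} (ha : g a = w) {u : V} (hu : ¬ T.IsLeaf u) (hue : u ≠ e) (huq : u ≠ q)
    (hub : ∀ t, T.IsLeaf t → (T.tree.Adj u t ↔ t = g b)) (hab : ¬ 3 ∣ l ∨ a ≡ b [MOD 3])
    (D : Orientation T.closure) :
    edgePoly (ZMod 3) D ∉ cubeIdeal T.closure.edgeSet (ZMod 3) := by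
  obtain ⟨par, hr, h1, h2, h3, h4⟩ := h.exists_rooted ho ha
  obtain ⟨n, hn⟩ : ∃ n, l = n + 2 := ⟨l - 2, by have := ho.two_le; omega⟩
  obtain ⟨p, hp, hpb⟩ := hr.exists_index (ho.isLeaf b)
  have hpar : ∀ i < l, u = par (g (i + a)) ↔ i = p := by
    intro i hi
    rw [← hr.adj_leaf_iff (ho.isLeaf _), SimpleGraph.adj_comm, hub _ (ho.isLeaf _), ← hpb]
    exact ⟨fun e => hr.leaf_inj hi hp e, fun e => by rw [e]⟩
  obtain ⟨s, rfl⟩ : ∃ s, p = s + 1 := by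
    refine ⟨p - 1, ?_⟩
    have : p ≠ 0 := by
      rintro rfl
      exact hue (((hpar 0 (by omega)).mpr rfl).trans h3)
    omega
  have hcond : ((n : ZMod 3) + 2 ≠ 0 ∨ (s : ZMod 3) + 1 = 0) := by
    have cast3 : ∀ m : ℕ, (m : ZMod 3) = 0 ↔ 3 ∣ m := fun m => ZMod.natCast_eq_zero_iff m 3
    rcases hab with hab | hab
    · left
      rw [hn, ← cast3] at hab
      exact_mod_cast hab
    · by_cases h3l : 3 ∣ l
      · right
        have e1 := (ho.eq_iff _ _).mp hpb
        have e2 := (e1.of_dvd h3l).trans hab.symm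
        rw [← zero_add a, ← add_assoc, add_zero] at e2
        have e3 := Nat.ModEq.add_right_cancel' a e2
        have := (cast3 (s + 1)).mpr ((Nat.modEq_zero_iff_dvd).mp e3)
        exact_mod_cast this
      · left
        rw [hn, ← cast3] at h3l
        exact_mod_cast h3l
  have hfin : ∀ N S : ZMod 3, (N + 2 ≠ 0 ∨ S + 1 = 0) →
      N + 3 + (N + 1) - 0 + ((N + 1) * (N + 3) - S * (S + 1) - (N - S) * (N - S + 1)) ≠ 0 := by
    decide
  obtain ⟨x, hx, h0, hmem⟩ := hr.exists_notMem_leg h.not_isLeaf h1 h2 h3 h4 hn hε halt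
    ⟨u, mem_internal.mpr hu, by
      rw [if_neg hue, if_neg huq, Finset.sum_eq_single s]
      · rw [if_pos ((hpar (s + 1) hp).mpr rfl)]
        exact hfin _ _ hcond
      · intro j hj hjs
        rw [Finset.mem_range] at hj
        refine if_neg fun e => hjs ?_
        have := (hpar (j + 1) (by omega)).mp e
        omega
      · intro hs
        rw [Finset.mem_range] at hs
        omega⟩
  exact hr.edgePoly_notMem (hreal x hx h0) D (by omega) (Or.inl le_rfl) hmem

/-- When 3 ∣ l, pendant coefficients vanish at positions not congruent to that of the leg's leaf.
The coefficient at q is then n + 3, which is 1 mod 3 because n + 2 = l. -/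
theorem IsLeg.edgePoly_notMem_of_positions (h : T.IsLeg e w q) (ho : T.LeafOrder l g)
    (hε : ∀ v, ε v = 1 ∨ ε v = -1) (halt : ∀ u v, T.closure.Adj u v → ε v = -ε u)
    (hreal : ∀ x : V → MvPolynomial V (ZMod 3), (∀ v, x v ∈ idealOfVars V (ZMod 3)) →
        ∑ v, (ε v : MvPolynomial V (ZMod 3)) * x v = 0 → Realizable T.closure x)
    {a : ℕ} (ha : g a = w) (hl : 3 ∣ l) (hpos : ∀ b, T.tree.Adj q (g b) → ¬ a ≡ b [MOD 3])
    (D : Orientation T.closure) :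
    edgePoly (ZMod 3) D ∉ cubeIdeal T.closure.edgeSet (ZMod 3) := by
  obtain ⟨par, hr, h1, h2, h3, h4⟩ := h.exists_rooted ho ha
  obtain ⟨n, hn⟩ : ∃ n, l = n + 2 := ⟨l - 2, by have := ho.two_le; omega⟩
  have cast3 : ∀ m : ℕ, (m : ZMod 3) = 0 ↔ 3 ∣ m := fun m => ZMod.natCast_eq_zero_iff m 3
  have hN : (n : ZMod 3) + 2 = 0 := by
    rw [hn, ← cast3] at hl
    exact_mod_cast hl
  have hfin : ∀ N S : ZMod 3, N + 2 = 0 → S + 1 ≠ 0 →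
      (N + 1) * (N + 3) - S * (S + 1) - (N - S) * (N - S + 1) = 0 := by
    decide
  have hfin' : ∀ N : ZMod 3, N + 2 = 0 → N + 3 + (N + 1) - (N + 1) + 0 ≠ 0 := by
    decide
  obtain ⟨x, hx, h0, hmem⟩ := hr.exists_notMem_leg h.not_isLeaf h1 h2 h3 h4 hn hε halt
    ⟨q, mem_internal.mpr h.internal, by
      rw [if_neg h1.symm, if_pos rfl, Finset.sum_eq_zero]
      · exact hfin' _ hN
      · intro s _
        split_ifs with hs
        · refine hfin _ _ hN fun h0 => ?_
          refine hpos (s + 1 + a) ((hr.adj_leaf_iff (ho.isLeaf _)).mpr hs).symm ?_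
          have h3 : 3 ∣ s + 1 := by
            rw [← cast3]
            exact_mod_cast h0
          have := ((Nat.modEq_zero_iff_dvd).mpr h3).add_right a
          rw [zero_add] at this
          exact this.symm
        · rfl⟩
  exact hr.edgePoly_notMem (hreal x hx h0) D (by omega) (Or.inl le_rfl) hmem

end PlaneTree

end Halin

/-! ### Legs in balanced bipartite trees -/

namespace Halin

variable {V : Type*} [Fintype V] [DecidableEq V]

namespace PlaneTree

variable {T : PlaneTree V}

/-- The walk around the tree which starts with `d` reaches a first leaf `t` after `m` steps and
returns to the next dart around its starting point after `m` further steps without meeting a leaf. -/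
structure Tip (T : PlaneTree V) (d : T.tree.Dart) (t : V) (m : ℕ) : Prop where
  leaf : T.IsLeaf t
  pos : 0 < m
  fst : (T.faceStep^[m] d).fst = t
  down : ∀ k, 0 < k → k < m → ¬ T.IsLeaf (T.faceStep^[k] d).fst
  back : T.faceStep^[m + m] d = T.rot d
  up : ∀ k, m < k → k < m + m → ¬ T.IsLeaf (T.faceStep^[k] d).fst

/-- The walk returns from the first tip to the internal centre and then descends into the next tip,
meeting no leaf in between. -/
theorem Tip.nextLeaf {d : T.tree.Dart} {t t' : V} {m m' : ℕ} (hd : ¬ T.IsLeaf d.fst)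
    (h : T.Tip d t m) (h' : T.Tip (T.rot d) t' m') : T.NextLeaf t t' := by
  have hiter : ∀ j, T.faceStep^[m + j] (T.faceStep^[m] d) = T.faceStep^[j] (T.rot d) := by
    intro j
    rw [← h.back, ← Function.iterate_add_apply, ← Function.iterate_add_apply]
    congr 1
    omega
  refine ⟨h.leaf, h'.leaf, T.faceStep^[m] d, h.fst, m + m', by have := h.pos; omega, ?_, ?_⟩
  · rw [hiter, h'.fst]
  · intro k hk hk'
    rcases lt_trichotomy k m with hlt | rfl | hgt
    · rw [← Function.iterate_add_apply]
      exact h.up _ (by omega) (by omega)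
    · have := hiter 0
      rw [add_zero] at this
      rw [this, Function.iterate_zero_apply, T.rot_fst]
      exact hd
    · obtain ⟨j, rfl⟩ : ∃ j, k = m + j := ⟨k - m, by omega⟩
      rw [hiter]
      exact h'.down j (by omega) (by omega)

theorem faceStep_of_isLeaf {d : T.tree.Dart} (h : T.IsLeaf d.snd) : T.faceStep d = d.symm :=
  IsLeaf.dart_eq T (by rwa [faceStep_fst]) (by rw [faceStep_fst]; rfl)

theorem tip_of_isLeaf {d : T.tree.Dart} (h : T.IsLeaf d.snd) : T.Tip d d.snd 1 := by
  have h1 := faceStep_of_isLeaf h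
  refine ⟨h, one_pos, by rw [Function.iterate_one, h1]; rfl, fun k _ _ => by omega, ?_,
    fun k _ _ => by omega⟩
  rw [Function.iterate_add_apply, Function.iterate_one, h1, faceStep_symm]

theorem dart_ext {d d' : T.tree.Dart} (h1 : d.fst = d'.fst) (h2 : d.snd = d'.snd) : d = d' :=
  SimpleGraph.Dart.ext _ _ (Prod.ext h1 h2)

theorem rot_ne {d d' : T.tree.Dart} (h : d.fst = d'.fst) (hne : d' ≠ d) : T.rot d ≠ d := by
  intro hfix
  exact hne ((T.rot_sameCycle d d' h).eq_of_left hfix).symm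

theorem eq_or_eq_of_rot {d₀ d₁ : T.tree.Dart} (h₀ : T.rot d₀ = d₁) (h₁ : T.rot d₁ = d₀)
    (d : T.tree.Dart) (hd : d.fst = d₀.fst) : d = d₀ ∨ d = d₁ := by
  have : Finite T.tree.Dart := Finite.of_injective _ SimpleGraph.Dart.toProd_injective
  obtain ⟨n, rfl⟩ := (T.rot_sameCycle d₀ d hd.symm).exists_nat_pow_eq
  clear hd
  induction n with
  | zero => simp
  | succ n ih =>
    rw [pow_succ', Equiv.Perm.mul_apply]
    rcases ih with h | h <;> rw [h]
    · exact Or.inr h₀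
    · exact Or.inl h₁

theorem IsLeg.tip {d : T.tree.Dart} {w : V} (h : T.IsLeg d.snd w d.fst) : T.Tip d w 2 := by
  have hw : T.tree.Adj d.snd w := h.adj_leaf
  have hne : (⟨(d.snd, w), hw⟩ : T.tree.Dart) ≠ d.symm := fun e =>
    h.ne (congrArg (fun d : T.tree.Dart => d.snd) e)
  have hf1 : (T.faceStep d).fst = d.snd := T.faceStep_fst d
  have h1 : T.faceStep d = ⟨(d.snd, w), hw⟩ := by
    refine dart_ext hf1 ?_
    have hadj : T.tree.Adj d.snd (T.faceStep d).snd := hf1 ▸ (T.faceStep d).adj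
    refine ((h.adj_iff _).mp hadj).resolve_right fun e => ?_
    exact rot_ne (d := d.symm) (d' := ⟨(d.snd, w), hw⟩) rfl hne (dart_ext hf1 e)
  have h2 : T.faceStep ⟨(d.snd, w), hw⟩ = ⟨(w, d.snd), hw.symm⟩ := faceStep_of_isLeaf h.leaf
  have h3 : T.faceStep ⟨(w, d.snd), hw.symm⟩ = d.symm := by
    have hf : (T.faceStep ⟨(w, d.snd), hw.symm⟩).fst = d.snd := T.faceStep_fst _
    refine dart_ext hf ?_
    have hadj := hf ▸ (T.faceStep ⟨(w, d.snd), hw.symm⟩).adj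
    refine ((h.adj_iff _).mp hadj).resolve_left fun e => ?_
    exact rot_ne (d := ⟨(d.snd, w), hw⟩) (d' := d.symm) rfl hne.symm (dart_ext hf e)
  refine ⟨h.leaf, two_pos, ?_, ?_, ?_, ?_⟩
  · simp only [Function.iterate_succ_apply', Function.iterate_zero_apply, h1, h2]
  · intro k hk hk'
    obtain rfl : k = 1 := by omega
    rw [Function.iterate_one, hf1]
    exact h.not_isLeaf
  · simp only [Function.iterate_succ_apply', Function.iterate_zero_apply, h1, h2, h3]
    exact T.faceStep_symm d
  · intro k hk hk'
    obtain rfl : k = 3 := by omega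
    simp only [Function.iterate_succ_apply', Function.iterate_zero_apply, h1, h2, h3]
    exact h.not_isLeaf

section Bipartite

variable {l : ℕ} {g : ℕ → V} (ho : T.LeafOrder l g)

include ho

theorem LeafOrder.ne_of_nextLeaf {u v : V} (h : T.NextLeaf u v) : u ≠ v := by
  obtain ⟨i, rfl, rfl⟩ := ho.exists_of_next u v h
  intro e
  rw [ho.eq_iff] at e
  have h1 : 0 ≡ 1 [MOD l] := Nat.ModEq.add_left_cancel' i e
  exact zero_ne_one (h1.eq_of_lt_of_lt (by have := ho.two_le; omega) ho.two_le)

theorem LeafOrder.closure_adj_of_nextLeaf {u v : V} (h : T.NextLeaf u v) : T.closure.Adj u v :=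
  closure_adj T |>.mpr (Or.inr ⟨ho.ne_of_nextLeaf h, Or.inl h⟩)

theorem LeafOrder.index_of_nextLeaf {a b : ℕ} (h : T.NextLeaf (g a) (g b)) :
    b ≡ a + 1 [MOD l] := by
  obtain ⟨i, h1, h2⟩ := ho.exists_of_next _ _ h
  rw [ho.eq_iff] at h1 h2
  exact h2.symm.trans (h1.add_right 1)

variable {ε : V → ℤ} (hε : ∀ v, ε v = 1 ∨ ε v = -1)
  (halt : ∀ u v, T.closure.Adj u v → ε v = -ε u)

omit ho in
theorem tree_le_closure {u v : V} (h : T.tree.Adj u v) : T.closure.Adj u v :=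
  closure_adj T |>.mpr (Or.inl h)

include hε halt

/-- Two leaves consecutive around a vertex are joined by a rim edge and form a triangle with it,
which alternating signs forbid. -/
theorem LeafOrder.rot_snd_not_isLeaf {d : T.tree.Dart} (hd : ¬ T.IsLeaf d.fst)
    (h : T.IsLeaf d.snd) : ¬ T.IsLeaf (T.rot d).snd := by
  intro h'
  have h1 := halt _ _ (ho.closure_adj_of_nextLeaf ((tip_of_isLeaf h).nextLeaf hd (tip_of_isLeaf h')))
  have h2 := halt _ _ (tree_le_closure d.adj)
  have h3 := halt _ _ (tree_le_closure (T.rot d).adj)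
  rw [T.rot_fst] at h3
  have := hε d.fst
  omega

theorem LeafOrder.exists_internal_adj {u : V} (hu : ¬ T.IsLeaf u) :
    ∃ q, T.tree.Adj u q ∧ ¬ T.IsLeaf q := by
  obtain ⟨par, hpar, -⟩ := exists_parent T.isTree (g 0)
  have h1 := (hpar u fun e => hu (e ▸ ho.isLeaf 0)).1
  by_cases h : T.IsLeaf (par u)
  · let d : T.tree.Dart := ⟨(u, par u), h1⟩
    refine ⟨(T.rot d).snd, ?_, ho.rot_snd_not_isLeaf hε halt (d := d) hu h⟩
    have := (T.rot d).adj
    rwa [T.rot_fst d] at this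
  · exact ⟨_, h1, h⟩

/-- After the only internal neighbour the rotation meets a leaf, and then it cannot meet another
leaf, so it is back at its start: the degree is 2. -/
theorem LeafOrder.exists_isLeg {u q : V} (hu : ¬ T.IsLeaf u) (huq : T.tree.Adj u q)
    (hq : ¬ T.IsLeaf q) (huniq : ∀ p, T.tree.Adj u p → ¬ T.IsLeaf p → p = q) :
    ∃ w, T.IsLeg u w q := by
  let d₀ : T.tree.Dart := ⟨(u, q), huq⟩
  obtain ⟨a, hua, haq⟩ : ∃ a, T.tree.Adj u a ∧ a ≠ q := by
    by_contra hcon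
    push Not at hcon
    exact hu ⟨q, huq, hcon⟩
  have h01 : T.rot d₀ ≠ d₀ := rot_ne (d' := ⟨(u, a), hua⟩) rfl fun e =>
    haq (congrArg (fun d : T.tree.Dart => d.snd) e)
  have hf1 : (T.rot d₀).fst = u := T.rot_fst d₀
  have hf2 : (T.rot (T.rot d₀)).fst = u := (T.rot_fst _).trans hf1
  have hl1 : T.IsLeaf (T.rot d₀).snd := by
    by_contra h
    exact h01 (dart_ext hf1 (huniq _ (hf1 ▸ (T.rot d₀).adj) h))
  have hl2 := ho.rot_snd_not_isLeaf hε halt (d := T.rot d₀) (hf1 ▸ hu) hl1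
  have h2 : T.rot (T.rot d₀) = d₀ :=
    dart_ext hf2 (huniq _ (hf2 ▸ (T.rot (T.rot d₀)).adj) hl2)
  refine ⟨(T.rot d₀).snd, hl1, hq, fun p => ⟨fun hp => ?_, ?_⟩⟩
  · rcases eq_or_eq_of_rot rfl h2 ⟨(u, p), hp⟩ rfl with e | e
    · exact Or.inr (congrArg (fun d : T.tree.Dart => d.snd) e)
    · exact Or.inl (congrArg (fun d : T.tree.Dart => d.snd) e)
  · rintro (rfl | rfl)
    · exact hf1 ▸ (T.rot d₀).adj
    · exact huq

/-- An internal vertex of maximal distance from `x` is a leg. -/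
theorem LeafOrder.exists_isLeg_of_far {x v : V} (hv : ¬ T.IsLeaf v)
    (hmax : ∀ u, ¬ T.IsLeaf u → T.tree.dist x u ≤ T.tree.dist x v) (hne : v ≠ x) :
    ∃ w q, T.IsLeg v w q ∧ T.tree.dist x v = T.tree.dist x q + 1 := by
  obtain ⟨par, hpar, heq⟩ := exists_parent T.isTree x
  have key : ∀ p, T.tree.Adj v p → ¬ T.IsLeaf p → p = par v := by
    intro p hvp hp
    rcases heq v p hvp with h | ⟨h1, h2⟩
    · exact h.2
    · have := hmax p hp
      rw [(hpar p h1).2, ← h2] at this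
      omega
  obtain ⟨q, hvq, hq⟩ := ho.exists_internal_adj hε halt hv
  obtain ⟨w, hw⟩ := ho.exists_isLeg hε halt hv hvq hq fun p hp hp' =>
    (key p hp hp').trans (key q hvq hq).symm
  exact ⟨w, q, hw, by rw [key q hvq hq]; exact (hpar v hne).2⟩

theorem LeafOrder.even_length : Even l ∧ ∑ i ∈ Finset.range l, ε (g i) = 0 := by
  have h1 : ∀ i, ε (g i) = (-1) ^ i * ε (g 0) := by
    intro i
    induction i with
    | zero => simp
    | succ i ih =>
      rw [halt _ _ (ho.closure_adj_of_nextLeaf (ho.next i)), ih, pow_succ]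
      ring
  have hl : Even l := by
    have h2 := h1 l
    rw [(ho.eq_iff l 0).mpr (by simp [Nat.ModEq])] at h2
    by_contra hodd
    rw [Nat.not_even_iff_odd] at hodd
    rw [hodd.neg_one_pow] at h2
    have := hε (g 0)
    omega
  refine ⟨hl, ?_⟩
  rw [Finset.sum_congr rfl fun i _ => h1 i, ← Finset.sum_mul, neg_one_geom_sum, if_pos hl, zero_mul]

/-- The rim alternates in sign, so half the leaves have the sign of c. These are exactly the leaves
hanging at legs, so there are l / 2 legs, each of sign opposite to c, and Σ ε = ±(1 - l / 2). This
is nonzero mod 3 when 3 ∣ l. -/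
theorem LeafOrder.not_dvd_of_star {c : V} (hc : ¬ T.IsLeaf c)
    (hleg : ∀ u, ¬ T.IsLeaf u → u ≠ c → ∃ w, T.IsLeg u w c)
    (hδ : ((∑ v, ε v : ℤ) : ZMod 3) = 0) : ¬ 3 ∣ l := by
  classical
  intro hl
  obtain ⟨par, hr⟩ := T.exists_rooted hc ho
  have hsum := hr.sum_eq_internal_add_leaves ε
  rw [(ho.even_length hε halt).2, add_zero,
    ← Finset.add_sum_erase _ _ (mem_internal.mpr hc)] at hsum
  have hlegs : ∀ u ∈ T.internal.erase c, ε u = -ε c := by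
    intro u hu
    rw [Finset.mem_erase, mem_internal] at hu
    obtain ⟨w, hw⟩ := hleg u hu.2 hu.1
    exact halt _ _ (tree_le_closure hw.adj_internal.symm)
  rw [Finset.sum_congr rfl hlegs, Finset.sum_const, nsmul_eq_mul] at hsum
  have hcard : ((Finset.range l).filter fun i => ε (g i) = ε c).card = (T.internal.erase c).card := by
    refine Finset.card_bij (fun i _ => par (g i)) ?_ ?_ ?_
    · intro i hi
      rw [Finset.mem_filter] at hi
      refine Finset.mem_erase.mpr ⟨fun e => ?_, mem_internal.mpr (hr.par_internal (hr.leaf_ne_root i))⟩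
      have h1 := halt _ _ (tree_le_closure (hr.par_spec _ (hr.leaf_ne_root i)).1)
      rw [e, hi.2] at h1
      have := hε c
      omega
    · intro i hi j hj e
      rw [Finset.mem_filter, Finset.mem_range] at hi hj
      have key : ∀ i, ε (g i) = ε c → ∃ w, T.IsLeg (par (g i)) w c ∧ g i = w := by
        intro i hi
        have hadj := (hr.par_spec _ (hr.leaf_ne_root i)).1
        obtain ⟨w, hw⟩ := hleg (par (g i)) (hr.par_internal (hr.leaf_ne_root i)) fun e => by
          have h1 := halt _ _ (tree_le_closure hadj)
          rw [e, hi] at h1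
          have := hε c
          omega
        exact ⟨w, hw, ((hw.adj_iff _).mp hadj.symm).resolve_right (hr.leaf_ne_root i)⟩
      obtain ⟨w, hw, hiw⟩ := key i hi.2
      refine hr.leaf_inj hi.1 hj.1 ?_
      have hadj := (hr.par_spec _ (hr.leaf_ne_root j)).1.symm
      rw [← e] at hadj
      rw [hiw, ((hw.adj_iff _).mp hadj).resolve_right (hr.leaf_ne_root j)]
    · intro u hu
      rw [Finset.mem_erase, mem_internal] at hu
      obtain ⟨w, hw⟩ := hleg u hu.2 hu.1
      obtain ⟨i, hi, rfl⟩ := hr.exists_index hw.leaf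
      refine ⟨i, Finset.mem_filter.mpr ⟨Finset.mem_range.mpr hi, ?_⟩,
        ((hr.adj_leaf_iff hw.leaf).mp hw.adj_leaf.symm).symm⟩
      have h1 := halt _ _ (tree_le_closure hw.adj_leaf)
      have h2 := halt _ _ (tree_le_closure hw.adj_internal)
      omega
  have htwo : 2 * ((T.internal.erase c).card : ℤ) = l := by
    rw [← hcard, Finset.card_filter, Nat.cast_sum, Finset.mul_sum]
    have h1 : ∀ i ∈ Finset.range l, 2 * (((if ε (g i) = ε c then 1 else 0 : ℕ)) : ℤ) =
        1 + ε c * ε (g i) := by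
      intro i _
      rcases hε c with h1 | h1 <;> rcases hε (g i) with h2 | h2 <;> simp [h1, h2]
    rw [Finset.sum_congr rfl h1, Finset.sum_add_distrib, ← Finset.mul_sum,
      (ho.even_length hε halt).2]
    simp
  have hj : 3 ∣ (T.internal.erase c).card := by omega
  obtain ⟨k, hk⟩ := hj
  rw [hsum, hk, ZMod.intCast_zmod_eq_zero_iff_dvd] at hδ
  have := hε c
  push_cast at hδ
  rcases this with h1 | h1 <;> rw [h1] at hδ <;> omega

/-- If the only neighbours of `c` which are not leaves are `v` and `p`, where `v` is a leg, then
the leaves at `c` are next to the leaf at `v`. -/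
theorem LeafOrder.positions_of_isLeg {v w c p : V} (h : T.IsLeg v w c) (hvp : v ≠ p)
    (honly : ∀ u, T.tree.Adj c u → ¬ T.IsLeaf u → u = v ∨ u = p) (hl : 3 ∣ l) {a : ℕ}
    (ha : g a = w) : ∀ b, T.tree.Adj c (g b) → ¬ a ≡ b [MOD 3] := by
  intro b hb hab
  subst ha
  let e : T.tree.Dart := ⟨(c, g b), hb⟩
  have hc := h.internal
  have hrot : ∀ d : T.tree.Dart, d.fst = c → T.IsLeaf d.snd → (T.rot d).snd = v ∨ (T.rot d).snd = p :=
    fun d hd hleaf => honly _ (by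
      have := (T.rot d).adj
      rwa [T.rot_fst, hd] at this) (ho.rot_snd_not_isLeaf hε halt (hd ▸ hc) hleaf)
  obtain ⟨e', he'⟩ := T.rot.surjective e
  have hfe' : e'.fst = c := by
    have := T.rot_fst e'
    rw [he'] at this
    exact this.symm
  have he's : e'.snd = v ∨ e'.snd = p := by
    refine honly _ (hfe' ▸ e'.adj) fun hleaf => ?_
    have := ho.rot_snd_not_isLeaf hε halt (hfe' ▸ hc) hleaf
    rw [he'] at this
    exact this (ho.isLeaf b)
  have hmod : ∀ {i j : ℕ}, j ≡ i + 1 [MOD l] → ¬ i ≡ j [MOD 3] := by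
    intro i j h1 h2
    have h3 := (h2.trans (h1.of_dvd hl))
    have : 0 ≡ 1 [MOD 3] := Nat.ModEq.add_left_cancel' i h3
    exact absurd this (by decide)
  have htip : ∀ d : T.tree.Dart, d.fst = c → d.snd = v → T.Tip d (g a) 2 := fun d h1 h2 =>
    IsLeg.tip (by rw [h1, h2]; exact h)
  have htipe : T.Tip e (g b) 1 := tip_of_isLeaf (d := e) (ho.isLeaf b)
  have hfre : (T.rot e).fst = c := T.rot_fst e
  -- If the dart after or before `e` leads to v, the two leaf positions differ by 1 modulo l. If
  -- both led to p they would be the same dart, and there would be no room for v around c.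
  rcases hrot e rfl (ho.isLeaf b) with h1 | h1
  · exact hmod (ho.index_of_nextLeaf (htipe.nextLeaf hc (htip _ hfre h1))) hab.symm
  · rcases he's with h2 | h2
    · refine hmod (ho.index_of_nextLeaf ((htip e' hfe' h2).nextLeaf (m' := 1) (hfe' ▸ hc) ?_)) hab
      rw [he']
      exact htipe
    · have h3 : T.rot e = e' := dart_ext (hfre.trans hfe'.symm) (h1.trans h2.symm)
      rcases eq_or_eq_of_rot h3 he' ⟨(c, v), h.adj_internal.symm⟩ rfl with h4 | h4
      · have : v = g b := congrArg (fun d : T.tree.Dart => d.snd) h4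
        exact h.not_isLeaf (this ▸ ho.isLeaf b)
      · have : v = e'.snd := congrArg (fun d : T.tree.Dart => d.snd) h4
        exact hvp (this.trans h2)

end Bipartite

end PlaneTree

end Halin

/-! ### Choice of legs and conclusion -/

namespace Halin

open MvPolynomial

variable {V : Type*} [Fintype V] [DecidableEq V]

namespace PlaneTree

variable {T : PlaneTree V}

theorem IsLeg.internal_unique {e w q p : V} (h : T.IsLeg e w q) (hp : T.tree.Adj e p)
    (hpl : ¬ T.IsLeaf p) : p = q :=
  ((h.adj_iff p).mp hp).resolve_left fun e => hpl (e ▸ h.leaf)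

/-- If `v` is a leg at `c`, farthest from `x`, then the leaves at `c` are next to the leaf at `v`,
or there is another leg at `c`. -/
theorem LeafOrder.positions_or_exists_isLeg {l : ℕ} {g : ℕ → V} (ho : T.LeafOrder l g) {ε : V → ℤ}
    (hε : ∀ v, ε v = 1 ∨ ε v = -1) (halt : ∀ u v, T.closure.Adj u v → ε v = -ε u) (hl : 3 ∣ l)
    {x v w c : V} (h : T.IsLeg v w c)
    (hmax : ∀ u, ¬ T.IsLeaf u → T.tree.dist x u ≤ T.tree.dist x v)
    (hd : T.tree.dist x v = T.tree.dist x c + 1) (hcx : c ≠ x) {a : ℕ} (ha : g a = w) :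
    (∀ b, T.tree.Adj c (g b) → ¬ a ≡ b [MOD 3]) ∨ ∃ v₂ w₂, v₂ ≠ v ∧ T.IsLeg v₂ w₂ c := by
  obtain ⟨par, hpar, heq⟩ := exists_parent T.isTree x
  have hdp := (hpar c hcx).2
  by_cases hsec : ∃ u, T.tree.Adj c u ∧ ¬ T.IsLeaf u ∧ u ≠ v ∧ u ≠ par c
  · obtain ⟨u, hcu, hu, huv, hup⟩ := hsec
    right
    rcases heq c u hcu with h1 | ⟨hux, h1⟩
    · exact absurd h1.2 hup
    · have hdu := (hpar u hux).2
      rw [← h1] at hdu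
      obtain ⟨w₂, q, hw₂, -⟩ := ho.exists_isLeg_of_far hε halt (x := x) hu
        (fun z hz => (hmax z hz).trans (by omega)) hux
      obtain rfl := hw₂.internal_unique hcu.symm h.internal
      exact ⟨u, w₂, huv, hw₂⟩
  · left
    refine ho.positions_of_isLeg hε halt h (p := par c) (fun e => ?_) (fun u hcu hu => ?_) hl ha
    · rw [← e] at hdp
      omega
    · by_contra hcon
      push Not at hcon
      exact hsec ⟨u, hcu, hu, hcon.1, hcon.2⟩

variable [DecidableRel T.closure.Adj]

/-- The ends x, v of a longest path between internal vertices are legs at c', c. When 3 ∣ l, either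
the position criterion applies at an end or each end has a second leg; c = c' contradicts the
balance, and otherwise four legs are available. -/
theorem edgePoly_notMem_of_bipartite (hV : 3 ≤ Fintype.card V) {l : ℕ} {g : ℕ → V}
    (ho : T.LeafOrder l g) {ε : V → ℤ} (hε : ∀ v, ε v = 1 ∨ ε v = -1)
    (halt : ∀ u v, T.closure.Adj u v → ε v = -ε u) (hδ : ((∑ v, ε v : ℤ) : ZMod 3) = 0)
    (hreal : ∀ x : V → MvPolynomial V (ZMod 3), (∀ v, x v ∈ idealOfVars V (ZMod 3)) →
        ∑ v, (ε v : MvPolynomial V (ZMod 3)) * x v = 0 → Realizable T.closure x)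
    (D : Orientation T.closure) :
    edgePoly (ZMod 3) D ∉ cubeIdeal T.closure.edgeSet (ZMod 3) := by
  classical
  obtain ⟨r, hr⟩ := T.exists_internal hV
  obtain ⟨⟨x, v⟩, hxv, hmax⟩ := Finset.exists_max_image (T.internal ×ˢ T.internal)
    (fun p => T.tree.dist p.1 p.2) ⟨(r, r), Finset.mem_product.mpr
      ⟨mem_internal.mpr hr, mem_internal.mpr hr⟩⟩
  rw [Finset.mem_product, mem_internal, mem_internal] at hxv
  obtain ⟨hx, hv⟩ := hxv
  simp only at hx hv
  have hmax : ∀ a b, ¬ T.IsLeaf a → ¬ T.IsLeaf b → T.tree.dist a b ≤ T.tree.dist x v :=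
    fun a b ha hb => hmax (a, b) (Finset.mem_product.mpr ⟨mem_internal.mpr ha, mem_internal.mpr hb⟩)
  have hvx : v ≠ x := by
    rintro rfl
    obtain ⟨q, hq, hq'⟩ := ho.exists_internal_adj hε halt hv
    have := hmax v q hv hq'
    rw [SimpleGraph.dist_eq_one_iff_adj.mpr hq, SimpleGraph.dist_self] at this
    omega
  have hcomm : T.tree.dist v x = T.tree.dist x v := SimpleGraph.dist_comm
  obtain ⟨w, c, hleg, hdc⟩ := ho.exists_isLeg_of_far hε halt hv (fun u hu => hmax x u hx hu) hvx
  obtain ⟨w', c', hleg', hdc'⟩ := ho.exists_isLeg_of_far hε halt (x := v) hx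
    (fun u hu => (hmax v u hv hu).trans hcomm.ge) hvx.symm
  obtain ⟨a, ha⟩ := ho.surj w hleg.leaf
  obtain ⟨a', ha'⟩ := ho.surj w' hleg'.leaf
  by_cases hl2 : l = 2
  · exact hleg.edgePoly_notMem_two ho hl2 hε halt hreal D
  have hl3 : 3 ≤ l := by have := ho.two_le; omega
  -- The two vertices `x` and `v` are not adjacent.
  have hnadj : ¬ T.tree.Adj x v := by
    intro hadj
    have hd1 := SimpleGraph.dist_eq_one_iff_adj.mpr hadj
    obtain ⟨par, hroot⟩ := T.exists_rooted hx ho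
    have key : ∀ i, g i = w ∨ g i = w' := by
      intro i
      have hpadj := (hroot.par_spec _ (hroot.leaf_ne_root i)).1.symm
      have hpint := hroot.par_internal (hroot.leaf_ne_root i)
      have hle := hmax x _ hx hpint
      rw [hd1] at hle
      rcases Nat.eq_zero_or_pos (T.tree.dist x (par (g i))) with h0 | h0
      · have := (T.isTree.connected.dist_eq_zero_iff).mp h0
        rw [← this] at hpadj
        right
        exact ((hleg'.adj_iff _).mp hpadj).resolve_right fun e =>
          hleg'.internal (e ▸ ho.isLeaf i)
      · have h1 := SimpleGraph.dist_eq_one_iff_adj.mp (le_antisymm hle h0)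
        have h2 := hleg'.internal_unique h1 hpint
        have h3 := hleg'.internal_unique hadj hv
        rw [h2, ← h3] at hpadj
        left
        exact ((hleg.adj_iff _).mp hpadj).resolve_right fun e => hleg.internal (e ▸ ho.isLeaf i)
    -- Adjacent x and v would leave only the two leaves w and w', but there are three distinct ones.
    have h01 : g 0 ≠ g 1 := fun e => by have := hroot.leaf_inj (by omega) (by omega) e; omega
    have h02 : g 0 ≠ g 2 := fun e => by have := hroot.leaf_inj (by omega) (by omega) e; omega
    have h12 : g 1 ≠ g 2 := fun e => by have := hroot.leaf_inj (by omega) (by omega) e; omega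
    rcases key 0 with h0 | h0 <;> rcases key 1 with h1 | h1 <;> rcases key 2 with h2 | h2 <;>
      first
      | exact h01 (h0.trans h1.symm)
      | exact h02 (h0.trans h2.symm)
      | exact h12 (h1.trans h2.symm)
  -- A second leg serves as the vertex with exactly one leaf required by the vertex criterion.
  have hpair : ∀ {e w q e' w' q' : V} {a a' : ℕ}, T.IsLeg e w q → T.IsLeg e' w' q' → g a = w →
      g a' = w' → e' ≠ e → e' ≠ q → (¬ 3 ∣ l ∨ a ≡ a' [MOD 3]) →
      edgePoly (ZMod 3) D ∉ cubeIdeal T.closure.edgeSet (ZMod 3) := by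
    intro e w q e' w' q' a a' h h' ha ha' hee heq hab
    refine h.edgePoly_notMem_of_vertex ho hε halt hreal ha h'.not_isLeaf hee heq
      (b := a') (fun t ht => ?_) hab D
    rw [h'.adj_iff, ha']
    exact ⟨fun h => h.resolve_right fun e => h'.internal (e ▸ ht), Or.inl⟩
  have hxc : x ≠ c := by
    rintro rfl
    exact hnadj hleg.adj_internal.symm
  have hvc : v ≠ c' := by
    rintro rfl
    exact hnadj hleg'.adj_internal
  by_cases h3 : ¬ 3 ∣ l
  · exact hpair hleg hleg' ha ha' hvx.symm hxc (Or.inl h3)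
  rw [not_not] at h3
  rcases ho.positions_or_exists_isLeg hε halt h3 hleg (fun u hu => hmax x u hx hu) hdc hxc.symm ha
    with hpos | ⟨v₂, w₂, hv₂, hleg₂⟩
  · exact hleg.edgePoly_notMem_of_positions ho hε halt hreal ha h3 hpos D
  rcases ho.positions_or_exists_isLeg hε halt h3 (x := v) hleg'
    (fun u hu => (hmax v u hv hu).trans hcomm.ge) hdc' hvc.symm ha'
    with hpos | ⟨x₂, y₂, hx₂, hleg₂'⟩
  · exact hleg'.edgePoly_notMem_of_positions ho hε halt hreal ha' h3 hpos D
  have hcleg : ∀ {w q : V}, ¬ T.IsLeg c w q := fun h =>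
    hv₂ ((h.internal_unique hleg₂.adj_internal.symm hleg₂.not_isLeaf).trans
      (h.internal_unique hleg.adj_internal.symm hv).symm)
  have hcc : c ≠ c' := by
    intro hcc
    subst hcc
    -- All internal vertices other than `c` are legs at `c`.
    refine ho.not_dvd_of_star hε halt hleg.internal (fun u hu huc => ?_) hδ h3
    have hxc1 : T.tree.dist x c = 1 := SimpleGraph.dist_eq_one_iff_adj.mpr hleg'.adj_internal
    by_cases hux : u = x
    · exact ⟨w', hux ▸ hleg'⟩
    obtain ⟨par, hpar, -⟩ := exists_parent T.isTree x
    have hdu := hpar u hux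
    have hle := hmax x u hx hu
    rcases Nat.eq_zero_or_pos (T.tree.dist x (par u)) with h0 | h0
    · have h1 := (T.isTree.connected.dist_eq_zero_iff).mp h0
      rw [← h1] at hdu
      exact absurd (hleg'.internal_unique hdu.1.symm hu) huc
    · obtain ⟨w₃, q, hw₃, hq⟩ := ho.exists_isLeg_of_far hε halt (x := x) hu
        (fun z hz => (hmax x z hx hz).trans (by omega)) hux
      have hq1 : T.tree.dist x q = 1 := by omega
      have := hleg'.internal_unique (SimpleGraph.dist_eq_one_iff_adj.mp hq1) hw₃.internal
      exact ⟨w₃, this ▸ hw₃⟩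
  obtain ⟨b, hb⟩ := ho.surj w₂ hleg₂.leaf
  obtain ⟨b', hb'⟩ := ho.surj y₂ hleg₂'.leaf
  have hnc' : ∀ {e w : V}, T.IsLeg e w c' → e ≠ c := fun h e => hcleg (e ▸ h)
  have hcross : ∀ {e w e' w' : V}, T.IsLeg e w c → T.IsLeg e' w' c' → e' ≠ e := by
    rintro e w e' w' h h' rfl
    exact hcc (h'.internal_unique h.adj_internal h.internal)
  have hself₂ : v₂ ≠ c := hleg₂.adj_internal.ne
  have hself₂' : x₂ ≠ c' := hleg₂'.adj_internal.ne
  intro hcon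
  have h1 : ¬ a ≡ b [MOD 3] := fun e => hpair hleg hleg₂ ha hb hv₂ hself₂ (Or.inr e) hcon
  have h2 : ¬ a' ≡ b' [MOD 3] := fun e =>
    hpair hleg' hleg₂' ha' hb' hx₂ hself₂' (Or.inr e) hcon
  have h3 : ¬ a ≡ a' [MOD 3] := fun e =>
    hpair hleg hleg' ha ha' hvx.symm hxc (Or.inr e) hcon
  have h4 : ¬ a ≡ b' [MOD 3] := fun e =>
    hpair hleg hleg₂' ha hb' (hcross hleg hleg₂') (hnc' hleg₂') (Or.inr e) hcon
  have h5 : ¬ b ≡ a' [MOD 3] := fun e =>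
    hpair hleg₂ hleg' hb ha' (hcross hleg₂ hleg') hxc (Or.inr e) hcon
  have h6 : ¬ b ≡ b' [MOD 3] := fun e =>
    hpair hleg₂ hleg₂' hb hb' (hcross hleg₂ hleg₂') (hnc' hleg₂') (Or.inr e) hcon
  -- Pigeonhole: four positions cannot be pairwise incongruent mod 3.
  simp only [Nat.ModEq] at h1 h2 h3 h4 h5 h6
  omega

theorem exists_edgePoly_notMem (hV : 3 ≤ Fintype.card V) (D : Orientation T.closure) :
    ∃ (R : Type) (_ : CommRing R), edgePoly R D ∉ cubeIdeal T.closure.edgeSet R := by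
  obtain ⟨l, g, ho⟩ := T.exists_leafOrder (by omega)
  obtain ⟨r, hr⟩ := T.exists_internal hV
  obtain ⟨par, hroot⟩ := T.exists_rooted hr ho
  rcases realizable_or_exists_sign T.closure_connected V with hreal | ⟨ε, hε, halt, hδ, hreal⟩
  · rcases Nat.even_or_odd l with hl | hl
    · obtain ⟨x, hx, hmem⟩ := hroot.exists_notMem_even hl
      exact ⟨ZMod 3, inferInstance, hroot.edgePoly_notMem (hreal x hx) D (by omega) (Or.inl le_rfl)
        hmem⟩
    · have hl3 : 3 ≤ l := by
        have := ho.two_le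
        rw [Nat.odd_iff] at hl
        omega
      -- The leaf order is shifted so that the two leaves with different parents are the last and
      -- the first. If there are none, all leaves have one neighbour, which becomes the root of a
      -- star.
      by_cases hpar : ∃ k, par (g k) ≠ par (g (k + 1))
      · obtain ⟨k, hk⟩ := hpar
        obtain ⟨n, hn⟩ : ∃ n, l = n + 1 := ⟨l - 1, by omega⟩
        have hs := hroot.shift (k + 1)
        have e : g (n + (k + 1)) = g k := (ho.eq_iff _ _).mpr (by
          rw [show n + (k + 1) = k + l by omega]
          simp [Nat.ModEq])
        obtain ⟨x, hx, hmem⟩ := hs.exists_notMem_odd hl hn (by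
          rw [e, zero_add]
          exact hk)
        exact ⟨ZMod 3, inferInstance, hs.edgePoly_notMem (hreal x hx) D (by omega) (Or.inl le_rfl)
          hmem⟩
      · push Not at hpar
        have hall : ∀ i, par (g i) = par (g 0) := by
          intro i
          induction i with
          | zero => rfl
          | succ i ih => rw [← hpar i, ih]
        obtain ⟨par', hroot'⟩ := T.exists_rooted (hroot.par_internal (hroot.leaf_ne_root 0)) ho
        have hall' : ∀ i, par' (g i) = par (g 0) := fun i => by
          rw [← hall i]
          exact ((hroot'.adj_leaf_iff (ho.isLeaf i)).mp
            ((hroot.adj_leaf_iff (ho.isLeaf i)).mpr rfl)).symm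
        obtain ⟨x, hx, hmem⟩ := hroot'.exists_notMem_star hall' hl3 hl
        exact ⟨ℤ, inferInstance, hroot'.edgePoly_notMem hx D (by omega) (Or.inl le_rfl) hmem⟩
  · exact ⟨ZMod 3, inferInstance, edgePoly_notMem_of_bipartite hV ho hε halt hδ hreal D⟩

end PlaneTree

end Halin

theorem theorem1 {V : Type*} [Fintype V] [DecidableEq V] (G : SimpleGraph V) [DecidableRel G.Adj]
    (hG : Halin.IsGeneralizedHalin G) :
    Halin.HasPermanentNonsingularMatrix G 0 2 ∧ Halin.IsChoosable G 1 3 := by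
  obtain ⟨hV, T, rfl⟩ := hG
  exact Halin.conclusion_of_notMem fun D => T.exists_edgePoly_notMem hV D
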